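/- **Setting.** Let $G$ be a (discrete) group, $s,h:G\to\mathbb Z_2$ homomorphisms, and $\omega:G\times G\to U(1)$ a 2-cocycle, where $g\in G$ acts on $U(1)\subset\mathbb C$, and on $\mathbb C$, trivially if $s(g)=0$ and by complex conjugation if $s(g)=1$. Let $A=\mathbb C[G,\omega,s]$ be the real algebra with complex basis $G$ and multiplication $(xa)(yb)=x\,({}^a y)\,\omega(a,b)\,ab$ for $x,y\in\mathbb C$, $a,b\in G$, graded by $\mathbb Z_2$ so that $g$ has degree $h(g)$. For a real representation $\rho_W$ of $G$ on $W$ by isometries of a quadratic form $Q$, let $A^{(W,Q)}$ be the real algebra generated by $A$ and the vectors $w\in W$ (linearly), with the relations $w^2=Q(w)$, $zw=wz$ for $z\in\mathbb C$, and $gw=(-1)^{h(g)}(\rho_W(g)w)\,g$ for $g\in G$; it is $\mathbb Z_2$-graded, with $g$ of degree $h(g)$ and $w$ of degree $1$. If $W$ is Euclidean with its squared norm as $Q$, write $A^W$. Let $Cl^{p,q}$ be the real Clifford algebra on anticommuting odd generators $e_1,\dots,e_p$ with $e_i^2=-1$ and $\tilde e_1,\dots,\tilde e_q$ with $\tilde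 e_i^2=1$, and let $\hat\otimes$ be the graded tensor product with its total grading. *Classifying spaces.* Let $B=A$ or $B=A^W$ with $W$ Euclidean. A universe for $Cl^{0,1}\hat\otimes B$ is a module $\mathcal U=\bigoplus_{k\in\mathbb N}S_k$ with $S_k$ irreducible submodules of finite real dimension such that every irreducible $Cl^{0,1}\hat\otimes B$-module is isomorphic to infinitely many $S_k$ (for finite $G$ finite-dimensionality is automatic). Let $\rho(b)$ be the action of $1\hat\otimes b$ and $M_0$ the action of $\tilde e_1\hat\otimes1$. Then $K(B)$ is the set of $\mathbb C$-linear operators $M$ on $\mathcal U$ with $M^2=1$, anticommuting with $\rho(w)$ for all $w\in W$ (no condition if $B=A$), for which there is an $n$ such that $M$ preserves $\bigoplus_{k<n}S_k$ and agrees with $M_0$ on $S_k$ for all $k\ge n$. It has the direct limit topology over $n$, the $n$-th stage being topologized as a set of linear operators on the finite-dimensional space $\bigoplus_{k<n}S_k$; it has the base point $M_0$ and the $G$-action $g\cdot M=(-1)^{h(g)}\rho(g)M\rho(g)^{-1}$. **Theorem.** Let $V$ be a $d$-dimensional orthogonal real representation of $G$ with orthonormal basis $b_1,\dots,b_d$ and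 squared norm $Q_V$. Let $V'$ be the Euclidean space $V$ with $\rho_{V'}(g)=(-1)^{s(g)}\rho_V(g)$, and let $V''$ be the representation $V$ with the quadratic form $-Q_V$. 1. There are isomorphisms of $\mathbb Z_2$-graded real algebras $$A^{V\oplus V'}\;\xrightarrow{\ \Phi_1\ }\;A^{(V\oplus V'',\,Q_V\oplus(-Q_V))}\;\xrightarrow{\ \Phi_2\ }\;Cl^{d,0}\,\hat\otimes\,Cl^{0,d}\,\hat\otimes\,A ,$$ where the last factor is the same $A=\mathbb C[G,\omega,s]$, with unchanged cocycle $\omega$ and grading $h$. They can be chosen so that $\Phi_1(a)=a$ for $a\in A$, $\Phi_1(v,0)=(v,0)$ and $\Phi_1(0,v)=i\cdot(0,v)$ for $v\in V$; and $\Phi_2(b_k,0)=1\hat\otimes\tilde e_k\hat\otimes1$, $\Phi_2(0,b_k)=e_k\hat\otimes1\hat\otimes1$, $\Phi_2(z)=1\hat\otimes1\hat\otimes z$ for $z\in\mathbb C$, and, for each $g\in G$, $\Phi_2(g)=x_g\hat\otimes g$ with some even $x_g\in Cl^{d,0}\hat\otimes Cl^{0,d}$. 2. For all universes for $Cl^{0,1}\hat\otimes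 A^{V\oplus V'}$ and for $Cl^{0,1}\hat\otimes A$, the classifying spaces $K(A^{V\oplus V'})$ and $K(A)$ are $G$-homotopy equivalent: there are continuous $G$-equivariant base-point preserving maps in both directions whose composites are homotopic to the identities through $G$-equivariant base-point preserving maps. -/

import Mathlib

open scoped TensorProduct

noncomputable section

namespace FreeFermion

universe u v w

/-! ### Signs and gradings by `ZMod 2` -/

/-- The sign `(-1)^c` of a class `c` modulo 2, as a real number. -/
def sgn (c : ZMod 2) : ℝ := if c = 0 then 1 else -1

@[simp] theorem sgn_zero : sgn 0 = 1 := by simp [sgn]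

@[simp] theorem sgn_one : sgn 1 = -1 := by simp [sgn]

theorem zmod2_cases (a : ZMod 2) : a = 0 ∨ a = 1 := by
  revert a; decide

theorem zmod2_one_add_one : (1 + 1 : ZMod 2) = 0 := by decide

theorem sgn_add (a b : ZMod 2) : sgn (a + b) = sgn a * sgn b := by
  rcases zmod2_cases a with rfl | rfl <;> rcases zmod2_cases b with rfl | rfl <;>
    simp [zmod2_one_add_one]

@[simp] theorem sgn_mul_self (a : ZMod 2) : sgn a * sgn a = 1 := by
  rcases zmod2_cases a with rfl | rfl <;> simp

theorem units_pow_smul {M : Type*} [AddCommGroup M] [Module ℝ M] (c : ZMod 2) (x : M) :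
    ((-1 : ℤˣ) ^ c) • x = sgn c • x := by
  rcases zmod2_cases c with rfl | rfl <;> simp

section Grading

variable {B : Type*} [Ring B] [Algebra ℝ B]

/-- Two subspaces on which a linear map acts as `1` and as `-1`, and which span the algebra,
form a grading as soon as they contain `1` and are multiplied correctly. -/
theorem isInternal_of_parity (ℬ : ZMod 2 → Submodule ℝ B) (σ : B →ₗ[ℝ] B)
    (hσ : ∀ c, ∀ x ∈ ℬ c, σ x = sgn c • x) (hs : ∀ x, ∃ y ∈ ℬ 0, ∃ z ∈ ℬ 1, y + z = x) :
    DirectSum.IsInternal ℬ := by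
  rw [DirectSum.isInternal_submodule_iff_isCompl ℬ (i := 0) (j := 1) (by decide)
    (by ext c; rcases zmod2_cases c with rfl | rfl <;> simp)]
  constructor
  · rw [Submodule.disjoint_def]
    intro x h0 h1
    have e0 := hσ 0 x h0
    have e1 := hσ 1 x h1
    rw [sgn_zero, one_smul] at e0
    rw [sgn_one, e0] at e1
    have h2 : (2 : ℝ) • x = 0 := by
      rw [two_smul]; nth_rewrite 1 [e1]; simp
    exact (smul_eq_zero.mp h2).resolve_left (by norm_num)
  · rw [codisjoint_iff, eq_top_iff]
    intro x _
    obtain ⟨y, hy, z, hz, rfl⟩ := hs x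
    exact Submodule.add_mem_sup hy hz

/-- The graded algebra structure given by `isInternal_of_parity`. -/
@[reducible] def gradedAlgebraOfParity (ℬ : ZMod 2 → Submodule ℝ B) (σ : B →ₗ[ℝ] B)
    (h1 : (1 : B) ∈ ℬ 0) (hmul : ∀ a b, ∀ x ∈ ℬ a, ∀ y ∈ ℬ b, x * y ∈ ℬ (a + b))
    (hσ : ∀ c, ∀ x ∈ ℬ c, σ x = sgn c • x) (hs : ∀ x, ∃ y ∈ ℬ 0, ∃ z ∈ ℬ 1, y + z = x) :
    GradedAlgebra ℬ :=
  letI := (isInternal_of_parity ℬ σ hσ hs).chooseDecomposition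
  { one_mem := h1
    mul_mem := fun {i j} {x y} hx hy => hmul i j x hx y hy }

end Grading

/-! ### The graded tensor product as a graded algebra -/

section TensorGrading

variable {A B : Type*} [Ring A] [Ring B] [Algebra ℝ A] [Algebra ℝ B]
variable (𝒜 : ZMod 2 → Submodule ℝ A) (ℬ : ZMod 2 → Submodule ℝ B)
variable [GradedAlgebra 𝒜] [GradedAlgebra ℬ]

open GradedTensorProduct

/-- The total grading of `A ⊗̂ B`: the part of degree `c` is spanned by the `a ⊗ b` with `a`, `b`
homogeneous of degrees adding up to `c`. -/
def tensorGrade (c : ZMod 2) : Submodule ℝ (𝒜 ᵍ⊗[ℝ] ℬ) :=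
  Submodule.span ℝ {t | ∃ i j, i + j = c ∧ ∃ a ∈ 𝒜 i, ∃ b ∈ ℬ j, t = a ᵍ⊗ₜ[ℝ] b}

variable {𝒜 ℬ} in
theorem tmul_mem_tensorGrade {i j c : ZMod 2} (h : i + j = c) {a : A} {b : B}
    (ha : a ∈ 𝒜 i) (hb : b ∈ ℬ j) : (a ᵍ⊗ₜ[ℝ] b : 𝒜 ᵍ⊗[ℝ] ℬ) ∈ tensorGrade 𝒜 ℬ c :=
  Submodule.subset_span ⟨i, j, h, a, ha, b, hb, rfl⟩

variable {𝒜 ℬ} in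
/-- The rule of signs in `A ⊗̂ B`. -/
theorem tmul_mul_tmul_of_mem {i j : ZMod 2} (a a' : A) (b b' : B) (hb : b ∈ ℬ i) (ha : a' ∈ 𝒜 j) :
    (a ᵍ⊗ₜ[ℝ] b * a' ᵍ⊗ₜ[ℝ] b' : 𝒜 ᵍ⊗[ℝ] ℬ) = sgn (i * j) • ((a * a') ᵍ⊗ₜ[ℝ] (b * b')) := by
  have := tmul_coe_mul_coe_tmul 𝒜 ℬ a ⟨b, hb⟩ ⟨a', ha⟩ b'
  rw [← units_pow_smul]
  exact this

/-- The linear map acting on the part of degree `c` of a graded algebra as `(-1)^c`. -/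
def parityMap : A →ₗ[ℝ] A :=
  (DirectSum.coeLinearMap 𝒜 ∘ₗ DirectSum.lmap (fun c => sgn c • LinearMap.id)) ∘ₗ
    (DirectSum.decomposeLinearEquiv 𝒜).toLinearMap

theorem parityMap_of_mem {c : ZMod 2} {a : A} (ha : a ∈ 𝒜 c) : parityMap 𝒜 a = sgn c • a := by
  lift a to 𝒜 c using ha
  simp [parityMap]

instance tensorGradedAlgebra : GradedAlgebra (tensorGrade 𝒜 ℬ) := by
  refine gradedAlgebraOfParity _
    ((of ℝ 𝒜 ℬ).toLinearMap ∘ₗ TensorProduct.map (parityMap 𝒜) (parityMap ℬ) ∘ₗ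
      (of ℝ 𝒜 ℬ).symm.toLinearMap) ?_ ?_ ?_ ?_
  · exact tmul_mem_tensorGrade (add_zero 0) SetLike.GradedOne.one_mem SetLike.GradedOne.one_mem
  · intro c d x hx y hy
    induction hx using Submodule.span_induction with
    | zero => simp
    | add x x' _ _ h h' => rw [add_mul]; exact add_mem h h'
    | smul r x _ h => rw [smul_mul_assoc]; exact Submodule.smul_mem _ _ h
    | mem x hx =>
      obtain ⟨i, j, rfl, a, ha, b, hb, rfl⟩ := hx
      induction hy using Submodule.span_induction with
      | zero => simp
      | add x x' _ _ h h' => rw [mul_add]; exact add_mem h h'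
      | smul r x _ h => rw [mul_smul_comm]; exact Submodule.smul_mem _ _ h
      | mem y hy =>
        obtain ⟨k, l, rfl, a', ha', b', hb', rfl⟩ := hy
        rw [tmul_mul_tmul_of_mem a a' b b' hb ha']
        exact Submodule.smul_mem _ _ (tmul_mem_tensorGrade (by ring)
          (SetLike.GradedMul.mul_mem ha ha') (SetLike.GradedMul.mul_mem hb hb'))
  · intro c x hx
    induction hx using Submodule.span_induction with
    | zero => simp
    | add x x' _ _ h h' => rw [map_add, h, h', smul_add]
    | smul r x _ h => rw [map_smul, h, smul_comm]
    | mem x hx =>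
      obtain ⟨i, j, rfl, a, ha, b, hb, rfl⟩ := hx
      simp [parityMap_of_mem 𝒜 ha, parityMap_of_mem ℬ hb, sgn_add, TensorProduct.smul_tmul', TensorProduct.tmul_smul, smul_smul]
      rw [← TensorProduct.smul_tmul', map_smul, mul_comm]
  · intro x
    have key : (⊤ : Submodule ℝ (𝒜 ᵍ⊗[ℝ] ℬ)) ≤ tensorGrade 𝒜 ℬ 0 ⊔ tensorGrade 𝒜 ℬ 1 := by
      intro x _
      have hh : ∀ t : A ⊗[ℝ] B, of ℝ 𝒜 ℬ t ∈ tensorGrade 𝒜 ℬ 0 ⊔ tensorGrade 𝒜 ℬ 1 := by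
        intro t
        induction t with
        | zero => simp
        | add x y hx hy => rw [map_add]; exact add_mem hx hy
        | tmul a b =>
          classical
          rw [← DirectSum.sum_support_decompose 𝒜 a, ← DirectSum.sum_support_decompose ℬ b,
            TensorProduct.sum_tmul, map_sum]
          refine Submodule.sum_mem _ fun i _ => ?_
          rw [TensorProduct.tmul_sum, map_sum]
          refine Submodule.sum_mem _ fun j _ => ?_
          have hm := tmul_mem_tensorGrade (𝒜 := 𝒜) (ℬ := ℬ) (i := i) (j := j) rfl
            (DirectSum.decompose 𝒜 a i).2 (DirectSum.decompose ℬ b j).2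
          rcases zmod2_cases (i + j) with h | h
          · exact Submodule.mem_sup_left (h ▸ hm)
          · exact Submodule.mem_sup_right (h ▸ hm)
      exact hh ((of ℝ 𝒜 ℬ).symm x)
    obtain ⟨y, hy, z, hz, h⟩ := Submodule.mem_sup.mp (key (Submodule.mem_top (x := x)))
    exact ⟨y, hy, z, hz, h⟩

end TensorGrading

/-! ### The Clifford algebras `Cl^{p,q}` -/

/-- The quadratic form on `ℝ^{p,q}` with `p` diagonal entries `-1` and `q` diagonal entries `1`. -/
def formPQ (p q : ℕ) : QuadraticForm ℝ (Fin p ⊕ Fin q → ℝ) :=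
  QuadraticMap.weightedSumSquares ℝ (Sum.elim (fun _ => (-1 : ℝ)) (fun _ => (1 : ℝ)))

theorem formPQ_apply (p q : ℕ) (v : Fin p ⊕ Fin q → ℝ) :
    formPQ p q v = ∑ i, -(v (Sum.inl i) * v (Sum.inl i)) + ∑ i, v (Sum.inr i) * v (Sum.inr i) := by
  change QuadraticMap.weightedSumSquares ℝ _ v = _
  rw [QuadraticMap.weightedSumSquares_apply, Fintype.sum_sum_type]
  simp

/-- The real Clifford algebra `Cl^{p,q}`: `p` generators of square `-1`, `q` of square `1`. -/
abbrev Cl (p q : ℕ) : Type := CliffordAlgebra (formPQ p q)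

/-- The grading of `Cl^{p,q}` in which all generators are odd. -/
abbrev clGrade (p q : ℕ) : ZMod 2 → Submodule ℝ (Cl p q) := CliffordAlgebra.evenOdd (formPQ p q)

/-- The generators `e_i` of `Cl^{p,q}`, of square `-1`. -/
def Cl.neg {p q : ℕ} (i : Fin p) : Cl p q :=
  CliffordAlgebra.ι (formPQ p q) (Pi.single (Sum.inl i) 1)

/-- The generators `ẽ_i` of `Cl^{p,q}`, of square `1`. -/
def Cl.pos {p q : ℕ} (i : Fin q) : Cl p q :=
  CliffordAlgebra.ι (formPQ p q) (Pi.single (Sum.inr i) 1)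

theorem Cl.pos_mul_self {p q : ℕ} (i : Fin q) : (Cl.pos i : Cl p q) * Cl.pos i = 1 := by
  classical
  rw [Cl.pos, CliffordAlgebra.ι_sq_scalar, formPQ_apply]
  simp [Pi.single_apply]

theorem Cl.neg_mul_self {p q : ℕ} (i : Fin p) : (Cl.neg i : Cl p q) * Cl.neg i = -1 := by
  classical
  rw [Cl.neg, CliffordAlgebra.ι_sq_scalar, formPQ_apply]
  simp [Pi.single_apply]

theorem Cl.pos_mem {p q : ℕ} (i : Fin q) : (Cl.pos i : Cl p q) ∈ clGrade p q 1 :=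
  CliffordAlgebra.ι_mem_evenOdd_one _ _

/-! ### The twisted group algebra with antilinear elements -/

/-- The action of a class modulo 2 on `ℂ`: trivial for `0`, complex conjugation for `1`. -/
def conjPow (c : ZMod 2) : ℂ ≃ₐ[ℝ] ℂ := if c = 0 then AlgEquiv.refl else Complex.conjAe

theorem conjPow_add (a b : ZMod 2) (z : ℂ) : conjPow (a + b) z = conjPow a (conjPow b z) := by
  rcases zmod2_cases a with rfl | rfl <;> rcases zmod2_cases b with rfl | rfl <;>
    simp [conjPow, zmod2_one_add_one]

@[simp] theorem conjPow_zero (z : ℂ) : conjPow 0 z = z := by simp [conjPow]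

/-- A symmetry group of a free fermionic system: homomorphisms `s` (antilinearity) and `h`
(anticommutation with the Hamiltonian) to `ℤ/2`, and a `U(1)`-valued 2-cocycle `ω` for the action
of `G` on `U(1)` by complex conjugation through `s`. -/
structure SymmetryData (G : Type u) [Group G] where
  /-- the grading by antilinearity -/
  s : G →* Multiplicative (ZMod 2)
  /-- the grading by anticommutation with the Hamiltonian -/
  h : G →* Multiplicative (ZMod 2)
  /-- the 2-cocycle -/
  ω : G → G → Circle
  cocycle : ∀ a b c : G,
    (ω a b : ℂ) * ω (a * b) c = conjPow (s a).toAdd (ω b c) * ω a (b * c)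

namespace SymmetryData

variable {G : Type u} [Group G] (D : SymmetryData G)

/-- `s(g)` as a class modulo 2. -/
def sdeg (g : G) : ZMod 2 := (D.s g).toAdd

/-- `h(g)` as a class modulo 2. -/
def hdeg (g : G) : ZMod 2 := (D.h g).toAdd

@[simp] theorem sdeg_mul (a b : G) : D.sdeg (a * b) = D.sdeg a + D.sdeg b := by simp [sdeg]

@[simp] theorem sdeg_one : D.sdeg 1 = 0 := by simp [sdeg]

@[simp] theorem hdeg_mul (a b : G) : D.hdeg (a * b) = D.hdeg a + D.hdeg b := by simp [hdeg]

@[simp] theorem hdeg_one : D.hdeg 1 = 0 := by simp [hdeg]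

theorem cocycle' (a b c : G) :
    (D.ω a b : ℂ) * D.ω (a * b) c = conjPow (D.sdeg a) (D.ω b c) * D.ω a (b * c) :=
  D.cocycle a b c

theorem ω_one_left (c : G) : (D.ω 1 c : ℂ) = D.ω 1 1 := by
  have := D.cocycle' 1 1 c
  simp only [mul_one, one_mul, sdeg_one, conjPow_zero] at this
  exact (mul_right_cancel₀ (Circle.coe_ne_zero _) this).symm

theorem ω_one_right (a : G) : (D.ω a 1 : ℂ) = conjPow (D.sdeg a) (D.ω 1 1) := by
  have := D.cocycle' a 1 1
  simp only [mul_one] at this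
  exact mul_right_cancel₀ (Circle.coe_ne_zero _) this

/-- The real algebra `ℂ[G,ω,s]`: the complex vector space with basis `G`, with the multiplication
`(x a)(y b) = x (ᵃy) ω(a,b) ab`, where `ᵃy` is `y` or its conjugate according to `s(a)`. -/
def Alg (_D : SymmetryData G) : Type u := G →₀ ℂ

instance : AddCommGroup D.Alg := inferInstanceAs (AddCommGroup (G →₀ ℂ))

instance : Module ℝ D.Alg := inferInstanceAs (Module ℝ (G →₀ ℂ))

/-- The element `x g` of `ℂ[G,ω,s]`. -/
def single (g : G) (x : ℂ) : D.Alg := Finsupp.single g x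

theorem single_add (g : G) (x y : ℂ) : D.single g (x + y) = D.single g x + D.single g y :=
  Finsupp.single_add g x y

@[simp] theorem single_zero (g : G) : D.single g 0 = 0 := Finsupp.single_zero g

theorem smul_single (r : ℝ) (g : G) (x : ℂ) : r • D.single g x = D.single g (r • x) :=
  Finsupp.smul_single r g x

theorem induction {p : D.Alg → Prop} (f : D.Alg) (h0 : p 0) (hadd : ∀ x y, p x → p y → p (x + y))
    (hs : ∀ g x, p (D.single g x)) : p f :=
  Finsupp.induction_linear f h0 hadd hs

/-- A real linear map out of `ℂ[G,ω,s]` is given by its values on the elements `x g`. -/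
def lsum {M : Type*} [AddCommGroup M] [Module ℝ M] (f : G → ℂ →ₗ[ℝ] M) : D.Alg →ₗ[ℝ] M :=
  Finsupp.lsum ℝ f

@[simp] theorem lsum_single {M : Type*} [AddCommGroup M] [Module ℝ M] (f : G → ℂ →ₗ[ℝ] M)
    (g : G) (x : ℂ) : D.lsum f (D.single g x) = f g x :=
  Finsupp.lsum_single ℝ f g x

/-- The inclusion of the real line `ℂ g`. -/
def lsingle (g : G) : ℂ →ₗ[ℝ] D.Alg where
  toFun := D.single g
  map_add' := D.single_add g
  map_smul' r x := (D.smul_single r g x).symm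

@[simp] theorem lsingle_apply (g : G) (x : ℂ) : D.lsingle g x = D.single g x := rfl

/-- The multiplication as a real bilinear map. -/
def mulHom : D.Alg →ₗ[ℝ] D.Alg →ₗ[ℝ] D.Alg :=
  D.lsum fun a => LinearMap.flip <| D.lsum fun b => LinearMap.flip <|
    (((LinearMap.mul ℝ ℂ).compl₂ (conjPow (D.sdeg a)).toLinearMap).compr₂
      (LinearMap.mulRight ℝ (D.ω a b : ℂ))).compr₂ (D.lsingle (a * b))

instance : Mul D.Alg := ⟨fun x y => D.mulHom x y⟩

theorem mul_def (x y : D.Alg) : x * y = D.mulHom x y := rfl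

theorem single_mul_single (a b : G) (x y : ℂ) :
    D.single a x * D.single b y = D.single (a * b) (x * conjPow (D.sdeg a) y * D.ω a b) := by
  rw [mul_def]
  simp [mulHom]

instance : One D.Alg := ⟨D.single 1 (D.ω 1 1 : ℂ)⁻¹⟩

theorem one_def : (1 : D.Alg) = D.single 1 (D.ω 1 1 : ℂ)⁻¹ := rfl

instance : NonUnitalNonAssocRing D.Alg where
  left_distrib a b c := by simp [mul_def]
  right_distrib a b c := by simp [mul_def]
  zero_mul a := by simp [mul_def]
  mul_zero a := by simp [mul_def]

theorem single_one_mul (x : ℂ) (g : G) (y : ℂ) :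
    D.single 1 (x * (D.ω 1 1 : ℂ)⁻¹) * D.single g y = D.single g (x * y) := by
  have h1 : (D.ω 1 1 : ℂ) ≠ 0 := Circle.coe_ne_zero _
  rw [single_mul_single, one_mul, sdeg_one, conjPow_zero, D.ω_one_left g]
  congr 1
  field_simp

theorem single_mul_single_one (x : ℂ) (g : G) (y : ℂ) :
    D.single g y * D.single 1 (x * (D.ω 1 1 : ℂ)⁻¹) =
      D.single g (y * conjPow (D.sdeg g) x) := by
  have h1 : conjPow (D.sdeg g) (D.ω 1 1 : ℂ) ≠ 0 :=
    (map_ne_zero_iff _ (conjPow (D.sdeg g)).injective).mpr (Circle.coe_ne_zero _)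
  rw [single_mul_single, mul_one, D.ω_one_right g, map_mul, map_inv₀]
  congr 1
  field_simp

instance : Ring D.Alg where
  sub_eq_add_neg := sub_eq_add_neg
  mul_assoc a b c := by
    induction a using D.induction with
    | h0 => simp
    | hadd x y hx hy => simp only [add_mul, hx, hy]
    | hs a x =>
    induction b using D.induction with
    | h0 => simp
    | hadd x y hx hy => simp only [add_mul, mul_add, hx, hy]
    | hs b y =>
    induction c using D.induction with
    | h0 => simp
    | hadd x y hx hy => simp only [mul_add, hx, hy]
    | hs c z =>
    simp only [single_mul_single, mul_assoc a b c, map_mul, sdeg_mul, conjPow_add]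
    congr 1
    linear_combination (x * conjPow (D.sdeg a) y * conjPow (D.sdeg a) (conjPow (D.sdeg b) z)) *
      D.cocycle' a b c
  one_mul a := by
    induction a using D.induction with
    | h0 => simp
    | hadd x y hx hy => simp only [mul_add, hx, hy]
    | hs a x => simpa [one_def] using D.single_one_mul 1 a x
  mul_one a := by
    induction a using D.induction with
    | h0 => simp
    | hadd x y hx hy => simp only [add_mul, hx, hy]
    | hs a x => simpa [one_def] using D.single_mul_single_one 1 a x
  neg_add_cancel := neg_add_cancel
  zsmul := zsmulRec

instance : Algebra ℝ D.Alg :=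
  Algebra.ofModule
    (fun r a b => by rw [mul_def, mul_def, map_smul, LinearMap.smul_apply])
    (fun r a b => by rw [mul_def, mul_def, map_smul])

/-- The group element `g` as an element of `ℂ[G,ω,s]`. -/
def of (g : G) : D.Alg := D.single g 1

/-- The inclusion of `ℂ` into `ℂ[G,ω,s]`. -/
def scalar : ℂ →ₐ[ℝ] D.Alg :=
  AlgHom.ofLinearMap
    { toFun := fun z => D.single 1 (z * (D.ω 1 1 : ℂ)⁻¹)
      map_add' := fun x y => by rw [add_mul, single_add]
      map_smul' := fun r x => by rw [RingHom.id_apply, smul_single, smul_mul_assoc] }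
    (by simp [one_def])
    (fun x y => by
      change D.single 1 _ = D.single 1 _ * D.single 1 _
      rw [single_one_mul, mul_assoc])

theorem scalar_apply (z : ℂ) : D.scalar z = D.single 1 (z * (D.ω 1 1 : ℂ)⁻¹) := rfl

theorem of_mul_of (a b : G) : D.of a * D.of b = D.scalar (D.ω a b) * D.of (a * b) := by
  rw [of, of, of, single_mul_single, scalar_apply, single_one_mul]
  simp

theorem of_mul_scalar (g : G) (z : ℂ) :
    D.of g * D.scalar z = D.scalar (conjPow (D.sdeg g) z) * D.of g := by
  rw [of, scalar_apply, scalar_apply, single_one_mul, single_mul_single_one, one_mul, mul_one]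

theorem single_eq (g : G) (z : ℂ) : D.single g z = D.scalar z * D.of g := by
  rw [of, scalar_apply, single_one_mul, mul_one]

theorem of_one : D.of 1 = D.scalar (D.ω 1 1) := by
  rw [of, scalar_apply, mul_inv_cancel₀ (Circle.coe_ne_zero _)]

/-- The group element `g` as a unit of `ℂ[G,ω,s]`. -/
def unit (g : G) : D.Algˣ where
  val := D.of g
  inv := D.scalar ((D.ω 1 1 : ℂ)⁻¹ * (D.ω g⁻¹ g : ℂ)⁻¹) * D.of g⁻¹
  val_inv := by
    have h1 : conjPow (D.sdeg g) (D.ω 1 1 : ℂ) ≠ 0 :=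
      (map_ne_zero_iff _ (conjPow (D.sdeg g)).injective).mpr (Circle.coe_ne_zero _)
    have h2 : conjPow (D.sdeg g) (D.ω g⁻¹ g : ℂ) ≠ 0 :=
      (map_ne_zero_iff _ (conjPow (D.sdeg g)).injective).mpr (Circle.coe_ne_zero _)
    have := D.cocycle' g g⁻¹ g
    rw [mul_inv_cancel, inv_mul_cancel, D.ω_one_left g, D.ω_one_right g] at this
    rw [← mul_assoc, of_mul_scalar, mul_assoc, of_mul_of, mul_inv_cancel, of_one, ← map_mul,
      ← map_mul, this, ← map_one D.scalar]
    congr 1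
    simp only [map_mul, map_inv₀]
    field_simp
  inv_val := by
    have h1 : (D.ω 1 1 : ℂ) ≠ 0 := Circle.coe_ne_zero _
    have h2 : (D.ω g⁻¹ g : ℂ) ≠ 0 := Circle.coe_ne_zero _
    rw [mul_assoc, of_mul_of, inv_mul_cancel, of_one, ← map_mul, ← map_mul, ← map_one D.scalar]
    congr 1
    field_simp

@[simp] theorem unit_val (g : G) : (D.unit g : D.Alg) = D.of g := rfl

/-- The grading of `ℂ[G,ω,s]`: the part of degree `c` consists of the combinations of the `g`
with `h(g) = c`. -/
def grade (c : ZMod 2) : Submodule ℝ D.Alg :=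
  Submodule.span ℝ {t | ∃ g x, D.hdeg g = c ∧ t = D.single g x}

theorem single_mem_grade {c : ZMod 2} {g : G} (h : D.hdeg g = c) (x : ℂ) :
    D.single g x ∈ D.grade c :=
  Submodule.subset_span ⟨g, x, h, rfl⟩

theorem of_mem_grade (g : G) : D.of g ∈ D.grade (D.hdeg g) := D.single_mem_grade rfl 1

theorem scalar_mem_grade (z : ℂ) : D.scalar z ∈ D.grade 0 := D.single_mem_grade D.hdeg_one _

theorem grade_mul {a b : ZMod 2} {x y : D.Alg} (hx : x ∈ D.grade a) (hy : y ∈ D.grade b) :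
    x * y ∈ D.grade (a + b) := by
  induction hx using Submodule.span_induction with
  | zero => simp
  | add x x' _ _ h h' => rw [add_mul]; exact add_mem h h'
  | smul r x _ h => rw [smul_mul_assoc]; exact Submodule.smul_mem _ _ h
  | mem x hx =>
    obtain ⟨g, z, rfl, rfl⟩ := hx
    induction hy using Submodule.span_induction with
    | zero => simp
    | add x x' _ _ h h' => rw [mul_add]; exact add_mem h h'
    | smul r x _ h => rw [mul_smul_comm]; exact Submodule.smul_mem _ _ h
    | mem y hy =>
      obtain ⟨g', z', rfl, rfl⟩ := hy
      rw [single_mul_single]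
      exact D.single_mem_grade (D.hdeg_mul g g') _

/-- The linear map multiplying `g` by `(-1)^{h(g)}`. -/
def parityLin : D.Alg →ₗ[ℝ] D.Alg := D.lsum fun g => sgn (D.hdeg g) • D.lsingle g

theorem parityLin_single (g : G) (z : ℂ) :
    D.parityLin (D.single g z) = sgn (D.hdeg g) • D.single g z := by
  simp [parityLin]

/-- The automorphism of `ℂ[G,ω,s]` multiplying `g` by `(-1)^{h(g)}`. -/
def parity : D.Alg →ₐ[ℝ] D.Alg :=
  AlgHom.ofLinearMap D.parityLin
    (by rw [one_def, parityLin_single, hdeg_one, sgn_zero, one_smul])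
    (fun x y => by
      induction x using D.induction with
      | h0 => simp
      | hadd x y hx hy => simp only [add_mul, map_add, hx, hy]
      | hs a x =>
      induction y using D.induction with
      | h0 => simp
      | hadd x y hx hy => simp only [mul_add, map_add, hx, hy]
      | hs b y =>
      rw [single_mul_single, parityLin_single, parityLin_single, parityLin_single, hdeg_mul,
        sgn_add, smul_mul_smul_comm, single_mul_single])

theorem parity_single (g : G) (z : ℂ) :
    D.parity (D.single g z) = sgn (D.hdeg g) • D.single g z :=
  D.parityLin_single g z

theorem parity_of_mem {c : ZMod 2} {x : D.Alg} (hx : x ∈ D.grade c) :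
    D.parity x = sgn c • x := by
  induction hx using Submodule.span_induction with
  | zero => simp
  | add x x' _ _ h h' => rw [map_add, h, h', smul_add]
  | smul r x _ h => rw [map_smul, h, smul_comm]
  | mem x hx =>
    obtain ⟨g, z, rfl, rfl⟩ := hx
    rw [parity_single]

theorem parity_parity (x : D.Alg) : D.parity (D.parity x) = x := by
  induction x using D.induction with
  | h0 => simp
  | hadd x y hx hy => simp only [map_add, hx, hy]
  | hs a x => rw [parity_single, map_smul, parity_single, smul_smul, sgn_mul_self, one_smul]

instance : GradedAlgebra D.grade :=
  gradedAlgebraOfParity _ D.parity.toLinearMap (D.single_mem_grade D.hdeg_one _)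
    (fun _ _ _ hx _ hy => D.grade_mul hx hy) (fun _ _ hx => D.parity_of_mem hx)
    (fun x => by
      induction x using D.induction with
      | h0 => exact ⟨0, zero_mem _, 0, zero_mem _, add_zero 0⟩
      | hadd x y hx hy =>
        obtain ⟨a, ha, b, hb, rfl⟩ := hx
        obtain ⟨c, hc, d, hd, rfl⟩ := hy
        exact ⟨a + c, add_mem ha hc, b + d, add_mem hb hd, add_add_add_comm a c b d⟩
      | hs g x =>
        rcases zmod2_cases (D.hdeg g) with h | h
        · exact ⟨_, D.single_mem_grade h x, 0, zero_mem _, add_zero _⟩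
        · exact ⟨0, zero_mem _, _, D.single_mem_grade h x, zero_add _⟩)

end SymmetryData

/-! ### The algebra `A^{(V,Q)}` of Dirac Hamiltonians -/

section Dirac

variable {G : Type u} [Group G] (D : SymmetryData G)
variable {V : Type v} [AddCommGroup V] [Module ℝ V]
variable (Q : QuadraticForm ℝ V) (ρ : Representation ℝ G V)

/-- The defining relations of `A^{(V,Q)}` between the elements `a` of `A = ℂ[G,ω,s]` and the
vectors `v` of `V`: those of the algebra `A` and of the vector space `V`, the Clifford relation
`v² = Q(v)`, complex numbers commute with vectors, and `g v = (-1)^{h(g)} (ρ(g)v) g`. -/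
inductive DiracAlg.Rel : FreeAlgebra ℝ (D.Alg ⊕ V) → FreeAlgebra ℝ (D.Alg ⊕ V) → Prop
  | alg_add (a b : D.Alg) : DiracAlg.Rel (FreeAlgebra.ι ℝ (Sum.inl (a + b)))
      (FreeAlgebra.ι ℝ (Sum.inl a) + FreeAlgebra.ι ℝ (Sum.inl b))
  | alg_mul (a b : D.Alg) : DiracAlg.Rel (FreeAlgebra.ι ℝ (Sum.inl (a * b)))
      (FreeAlgebra.ι ℝ (Sum.inl a) * FreeAlgebra.ι ℝ (Sum.inl b))
  | alg_real (r : ℝ) : DiracAlg.Rel (FreeAlgebra.ι ℝ (Sum.inl (algebraMap ℝ D.Alg r)))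
      (algebraMap ℝ _ r)
  | vec_add (v w : V) : DiracAlg.Rel (FreeAlgebra.ι ℝ (Sum.inr (v + w)))
      (FreeAlgebra.ι ℝ (Sum.inr v) + FreeAlgebra.ι ℝ (Sum.inr w))
  | vec_smul (r : ℝ) (v : V) : DiracAlg.Rel (FreeAlgebra.ι ℝ (Sum.inr (r • v)))
      (r • FreeAlgebra.ι ℝ (Sum.inr v))
  | clifford (v : V) : DiracAlg.Rel
      (FreeAlgebra.ι ℝ (Sum.inr v) * FreeAlgebra.ι ℝ (Sum.inr v)) (algebraMap ℝ _ (Q v))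
  | scalar_comm (z : ℂ) (v : V) : DiracAlg.Rel
      (FreeAlgebra.ι ℝ (Sum.inl (D.scalar z)) * FreeAlgebra.ι ℝ (Sum.inr v))
      (FreeAlgebra.ι ℝ (Sum.inr v) * FreeAlgebra.ι ℝ (Sum.inl (D.scalar z)))
  | group_comm (g : G) (v : V) : DiracAlg.Rel
      (FreeAlgebra.ι ℝ (Sum.inl (D.of g)) * FreeAlgebra.ι ℝ (Sum.inr v))
      (sgn (D.hdeg g) •
        (FreeAlgebra.ι ℝ (Sum.inr (ρ g v)) * FreeAlgebra.ι ℝ (Sum.inl (D.of g))))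

/-- The algebra `A^{(V,Q)}` generated by `A = ℂ[G,ω,s]` and the vectors of `V`, for a
representation `ρ` of `G` on `V` by isometries of the quadratic form `Q`. -/
def DiracAlg : Type (max u v) := RingQuot (DiracAlg.Rel D Q ρ)

namespace DiracAlg

instance : Ring (DiracAlg D Q ρ) := inferInstanceAs (Ring (RingQuot _))

instance : Algebra ℝ (DiracAlg D Q ρ) := inferInstanceAs (Algebra ℝ (RingQuot _))

/-- The projection from the free algebra. -/
def mk : FreeAlgebra ℝ (D.Alg ⊕ V) →ₐ[ℝ] DiracAlg D Q ρ := RingQuot.mkAlgHom ℝ _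

variable {D Q ρ} in
theorem mk_rel {x y : FreeAlgebra ℝ (D.Alg ⊕ V)} (h : DiracAlg.Rel D Q ρ x y) :
    mk D Q ρ x = mk D Q ρ y :=
  RingQuot.mkAlgHom_rel ℝ h

/-- The canonical homomorphism from `A` to `A^{(V,Q)}`. -/
def incl : D.Alg →ₐ[ℝ] DiracAlg D Q ρ where
  toFun a := mk D Q ρ (FreeAlgebra.ι ℝ (Sum.inl a))
  map_one' := by
    have := mk_rel (Q := Q) (ρ := ρ) (Rel.alg_real (D := D) 1)
    rwa [map_one, map_one, map_one] at this
  map_mul' a b := by rw [mk_rel (Rel.alg_mul a b), map_mul]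
  map_zero' := by
    have := mk_rel (Q := Q) (ρ := ρ) (Rel.alg_real (D := D) 0)
    rwa [map_zero, map_zero, map_zero] at this
  map_add' a b := by rw [mk_rel (Rel.alg_add a b), map_add]
  commutes' r := by rw [mk_rel (Rel.alg_real r), AlgHom.commutes]

/-- The generators of `A^{(V,Q)}` coming from the vectors of `V`. -/
def vec : V →ₗ[ℝ] DiracAlg D Q ρ where
  toFun v := mk D Q ρ (FreeAlgebra.ι ℝ (Sum.inr v))
  map_add' v w := by rw [mk_rel (Rel.vec_add v w), map_add]
  map_smul' r v := by rw [mk_rel (Rel.vec_smul r v), map_smul, RingHom.id_apply]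

theorem vec_mul_self (v : V) : vec D Q ρ v * vec D Q ρ v = algebraMap ℝ _ (Q v) := by
  have := mk_rel (D := D) (ρ := ρ) (Rel.clifford (Q := Q) v)
  rwa [map_mul, AlgHom.commutes] at this

theorem scalar_mul_vec (z : ℂ) (v : V) :
    incl D Q ρ (D.scalar z) * vec D Q ρ v = vec D Q ρ v * incl D Q ρ (D.scalar z) := by
  have := mk_rel (Q := Q) (ρ := ρ) (Rel.scalar_comm (D := D) z v)
  rwa [map_mul, map_mul] at this

theorem of_mul_vec (g : G) (v : V) :
    incl D Q ρ (D.of g) * vec D Q ρ v =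
      sgn (D.hdeg g) • (vec D Q ρ (ρ g v) * incl D Q ρ (D.of g)) := by
  have := mk_rel (Q := Q) (ρ := ρ) (Rel.group_comm (D := D) g v)
  rwa [map_mul, map_smul, map_mul] at this

section Lift

variable {D Q ρ}
variable {B : Type*} [Ring B] [Algebra ℝ B] (f : D.Alg →ₐ[ℝ] B) (φ : V →ₗ[ℝ] B)
  (h1 : ∀ v, φ v * φ v = algebraMap ℝ B (Q v))
  (h2 : ∀ z v, f (D.scalar z) * φ v = φ v * f (D.scalar z))
  (h3 : ∀ g v, f (D.of g) * φ v = sgn (D.hdeg g) • (φ (ρ g v) * f (D.of g)))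

/-- The universal property of `A^{(V,Q)}`. -/
def lift : DiracAlg D Q ρ →ₐ[ℝ] B :=
  RingQuot.liftAlgHom ℝ ⟨FreeAlgebra.lift ℝ (Sum.elim f φ), by
    intro x y h
    induction h <;> simp_all⟩

@[simp] theorem lift_incl (a : D.Alg) : lift f φ h1 h2 h3 (incl D Q ρ a) = f a := by
  refine (RingQuot.liftAlgHom_mkAlgHom_apply ℝ _ _ _).trans ?_
  simp

@[simp] theorem lift_vec (v : V) : lift f φ h1 h2 h3 (vec D Q ρ v) = φ v := by
  refine (RingQuot.liftAlgHom_mkAlgHom_apply ℝ _ _ _).trans ?_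
  simp

theorem hom_ext {f g : DiracAlg D Q ρ →ₐ[ℝ] B} (h : ∀ a, f (incl D Q ρ a) = g (incl D Q ρ a))
    (h' : ∀ v, f (vec D Q ρ v) = g (vec D Q ρ v)) : f = g := by
  refine RingQuot.ringQuot_ext' (S := ℝ) _ _ ?_
  refine FreeAlgebra.hom_ext ?_
  funext x
  rcases x with a | v
  · exact h a
  · exact h' v

end Lift

/-- The parity automorphism of `A^{(V,Q)}`: it multiplies `g` by `(-1)^{h(g)}` and the vectors
of `V` by `-1`. -/
def parity : DiracAlg D Q ρ →ₐ[ℝ] DiracAlg D Q ρ :=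
  lift ((incl D Q ρ).comp D.parity) (-vec D Q ρ)
    (fun v => by simp [vec_mul_self])
    (fun z v => by
      simp [D.parity_of_mem (D.scalar_mem_grade z), scalar_mul_vec])
    (fun g v => by
      simp [D.parity_of_mem (D.of_mem_grade g), of_mul_vec])

@[simp] theorem parity_incl (a : D.Alg) :
    parity D Q ρ (incl D Q ρ a) = incl D Q ρ (D.parity a) := by simp [parity]

@[simp] theorem parity_vec (v : V) : parity D Q ρ (vec D Q ρ v) = -vec D Q ρ v := by
  simp [parity]

theorem parity_parity (x : DiracAlg D Q ρ) : parity D Q ρ (parity D Q ρ x) = x := by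
  have : (parity D Q ρ).comp (parity D Q ρ) = AlgHom.id ℝ _ :=
    hom_ext (fun a => by simp [D.parity_parity]) (fun v => by simp)
  exact DFunLike.congr_fun this x

/-- The grading of `A^{(V,Q)}` in which `g` has degree `h(g)` and the vectors of `V` have
degree 1: the part of degree `c` is the eigenspace of the parity automorphism for `(-1)^c`. -/
def grade (c : ZMod 2) : Submodule ℝ (DiracAlg D Q ρ) where
  carrier := {x | parity D Q ρ x = sgn c • x}
  add_mem' {x y} hx hy := by
    rw [Set.mem_ofPred_eq] at *
    rw [map_add, hx, hy, smul_add]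
  zero_mem' := by simp
  smul_mem' r x hx := by
    rw [Set.mem_ofPred_eq] at *
    rw [map_smul, hx, smul_comm]

variable {D Q ρ} in
theorem mem_grade {c : ZMod 2} {x : DiracAlg D Q ρ} :
    x ∈ grade D Q ρ c ↔ parity D Q ρ x = sgn c • x := Iff.rfl

theorem vec_mem_grade (v : V) : vec D Q ρ v ∈ grade D Q ρ 1 := by
  simp [mem_grade]

theorem incl_mem_grade {c : ZMod 2} {a : D.Alg} (ha : a ∈ D.grade c) :
    incl D Q ρ a ∈ grade D Q ρ c := by
  simp [mem_grade, D.parity_of_mem ha]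

instance : GradedAlgebra (grade D Q ρ) :=
  gradedAlgebraOfParity _ (parity D Q ρ).toLinearMap (by simp [mem_grade])
    (fun a b x hx y hy => by
      rw [mem_grade] at *
      rw [map_mul, hx, hy, sgn_add, smul_mul_smul_comm])
    (fun _ _ hx => hx)
    (fun x => by
      refine ⟨(1 / 2 : ℝ) • (x + parity D Q ρ x), ?_, (1 / 2 : ℝ) • (x - parity D Q ρ x), ?_, ?_⟩
      · rw [mem_grade, map_smul, map_add, parity_parity, sgn_zero, one_smul, add_comm]
      · rw [mem_grade, map_smul, map_sub, parity_parity, sgn_one, neg_one_smul, ← smul_neg,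
          neg_sub]
      · rw [← smul_add, add_add_sub_cancel, ← two_smul ℝ x, smul_smul]
        norm_num)

end DiracAlg

end Dirac

/-- The twist of a representation by the signs `(-1)^{χ(g)}`. -/
def signTwist {G : Type u} [Group G] {V : Type v} [AddCommGroup V] [Module ℝ V]
    (χ : G →* Multiplicative (ZMod 2)) (ρ : Representation ℝ G V) : Representation ℝ G V where
  toFun g := sgn (χ g).toAdd • ρ g
  map_one' := by simp
  map_mul' a b := by
    rw [map_mul χ, map_mul ρ, toAdd_mul, sgn_add, smul_mul_smul_comm]

/-- The squared norm of a Euclidean space as a quadratic form. -/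
def normSqForm (V : Type v) [NormedAddCommGroup V] [InnerProductSpace ℝ V] :
    QuadraticForm ℝ V :=
  LinearMap.BilinMap.toQuadraticMap (innerₗ V)

theorem normSqForm_apply {V : Type v} [NormedAddCommGroup V] [InnerProductSpace ℝ V] (v : V) :
    normSqForm V v = ‖v‖ ^ 2 :=
  real_inner_self_eq_norm_sq v

/-- The quadratic form of the orthogonal sum `V ⊕ V'` of two copies of a Euclidean space. -/
abbrev sumForm (V : Type v) [NormedAddCommGroup V] [InnerProductSpace ℝ V] :
    QuadraticForm ℝ (V × V) :=
  (normSqForm V).prod (normSqForm V)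

/-- The quadratic form of `V ⊕ V''`, where `V''` is a copy of `V` with the negated form. -/
abbrev diffForm (V : Type v) [NormedAddCommGroup V] [InnerProductSpace ℝ V] :
    QuadraticForm ℝ (V × V) :=
  (normSqForm V).prod (-normSqForm V)

/-- The representation `V ⊕ V'`, where `ρ_{V'}(g) = (-1)^{s(g)} ρ_V(g)`. -/
abbrev sumRep {G : Type u} [Group G] (D : SymmetryData G) {V : Type v} [AddCommGroup V]
    [Module ℝ V] (ρ : Representation ℝ G V) : Representation ℝ G (V × V) :=
  ρ.prod (signTwist D.s ρ)

/-! ### Universes and classifying spaces -/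

/-- A universe for a real algebra `R`: an `R`-module with a decomposition into a sequence of
finite dimensional irreducible submodules in which every irreducible `R`-module occurs infinitely
often. (Every irreducible `R`-module is of the form `R ⧸ I`.) -/
structure UniverseDecomposition (R : Type u) [Ring R] [Algebra ℝ R] (U : Type v) [AddCommGroup U]
    [Module ℝ U] [Module R U] [IsScalarTower ℝ R U] where
  /-- the irreducible summands -/
  summand : ℕ → Submodule R U
  internal : DirectSum.IsInternal summand
  simple : ∀ k, IsSimpleModule R (summand k)
  finite : ∀ k, FiniteDimensional ℝ (summand k)
  infinite : ∀ I : Submodule R R, IsSimpleModule R (R ⧸ I) →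
    {k | Nonempty (summand k ≃ₗ[R] (R ⧸ I))}.Infinite

namespace UniverseDecomposition

variable {R : Type u} [Ring R] [Algebra ℝ R] {U : Type v} [AddCommGroup U]
  [Module ℝ U] [Module R U] [IsScalarTower ℝ R U] (𝒮 : UniverseDecomposition R U)

/-- The finite dimensional submodule given by the sum of the first `n` summands. -/
def initial (n : ℕ) : Submodule R U := ⨆ k, ⨆ _ : k < n, 𝒮.summand k

theorem initial_mono {m n : ℕ} (h : m ≤ n) : 𝒮.initial m ≤ 𝒮.initial n :=
  iSup₂_le fun k hk => le_iSup₂_of_le k (hk.trans_le h) le_rfl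

end UniverseDecomposition

/-- A graded algebra `ℬ` with a graded homomorphism `j` from `A = ℂ[G,ω,s]` and a set `E` of odd
elements which is stable, up to the sign `(-1)^{h(g)}`, under conjugation by the group elements. -/
class IsSymmetryExtension {G : Type u} [Group G] (D : SymmetryData G) {B : Type v} [Ring B]
    [Algebra ℝ B] (ℬ : ZMod 2 → Submodule ℝ B) (j : D.Alg →ₐ[ℝ] B) (E : Set B) : Prop where
  map_mem : ∀ c, ∀ a ∈ D.grade c, j a ∈ ℬ c
  gen_mem : ∀ e ∈ E, e ∈ ℬ 1
  gen_comm : ∀ z, ∀ e ∈ E, j (D.scalar z) * e = e * j (D.scalar z)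
  gen_conj : ∀ g, ∀ e ∈ E, ∃ e' ∈ E, e * j (D.of g) = sgn (D.hdeg g) • (j (D.of g) * e')

instance {G : Type u} [Group G] (D : SymmetryData G) :
    IsSymmetryExtension D D.grade (AlgHom.id ℝ D.Alg) ∅ where
  map_mem _ _ h := h
  gen_mem := by simp
  gen_comm := by simp
  gen_conj := by simp

instance {G : Type u} [Group G] (D : SymmetryData G) {V : Type v} [AddCommGroup V] [Module ℝ V]
    (Q : QuadraticForm ℝ V) (ρ : Representation ℝ G V) :
    IsSymmetryExtension D (DiracAlg.grade D Q ρ) (DiracAlg.incl D Q ρ)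
      (Set.range (DiracAlg.vec D Q ρ)) where
  map_mem _ _ h := DiracAlg.incl_mem_grade D Q ρ h
  gen_mem := by
    rintro _ ⟨v, rfl⟩
    exact DiracAlg.vec_mem_grade D Q ρ v
  gen_comm := by
    rintro z _ ⟨v, rfl⟩
    exact DiracAlg.scalar_mul_vec D Q ρ z v
  gen_conj := by
    rintro g _ ⟨v, rfl⟩
    refine ⟨_, ⟨ρ g⁻¹ v, rfl⟩, ?_⟩
    rw [DiracAlg.of_mul_vec, smul_smul, sgn_mul_self, one_smul, ← Module.End.mul_apply, ← map_mul,
      mul_inv_cancel, map_one, Module.End.one_apply]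

/-- The algebra `Cl^{0,1} ⊗̂ B` of a graded algebra together with a Hamiltonian. -/
abbrev Ham {B : Type v} [Ring B] [Algebra ℝ B] (ℬ : ZMod 2 → Submodule ℝ B) [GradedAlgebra ℬ] :
    Type v :=
  (clGrade 0 1) ᵍ⊗[ℝ] ℬ

section Classifying

variable {G : Type u} [Group G] (D : SymmetryData G)
variable {B : Type v} [Ring B] [Algebra ℝ B] (ℬ : ZMod 2 → Submodule ℝ B) [GradedAlgebra ℬ]
variable (j : D.Alg →ₐ[ℝ] B) (E : Set B)
variable {U : Type w} [AddCommGroup U] [Module ℝ U] [Module (Ham ℬ) U] [IsScalarTower ℝ (Ham ℬ) U]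

variable (U) in
/-- The representation of `B` on a module over `Cl^{0,1} ⊗̂ B`. -/
def rep : B →ₐ[ℝ] Module.End ℝ U :=
  (Algebra.lsmul ℝ ℝ U).comp (GradedTensorProduct.includeRight (clGrade 0 1) ℬ)

theorem rep_apply (b : B) (u : U) :
    rep ℬ U b u = ((1 : Cl 0 1) ᵍ⊗ₜ[ℝ] b : Ham ℬ) • u := rfl

variable (U) in
/-- The trivial Hamiltonian: the action of the generator `ẽ₁` of `Cl^{0,1}`. -/
def trivialHam : Module.End ℝ U :=
  Algebra.lsmul ℝ ℝ U (((Cl.pos 0 : Cl 0 1) ᵍ⊗ₜ[ℝ] (1 : B) : Ham ℬ))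

theorem trivialHam_apply (u : U) :
    trivialHam ℬ U u = ((Cl.pos 0 : Cl 0 1) ᵍ⊗ₜ[ℝ] (1 : B) : Ham ℬ) • u := rfl

theorem trivialHam_mul_self : trivialHam ℬ U * trivialHam ℬ U = 1 := by
  rw [trivialHam, ← map_mul,
    tmul_mul_tmul_of_mem _ _ _ _ (SetLike.GradedOne.one_mem (A := ℬ)) (Cl.pos_mem 0)]
  rw [zero_mul, sgn_zero, one_smul, Cl.pos_mul_self, one_mul]
  exact map_one _

theorem trivialHam_mul_rep {c : ZMod 2} {b : B} (hb : b ∈ ℬ c) :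
    trivialHam ℬ U * rep ℬ U b = sgn c • (rep ℬ U b * trivialHam ℬ U) := by
  change Algebra.lsmul ℝ ℝ U _ * Algebra.lsmul ℝ ℝ U _ =
    sgn c • (Algebra.lsmul ℝ ℝ U _ * Algebra.lsmul ℝ ℝ U _)
  rw [← map_mul, ← map_mul, ← map_smul]
  congr 1
  change (Cl.pos 0 ᵍ⊗ₜ[ℝ] 1 * 1 ᵍ⊗ₜ[ℝ] b : Ham ℬ) =
    sgn c • (1 ᵍ⊗ₜ[ℝ] b * Cl.pos 0 ᵍ⊗ₜ[ℝ] 1 : Ham ℬ)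
  rw [tmul_mul_tmul_of_mem _ _ _ _ (SetLike.GradedOne.one_mem (A := ℬ))
      (SetLike.GradedOne.one_mem (A := clGrade 0 1)),
    tmul_mul_tmul_of_mem _ _ _ _ hb (Cl.pos_mem 0), smul_smul]
  simp

/-- The operators `M` on a module over `Cl^{0,1} ⊗̂ B` which are complex linear, square to `1`
and anticommute with the elements of `E`; no compatibility with the group is required. -/
structure IsHamiltonian (M : Module.End ℝ U) : Prop where
  sq : M * M = 1
  comm : ∀ z : ℂ, M * rep ℬ U (j (D.scalar z)) = rep ℬ U (j (D.scalar z)) * M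
  anticomm : ∀ e ∈ E, M * rep ℬ U e = -(rep ℬ U e * M)

variable {ℬ} in
/-- The operator `M` differs from the trivial Hamiltonian only on the sum of the first `n`
summands of the universe: it preserves this sum and is trivial on the remaining summands. -/
structure IsTrivialOutside (𝒮 : UniverseDecomposition (Ham ℬ) U) (n : ℕ) (M : Module.End ℝ U) :
    Prop where
  maps : ∀ u ∈ 𝒮.initial n, M u ∈ 𝒮.initial n
  eq : ∀ k, n ≤ k → ∀ u ∈ 𝒮.summand k, M u = trivialHam ℬ U u

variable {ℬ} in
/-- The classifying space of (not necessarily symmetric) Hamiltonians in a universe for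
`Cl^{0,1} ⊗̂ B`. For `B = A` and `E = ∅` this is `K(A)`, for `B = A^V` and `E = V` it is `K(A^V)`. -/
def ClSpace (𝒮 : UniverseDecomposition (Ham ℬ) U) : Type w :=
  {M : Module.End ℝ U // IsHamiltonian D ℬ j E M ∧ ∃ n, IsTrivialOutside 𝒮 n M}

namespace ClSpace

variable {ℬ} (𝒮 : UniverseDecomposition (Ham ℬ) U)

/-- The Hamiltonians which are trivial outside the sum of the first `n` summands. -/
def stage (n : ℕ) : Set (ClSpace D j E 𝒮) := {M | IsTrivialOutside 𝒮 n M.1}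

/-- The restriction of a Hamiltonian to the finite dimensional sum of the first `n` summands. -/
def restrict (n : ℕ) (M : stage D j E 𝒮 n) :
    Module.End ℝ ((𝒮.initial n).restrictScalars ℝ) :=
  M.1.1.restrict M.2.maps

/-- The direct limit topology: the `n`-th stage is topologized as a set of linear maps on a finite
dimensional real vector space, with the usual topology of such a space. -/
instance : TopologicalSpace (ClSpace D j E 𝒮) :=
  ⨆ n, TopologicalSpace.coinduced (Subtype.val : stage D j E 𝒮 n → ClSpace D j E 𝒮)
    (TopologicalSpace.induced (restrict D j E 𝒮 n) (moduleTopology ℝ _))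

/-- The base point: the trivial Hamiltonian. -/
def base [hE : IsSymmetryExtension D ℬ j E] : ClSpace D j E 𝒮 :=
  ⟨trivialHam ℬ U,
    { sq := trivialHam_mul_self ℬ
      comm := fun z => by
        rw [trivialHam_mul_rep ℬ (hE.map_mem 0 _ (D.scalar_mem_grade z)), sgn_zero, one_smul]
      anticomm := fun e he => by
        rw [trivialHam_mul_rep ℬ (hE.gen_mem e he), sgn_one, neg_one_smul] },
    0, { maps := fun u hu => Submodule.smul_mem _ _ hu
         eq := fun _ _ _ _ => rfl }⟩

variable (ℬ) in
/-- The operator `(-1)^{h(g)} ρ(g) M ρ(g)⁻¹`. -/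
def conj (g : G) (M : Module.End ℝ U) : Module.End ℝ U :=
  sgn (D.hdeg g) • (rep ℬ U (j (D.unit g : D.Alg)) * M * rep ℬ U (j ((D.unit g)⁻¹ : D.Algˣ)))

theorem rep_unit_mul_inv (g : G) :
    rep ℬ U (j (D.unit g : D.Alg)) * rep ℬ U (j ((D.unit g)⁻¹ : D.Algˣ)) = 1 := by
  rw [← map_mul, ← map_mul, Units.mul_inv, map_one, map_one]

theorem rep_inv_mul_unit (g : G) :
    rep ℬ U (j ((D.unit g)⁻¹ : D.Algˣ)) * rep ℬ U (j (D.unit g : D.Alg)) = 1 := by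
  rw [← map_mul, ← map_mul, Units.inv_mul, map_one, map_one]

/-- `(-1)^{h(g)} ρ(g) M ρ(g)⁻¹` is the operator `N` with `(-1)^{h(g)} ρ(g) M = N ρ(g)`. -/
theorem conj_eq_iff (g : G) (M N : Module.End ℝ U) :
    conj D ℬ j g M = N ↔
      sgn (D.hdeg g) • (rep ℬ U (j (D.of g)) * M) = N * rep ℬ U (j (D.of g)) := by
  have h1 := rep_unit_mul_inv D j (ℬ := ℬ) (U := U) g
  have h2 := rep_inv_mul_unit D j (ℬ := ℬ) (U := U) g
  rw [SymmetryData.unit_val] at h1 h2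
  constructor
  · rintro rfl
    rw [conj, SymmetryData.unit_val, smul_mul_assoc, mul_assoc, mul_assoc, h2, mul_one]
  · intro h
    rw [conj, SymmetryData.unit_val, ← smul_mul_assoc, h, mul_assoc, h1, mul_one]

theorem conj_mul_rep (g : G) (M : Module.End ℝ U) :
    conj D ℬ j g M * rep ℬ U (j (D.of g)) = sgn (D.hdeg g) • (rep ℬ U (j (D.of g)) * M) :=
  ((conj_eq_iff D j g M _).mp rfl).symm

theorem mul_rep_cancel (g : G) {M N : Module.End ℝ U}
    (h : M * rep ℬ U (j (D.of g)) = N * rep ℬ U (j (D.of g))) : M = N := by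
  have h1 := rep_unit_mul_inv D j (ℬ := ℬ) (U := U) g
  rw [SymmetryData.unit_val] at h1
  rw [← mul_one M, ← h1, ← mul_assoc, h, mul_assoc, h1, mul_one]

theorem conj_trivialHam [hE : IsSymmetryExtension D ℬ j E] (g : G) :
    conj D ℬ j g (trivialHam ℬ U) = trivialHam ℬ U := by
  rw [conj_eq_iff, trivialHam_mul_rep ℬ (hE.map_mem _ _ (D.of_mem_grade g))]

theorem conj_isHamiltonian [hE : IsSymmetryExtension D ℬ j E] (g : G) {M : Module.End ℝ U}
    (hM : IsHamiltonian D ℬ j E M) : IsHamiltonian D ℬ j E (conj D ℬ j g M) where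
  sq := by
    apply mul_rep_cancel D (ℬ := ℬ) j g
    rw [mul_assoc, conj_mul_rep, mul_smul_comm, ← mul_assoc, conj_mul_rep, smul_mul_assoc,
      smul_smul, sgn_mul_self, one_smul, mul_assoc, hM.sq, mul_one, one_mul]
  comm z := by
    have h : ∀ w, rep ℬ U (j (D.of g)) * rep ℬ U (j (D.scalar w)) =
        rep ℬ U (j (D.scalar (conjPow (D.sdeg g) w))) * rep ℬ U (j (D.of g)) := by
      intro w
      rw [← map_mul, ← map_mul, ← map_mul, ← map_mul, D.of_mul_scalar]
    obtain ⟨w, rfl⟩ := (conjPow (D.sdeg g)).surjective z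
    apply mul_rep_cancel D (ℬ := ℬ) j g
    rw [mul_assoc, ← h, ← mul_assoc, conj_mul_rep, smul_mul_assoc, mul_assoc, hM.comm,
      ← mul_assoc, h, mul_assoc, mul_assoc, conj_mul_rep, mul_smul_comm]
  anticomm e he := by
    obtain ⟨e', he', h⟩ := hE.gen_conj g e he
    have h2 : rep ℬ U e * rep ℬ U (j (D.of g)) =
        sgn (D.hdeg g) • (rep ℬ U (j (D.of g)) * rep ℬ U e') := by
      rw [← map_mul, h, map_smul, map_mul]
    apply mul_rep_cancel D (ℬ := ℬ) j g
    rw [mul_assoc, h2, mul_smul_comm, ← mul_assoc, conj_mul_rep, smul_mul_assoc, mul_assoc,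
      hM.anticomm e' he', neg_mul, mul_assoc, conj_mul_rep, mul_smul_comm, ← mul_assoc, h2,
      smul_mul_assoc, mul_neg, mul_assoc, smul_neg, smul_neg]

theorem conj_isTrivialOutside [hE : IsSymmetryExtension D ℬ j E] (g : G) {M : Module.End ℝ U}
    {n : ℕ} (hM : IsTrivialOutside 𝒮 n M) : IsTrivialOutside 𝒮 n (conj D ℬ j g M) where
  maps u hu := by
    refine ((𝒮.initial n).restrictScalars ℝ).smul_mem _ (Submodule.smul_mem _ _ (hM.maps _ ?_))
    exact Submodule.smul_mem _ _ hu
  eq k hk u hu := by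
    rw [← conj_trivialHam D (ℬ := ℬ) (U := U) j E g]
    have : M (rep ℬ U (j ((D.unit g)⁻¹ : D.Algˣ)) u) =
        trivialHam ℬ U (rep ℬ U (j ((D.unit g)⁻¹ : D.Algˣ)) u) :=
      hM.eq k hk _ (Submodule.smul_mem _ _ hu)
    simp only [conj, LinearMap.smul_apply, Module.End.mul_apply, this]

/-- The action of `G` on the classifying space: `g` maps `M` to `(-1)^{h(g)} ρ(g) M ρ(g)⁻¹`. -/
instance [IsSymmetryExtension D ℬ j E] : MulAction G (ClSpace D j E 𝒮) where
  smul g M := ⟨conj D ℬ j g M.1, conj_isHamiltonian D j E g M.2.1,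
    M.2.2.imp fun _ h => conj_isTrivialOutside D j E 𝒮 g h⟩
  one_smul M := by
    refine Subtype.ext ((conj_eq_iff D j 1 M.1 M.1).mpr ?_)
    rw [D.hdeg_one, sgn_zero, one_smul, D.of_one, M.2.1.comm]
  mul_smul a b M := by
    refine Subtype.ext ((conj_eq_iff D j (a * b) M.1 _).mpr ?_)
    change _ = conj D ℬ j a (conj D ℬ j b M.1) * _
    have hM := (conj_isHamiltonian D j E a (conj_isHamiltonian D j E b M.2.1)).comm
    have h : rep ℬ U (j (D.scalar (D.ω a b))) * rep ℬ U (j (D.of (a * b))) =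
        rep ℬ U (j (D.of a)) * rep ℬ U (j (D.of b)) := by
      rw [← map_mul, ← map_mul, ← map_mul, ← map_mul, ← D.of_mul_of]
    have h1 : rep ℬ U (j (D.scalar (D.ω a b : ℂ)⁻¹)) * rep ℬ U (j (D.scalar (D.ω a b))) = 1 := by
      rw [← map_mul, ← map_mul, ← map_mul, inv_mul_cancel₀ (Circle.coe_ne_zero _), map_one,
        map_one, map_one]
    have h2 : rep ℬ U (j (D.of (a * b))) = rep ℬ U (j (D.scalar (D.ω a b : ℂ)⁻¹)) *
        (rep ℬ U (j (D.of a)) * rep ℬ U (j (D.of b))) := by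
      rw [← h, ← mul_assoc, h1, one_mul]
    have h3 : conj D ℬ j a (conj D ℬ j b M.1) * (rep ℬ U (j (D.of a)) * rep ℬ U (j (D.of b))) =
        sgn (D.hdeg (a * b)) • (rep ℬ U (j (D.of a)) * rep ℬ U (j (D.of b)) * M.1) := by
      rw [← mul_assoc, conj_mul_rep, smul_mul_assoc, mul_assoc, conj_mul_rep, mul_smul_comm,
        smul_smul, ← sgn_add, ← D.hdeg_mul, mul_assoc]
    rw [h2, ← mul_assoc (conj D ℬ j a _), hM, mul_assoc (rep ℬ U _) (conj D ℬ j a _), h3,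
      mul_smul_comm, mul_assoc (rep ℬ U (j (D.scalar _)))]

theorem smul_val [IsSymmetryExtension D ℬ j E] (g : G) (M : ClSpace D j E 𝒮) :
    (g • M).1 = sgn (D.hdeg g) •
      (rep ℬ U (j (D.unit g : D.Alg)) * M.1 * rep ℬ U (j ((D.unit g)⁻¹ : D.Algˣ))) := rfl

end ClSpace

end Classifying

/-! ### Equivariant homotopy equivalence -/

section Homotopy

variable (G : Type u) [Group G] {X : Type v} {Y : Type w} [TopologicalSpace X]
  [TopologicalSpace Y] [MulAction G X] [MulAction G Y]

/-- Two maps of based `G`-spaces are homotopic through equivariant based maps. -/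
def BasedGHomotopic (x₀ : X) (y₀ : Y) (f₀ f₁ : C(X, Y)) : Prop :=
  ∃ F : f₀.Homotopy f₁, (∀ t (g : G) x, F (t, g • x) = g • F (t, x)) ∧ ∀ t, F (t, x₀) = y₀

/-- A based `G`-homotopy equivalence between based `G`-spaces: equivariant based continuous maps
in both directions, inverse to each other up to equivariant based homotopy. -/
def BasedGHomotopyEquivalent (x₀ : X) (y₀ : Y) : Prop :=
  ∃ (f : C(X, Y)) (f' : C(Y, X)),
    (∀ (g : G) x, f (g • x) = g • f x) ∧ f x₀ = y₀ ∧
    (∀ (g : G) y, f' (g • y) = g • f' y) ∧ f' y₀ = x₀ ∧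
    BasedGHomotopic G x₀ x₀ (f'.comp f) (ContinuousMap.id X) ∧
    BasedGHomotopic G y₀ y₀ (f.comp f') (ContinuousMap.id Y)

end Homotopy

end FreeFermion

end

/-! Part 1. In `A^{V ⊕ V''}` the scalar `i` commutes with vectors and has square `-1`, so replacing
`w` by `i w` negates the quadratic form of the second summand; moving `g` past `i` gives
`(-1)^{s(g)}`, which is exactly the twist of `V'` against `V''`. This gives `Φ₁` (`rotate`,
`sumEquivDiff`). For `Φ₂`, let `Cl^{d,d}` act on the spinors `S = Cl(V)` by left multiplications and
by right multiplications composed with the grade involution. This identifies `Cl^{d,d}` with `End S`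
(`spin_bijective`). An orthogonal map of `V` induces an algebra automorphism of `S`, hence an
element `x_g` of `Cl^{d,d}` (`spinElt`). Three properties of `x_g` matter. Automorphisms compose
strictly, so `x_{gh} = x_g x_h`, and the cocycle is unchanged; this is where doubling `V` avoids a
Pin extension. Automorphisms commute with the involution, so `x_g` is even for every `g`, and `h` is
unchanged. Conjugation by `x_g` rotates both families of vectors by `ρ(g)`. So `g ↦ x_g ⊗ g`,
together with the inclusion of the vectors, defines a homomorphism, with linear inverse `c ⊗ g ↦ c
x_g⁻¹ g` (`toTensor`, `ofTensor`). Part 2. This is graded Morita theory. `End S` contains an even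
idempotent `p` of rank one (`cliffordVacuum`), and in `Cl^{0,1} ⊗̂ A^{V ⊕ V'}` it is a full
idempotent with corner `Cl^{0,1} ⊗̂ A` (`vacuumCorner`). For a full idempotent, `Y ↦ pY` matches
irreducible modules, so the part of one universe fixed by `p` is the other universe up to a
permutation of summands (`FullCorner.exists_transfer`). Since Hamiltonians commute with `i`,
anticommuting with the vectors means commuting with all of `Cl^{d,d}` in the graded sense
(`anticomm_vec_iff`). Such an operator preserves `pU` and is determined by its restriction there,
and every operator on `pU` extends (`compress`, `extend` in `VacuumPart`). Both assignments are
finite sums of `M ↦ a M c` and carry the trivial Hamiltonian to the trivial one, hence are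
continuous (`continuous_sandwichMap`). The group acts compatibly because the even factor `x_g`
commutes with `M`. Thus the two spaces are even `G`-homeomorphic, and constant homotopies suffice
(`basedGHomotopyEquivalent_of_vacuum`). -/

open scoped TensorProduct

noncomputable section

namespace FreeFermion

universe u v w

/-! ### Parity automorphisms and the sign rule in graded tensor products. -/

section Parity

variable {A : Type*} [Ring A] [Algebra ℝ A] (𝒜 : ZMod 2 → Submodule ℝ A) [GradedAlgebra 𝒜]

/-- Two linear maps out of a graded algebra agree if they agree on homogeneous elements. -/
theorem linearMap_ext_of_mem {M : Type*} [AddCommGroup M] [Module ℝ M] {f g : A →ₗ[ℝ] M}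
    (h : ∀ c, ∀ a ∈ 𝒜 c, f a = g a) : f = g :=
  DirectSum.decompose_lhom_ext 𝒜 fun c => LinearMap.ext fun a => h c a a.2

/-- The parity automorphism `a ↦ (-1)^{|a|} a` of a graded algebra. -/
def parityHom : A →ₐ[ℝ] A :=
  AlgHom.ofLinearMap (parityMap 𝒜)
    (by rw [parityMap_of_mem 𝒜 (SetLike.GradedOne.one_mem (A := 𝒜)), sgn_zero, one_smul])
    (by
      have : (LinearMap.mul ℝ A).compr₂ (parityMap 𝒜) =
          (LinearMap.mul ℝ A).compl₁₂ (parityMap 𝒜) (parityMap 𝒜) := by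
        refine linearMap_ext_of_mem 𝒜 fun c a ha => linearMap_ext_of_mem 𝒜 fun c' a' ha' => ?_
        simp only [LinearMap.compr₂_apply, LinearMap.compl₁₂_apply, LinearMap.mul_apply']
        rw [parityMap_of_mem 𝒜 ha, parityMap_of_mem 𝒜 ha',
          parityMap_of_mem 𝒜 (SetLike.GradedMul.mul_mem ha ha'), sgn_add, smul_mul_smul_comm]
      exact fun x y => LinearMap.congr_fun (LinearMap.congr_fun this x) y)

theorem parityHom_of_mem {c : ZMod 2} {a : A} (ha : a ∈ 𝒜 c) : parityHom 𝒜 a = sgn c • a :=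
  parityMap_of_mem 𝒜 ha

theorem parityHom_parityHom (a : A) : parityHom 𝒜 (parityHom 𝒜 a) = a := by
  have : (parityHom 𝒜).toLinearMap ∘ₗ (parityHom 𝒜).toLinearMap = LinearMap.id :=
    linearMap_ext_of_mem 𝒜 fun c a ha => by
      simp [parityHom_of_mem 𝒜 ha, smul_smul]
  exact LinearMap.congr_fun this a

/-- Splitting `a` into its even and odd parts, the eigenvalue equation forces twice the part of the
wrong degree to vanish. Degrees can therefore be tested with an algebra homomorphism. -/
theorem mem_iff_parityHom {c : ZMod 2} {a : A} : a ∈ 𝒜 c ↔ parityHom 𝒜 a = sgn c • a := by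
  refine ⟨parityHom_of_mem 𝒜, fun h => ?_⟩
  classical
  have hs : a = DirectSum.decompose 𝒜 a 0 + DirectSum.decompose 𝒜 a 1 := by
    nth_rewrite 1 [← DirectSum.sum_support_decompose 𝒜 a]
    rw [Finset.sum_subset (Finset.subset_univ _)
      (fun i _ hi => by simpa using hi)]
    exact Fin.sum_univ_two _
  have h0 := (DirectSum.decompose 𝒜 a 0).2
  have h1 := (DirectSum.decompose 𝒜 a 1).2
  generalize (DirectSum.decompose 𝒜 a 0 : A) = a0 at *
  generalize (DirectSum.decompose 𝒜 a 1 : A) = a1 at *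
  subst hs
  rw [map_add, parityHom_of_mem 𝒜 h0, parityHom_of_mem 𝒜 h1, sgn_zero, sgn_one, one_smul,
    neg_one_smul] at h
  rcases zmod2_cases c with rfl | rfl
  · have h2 : (2 : ℝ) • a1 = 0 := by
      rw [two_smul]
      rw [sgn_zero, one_smul] at h
      nth_rewrite 1 [← add_left_cancel h]
      exact neg_add_cancel a1
    rw [(smul_eq_zero.mp h2).resolve_left two_ne_zero, add_zero]
    exact h0
  · have h2 : (2 : ℝ) • a0 = 0 := by
      rw [two_smul]
      rw [sgn_one, neg_one_smul, neg_add] at h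
      nth_rewrite 1 [add_right_cancel h]
      exact neg_add_cancel a0
    rw [(smul_eq_zero.mp h2).resolve_left two_ne_zero, zero_add]
    exact h1

end Parity

section Tensor

variable {A B : Type*} [Ring A] [Ring B] [Algebra ℝ A] [Algebra ℝ B]
variable {𝒜 : ZMod 2 → Submodule ℝ A} {ℬ : ZMod 2 → Submodule ℝ B}
variable [GradedAlgebra 𝒜] [GradedAlgebra ℬ]

theorem gtmul_mul_of_right_even (a a' : A) (b b' : B) (hb : b ∈ ℬ 0) :
    (a ᵍ⊗ₜ[ℝ] b * a' ᵍ⊗ₜ[ℝ] b' : 𝒜 ᵍ⊗[ℝ] ℬ) = (a * a') ᵍ⊗ₜ[ℝ] (b * b') := by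
  have : (LinearMap.mulLeft ℝ (a ᵍ⊗ₜ[ℝ] b : 𝒜 ᵍ⊗[ℝ] ℬ)) ∘ₗ
      (TensorProduct.mk ℝ A B).flip b' =
      (TensorProduct.mk ℝ A B).flip (b * b') ∘ₗ LinearMap.mulLeft ℝ a :=
    linearMap_ext_of_mem 𝒜 fun c x hx => by
      refine (tmul_mul_tmul_of_mem a x b b' hb hx).trans ?_
      rw [zero_mul, sgn_zero, one_smul]
      rfl
  exact LinearMap.congr_fun this a'

theorem gtmul_mul_of_left_even (a a' : A) (b b' : B) (ha : a' ∈ 𝒜 0) :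
    (a ᵍ⊗ₜ[ℝ] b * a' ᵍ⊗ₜ[ℝ] b' : 𝒜 ᵍ⊗[ℝ] ℬ) = (a * a') ᵍ⊗ₜ[ℝ] (b * b') := by
  have : (LinearMap.mulRight ℝ (a' ᵍ⊗ₜ[ℝ] b' : 𝒜 ᵍ⊗[ℝ] ℬ)) ∘ₗ
      (TensorProduct.mk ℝ A B) a =
      (TensorProduct.mk ℝ A B) (a * a') ∘ₗ LinearMap.mulRight ℝ b' :=
    linearMap_ext_of_mem ℬ fun c x hx => by
      refine (tmul_mul_tmul_of_mem a a' x b' hx ha).trans ?_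
      rw [mul_zero, sgn_zero, one_smul]
      rfl
  exact LinearMap.congr_fun this b

theorem gtmul_one_mul (a a' : A) (b' : B) :
    (a ᵍ⊗ₜ[ℝ] 1 * a' ᵍ⊗ₜ[ℝ] b' : 𝒜 ᵍ⊗[ℝ] ℬ) = (a * a') ᵍ⊗ₜ[ℝ] b' := by
  rw [gtmul_mul_of_right_even _ _ _ _ SetLike.GradedOne.one_mem, one_mul]

theorem gtmul_mul_one (a : A) (b b' : B) :
    (a ᵍ⊗ₜ[ℝ] b * 1 ᵍ⊗ₜ[ℝ] b' : 𝒜 ᵍ⊗[ℝ] ℬ) = a ᵍ⊗ₜ[ℝ] (b * b') := by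
  rw [gtmul_mul_of_left_even _ _ _ _ SetLike.GradedOne.one_mem, mul_one]

end Tensor

section Twist

variable {A : Type*} [Ring A] [Algebra ℝ A] (𝒜 : ZMod 2 → Submodule ℝ A) [GradedAlgebra 𝒜]

/-- The power `a ↦ (-1)^{c|a|} a` of the parity automorphism. -/
def twist (c : ZMod 2) : A →ₐ[ℝ] A := if c = 0 then AlgHom.id ℝ A else parityHom 𝒜

@[simp] theorem twist_zero : twist 𝒜 0 = AlgHom.id ℝ A := if_pos rfl

@[simp] theorem twist_one : twist 𝒜 1 = parityHom 𝒜 := if_neg (by decide)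

theorem twist_of_mem {i c : ZMod 2} {a : A} (ha : a ∈ 𝒜 i) : twist 𝒜 c a = sgn (c * i) • a := by
  rcases zmod2_cases c with rfl | rfl
  · simp
  · rw [twist_one, parityHom_of_mem 𝒜 ha, one_mul]

end Twist

section TensorTwist

variable {A B : Type*} [Ring A] [Ring B] [Algebra ℝ A] [Algebra ℝ B]
variable {𝒜 : ZMod 2 → Submodule ℝ A} {ℬ : ZMod 2 → Submodule ℝ B}
variable [GradedAlgebra 𝒜] [GradedAlgebra ℬ]

variable (𝒜 ℬ) in
/-- The pure tensors as a bilinear map. -/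
def gtmk : A →ₗ[ℝ] B →ₗ[ℝ] 𝒜 ᵍ⊗[ℝ] ℬ := TensorProduct.mk ℝ A B

theorem gtmk_apply (a : A) (b : B) : gtmk 𝒜 ℬ a b = a ᵍ⊗ₜ[ℝ] b := rfl

theorem gtensor_induction {p : 𝒜 ᵍ⊗[ℝ] ℬ → Prop} (x : 𝒜 ᵍ⊗[ℝ] ℬ) (h0 : p 0)
    (hadd : ∀ x y, p x → p y → p (x + y)) (ht : ∀ (a : A) (b : B), p (a ᵍ⊗ₜ[ℝ] b)) : p x :=
  TensorProduct.induction_on (motive := p) x h0 ht hadd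

/-- Both sides are linear in `a'`, so homogeneous `a'` suffice. Writing the sign as the algebra map
`twist` means that only one of the two inner factors has to be homogeneous. -/
theorem gtmul_mul_of_right_mem (a a' : A) (b b' : B) {i : ZMod 2} (hb : b ∈ ℬ i) :
    (a ᵍ⊗ₜ[ℝ] b * a' ᵍ⊗ₜ[ℝ] b' : 𝒜 ᵍ⊗[ℝ] ℬ) = (a * twist 𝒜 i a') ᵍ⊗ₜ[ℝ] (b * b') := by
  have : (LinearMap.mulLeft ℝ (a ᵍ⊗ₜ[ℝ] b : 𝒜 ᵍ⊗[ℝ] ℬ)) ∘ₗ (gtmk 𝒜 ℬ).flip b' =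
      (gtmk 𝒜 ℬ).flip (b * b') ∘ₗ LinearMap.mulLeft ℝ a ∘ₗ (twist 𝒜 i).toLinearMap :=
    linearMap_ext_of_mem 𝒜 fun c x hx => by
      refine (tmul_mul_tmul_of_mem a x b b' hb hx).trans ?_
      simp only [LinearMap.comp_apply, AlgHom.toLinearMap_apply, twist_of_mem 𝒜 hx, map_smul]
      rfl
  exact LinearMap.congr_fun this a'

theorem gtmul_mul_of_left_mem (a a' : A) (b b' : B) {i : ZMod 2} (ha : a' ∈ 𝒜 i) :
    (a ᵍ⊗ₜ[ℝ] b * a' ᵍ⊗ₜ[ℝ] b' : 𝒜 ᵍ⊗[ℝ] ℬ) = (a * a') ᵍ⊗ₜ[ℝ] (twist ℬ i b * b') := by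
  have : (LinearMap.mulRight ℝ (a' ᵍ⊗ₜ[ℝ] b' : 𝒜 ᵍ⊗[ℝ] ℬ)) ∘ₗ gtmk 𝒜 ℬ a =
      gtmk 𝒜 ℬ (a * a') ∘ₗ LinearMap.mulRight ℝ b' ∘ₗ (twist ℬ i).toLinearMap :=
    linearMap_ext_of_mem ℬ fun c x hx => by
      refine (tmul_mul_tmul_of_mem a a' x b' hx ha).trans ?_
      simp only [LinearMap.comp_apply, AlgHom.toLinearMap_apply, twist_of_mem ℬ hx, map_smul,
        mul_comm]
      rfl
  exact LinearMap.congr_fun this b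

theorem parityHom_gtmul (a : A) (b : B) :
    parityHom (tensorGrade 𝒜 ℬ) (a ᵍ⊗ₜ[ℝ] b) = parityHom 𝒜 a ᵍ⊗ₜ[ℝ] parityHom ℬ b := by
  have : (gtmk 𝒜 ℬ).compr₂ (parityHom (tensorGrade 𝒜 ℬ)).toLinearMap =
      (gtmk 𝒜 ℬ).compl₁₂ (parityHom 𝒜).toLinearMap (parityHom ℬ).toLinearMap := by
    refine linearMap_ext_of_mem 𝒜 fun c a ha => linearMap_ext_of_mem ℬ fun c' b hb => ?_
    simp only [LinearMap.compr₂_apply, LinearMap.compl₁₂_apply, AlgHom.toLinearMap_apply]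
    rw [parityHom_of_mem 𝒜 ha, parityHom_of_mem ℬ hb, gtmk_apply,
      parityHom_of_mem _ (tmul_mem_tensorGrade rfl ha hb), map_smul, map_smul,
      LinearMap.smul_apply, smul_smul, sgn_add, mul_comm, gtmk_apply]
  exact LinearMap.congr_fun (LinearMap.congr_fun this a) b

/-- The universal property of the graded tensor product, with signs written as `sgn`. -/
def gtLift {C : Type*} [Ring C] [Algebra ℝ C] (f : A →ₐ[ℝ] C) (g : B →ₐ[ℝ] C)
    (h : ∀ i j, ∀ a ∈ 𝒜 i, ∀ b ∈ ℬ j, f a * g b = sgn (j * i) • (g b * f a)) :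
    (𝒜 ᵍ⊗[ℝ] ℬ) →ₐ[ℝ] C :=
  GradedTensorProduct.lift 𝒜 ℬ f g fun i j a b => by
    rw [units_pow_smul]; exact h i j a a.2 b b.2

theorem gtLift_tmul {C : Type*} [Ring C] [Algebra ℝ C] (f : A →ₐ[ℝ] C) (g : B →ₐ[ℝ] C)
    (h : ∀ i j, ∀ a ∈ 𝒜 i, ∀ b ∈ ℬ j, f a * g b = sgn (j * i) • (g b * f a)) (a : A) (b : B) :
    gtLift f g h (a ᵍ⊗ₜ[ℝ] b) = f a * g b := rfl

/-- Two homomorphisms commute up to the sign of the graded tensor product if they do so on odd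
generators. -/
theorem graded_comm_of_generators {C : Type*} [Ring C] [Algebra ℝ C] (f : A →ₐ[ℝ] C)
    (g : B →ₐ[ℝ] C) {X : Set A} {Y : Set B} (hX : Algebra.adjoin ℝ X = ⊤)
    (hY : Algebra.adjoin ℝ Y = ⊤) (hX1 : ∀ x ∈ X, x ∈ 𝒜 1) (hY1 : ∀ y ∈ Y, y ∈ ℬ 1)
    (h : ∀ x ∈ X, ∀ y ∈ Y, f x * g y = -(g y * f x)) :
    ∀ i j, ∀ a ∈ 𝒜 i, ∀ b ∈ ℬ j, f a * g b = sgn (j * i) • (g b * f a) := by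
  -- Only one variable is allowed to be general at a time: the rule for a fixed generator `x` is
  -- multiplicative in `b`, and afterwards the rule for a fixed homogeneous `b` is multiplicative in
  -- `a`.
  have h1 : ∀ x ∈ X, ∀ b, f x * g b = g (parityHom ℬ b) * f x := by
    intro x hx b
    have hb : b ∈ Algebra.adjoin ℝ Y := hY ▸ Algebra.mem_top
    induction hb using Algebra.adjoin_induction with
    | mem y hy => rw [h x hx y hy, parityHom_of_mem ℬ (hY1 y hy)]; simp
    | algebraMap r => simp only [AlgHom.commutes]; exact (Algebra.commutes r _).symm
    | add b b' _ _ hb hb' => simp only [map_add, mul_add, add_mul, hb, hb']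
    | mul b b' _ _ hb hb' => rw [map_mul, map_mul, map_mul, ← mul_assoc, hb, mul_assoc, hb',
        mul_assoc]
  have h2 : ∀ j, ∀ b ∈ ℬ j, ∀ a, f a * g b = g b * f (twist 𝒜 j a) := by
    intro j b hb a
    have ha : a ∈ Algebra.adjoin ℝ X := hX ▸ Algebra.mem_top
    induction ha using Algebra.adjoin_induction with
    | mem x hx =>
      rw [h1 x hx, parityHom_of_mem ℬ hb, twist_of_mem 𝒜 (hX1 x hx), mul_one, map_smul, map_smul,
        smul_mul_assoc, mul_smul_comm]
    | algebraMap r => simp only [AlgHom.commutes]; exact Algebra.commutes r _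
    | add b b' _ _ hb hb' => simp only [map_add, mul_add, add_mul, hb, hb']
    | mul b b' _ _ hb hb' => rw [map_mul, map_mul, map_mul, mul_assoc, hb', ← mul_assoc, hb,
        mul_assoc]
  intro i j a ha b hb
  rw [h2 j b hb a, twist_of_mem 𝒜 ha, map_smul, mul_smul_comm]

end TensorTwist

/-! ### The spinor module of `Cl^{d,d}` -/

section Ring

variable {R : Type*} [Ring R]

theorem commute_mul_of_anticomm {x y z : R} (hx : x * z = -(z * x)) (hy : y * z = -(z * y)) :
    Commute (x * y) z := by
  rw [Commute, SemiconjBy, mul_assoc, hy, mul_neg, ← mul_assoc, hx, neg_mul, neg_neg, mul_assoc]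

theorem mul_mul_self_of_sq_zero {x y : R} (hx : x * x = 0) (h : x * y + y * x = 1) :
    x * y * x = x := by
  rw [mul_assoc, eq_sub_iff_add_eq'.mpr h, mul_sub, ← mul_assoc, hx, mul_one, zero_mul, sub_zero]

variable [Algebra ℝ R]

theorem half_sub_mul_of_anticomm {x y z : R} {r : ℝ} (hx : x * z + z * x = algebraMap ℝ R (2 * r))
    (hy : z * y = -(y * z)) : ((1 / 2 : ℝ) • (x - y)) * z =
      algebraMap ℝ R r - z * ((1 / 2 : ℝ) • (x - y)) := by
  rw [eq_sub_iff_add_eq, smul_mul_assoc, mul_smul_comm, ← smul_add, sub_mul, mul_sub, hy]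
  have : x * z - y * z + (z * x - -(y * z)) = x * z + z * x := by abel
  rw [this, hx, Algebra.algebraMap_eq_smul_one, Algebra.algebraMap_eq_smul_one, smul_smul]
  congr 1; ring

theorem half_sub_mul_half_sub {x y x' y' : R} {r : ℝ}
    (hx : x * x' + x' * x = algebraMap ℝ R r) (hy : y * y' + y' * y = algebraMap ℝ R (-r))
    (h : x * y' = -(y' * x)) (h' : x' * y = -(y * x')) :
    ((1 / 2 : ℝ) • (x - y)) * ((1 / 2 : ℝ) • (x' - y')) =
      -(((1 / 2 : ℝ) • (x' - y')) * ((1 / 2 : ℝ) • (x - y))) := by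
  rw [eq_neg_iff_add_eq_zero, smul_mul_smul_comm, smul_mul_smul_comm, ← smul_add]
  have : (x - y) * (x' - y') + (x' - y') * (x - y) = 0 := by
    simp only [sub_mul, mul_sub, h, h']
    rw [map_neg, ← hx, eq_neg_iff_add_eq_zero] at hy
    rw [← hy]; abel
  rw [this, smul_zero]

end Ring

section Spinor

variable (V : Type v) [NormedAddCommGroup V] [InnerProductSpace ℝ V]

/-- The Clifford algebra of a Euclidean space, as the module of spinors for `V ⊕ (-V)`. -/
abbrev Spinor : Type v := CliffordAlgebra (normSqForm V)

/-- Left multiplication by vectors. -/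
def leftOp : V →ₗ[ℝ] Module.End ℝ (Spinor V) :=
  (Algebra.lmul ℝ (Spinor V)).toLinearMap ∘ₗ CliffordAlgebra.ι (normSqForm V)

/-- Right multiplication by vectors, preceded by the grade involution. -/
def rightOp : V →ₗ[ℝ] Module.End ℝ (Spinor V) :=
  ((LinearMap.mul ℝ (Spinor V)).flip ∘ₗ CliffordAlgebra.ι (normSqForm V)).compl₂
    (CliffordAlgebra.involute (Q := normSqForm V)).toLinearMap

variable {V}

theorem leftOp_apply (v : V) (x : Spinor V) :
    leftOp V v x = CliffordAlgebra.ι (normSqForm V) v * x := rfl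

theorem rightOp_apply (v : V) (x : Spinor V) :
    rightOp V v x = CliffordAlgebra.involute x * CliffordAlgebra.ι (normSqForm V) v := rfl

theorem polar_normSqForm (v w : V) :
    QuadraticMap.polar (normSqForm V) v w = 2 * inner ℝ v w := by
  simp only [QuadraticMap.polar, normSqForm_apply]
  rw [norm_add_sq_real]; ring

theorem leftOp_mul_leftOp (v w : V) :
    leftOp V v * leftOp V w + leftOp V w * leftOp V v =
      algebraMap ℝ _ (2 * inner ℝ v w) := by
  ext x
  simp only [LinearMap.add_apply, Module.End.mul_apply, leftOp_apply, Module.algebraMap_end_apply,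
    ← mul_assoc, ← add_mul, CliffordAlgebra.ι_mul_ι_add_swap, polar_normSqForm]
  rw [Algebra.smul_def]

/-- The second application of the involution meets the vector inserted by the first and negates it.
This is the source of the negative squares. -/
theorem rightOp_mul_rightOp (v w : V) :
    rightOp V v * rightOp V w + rightOp V w * rightOp V v =
      algebraMap ℝ _ (-(2 * inner ℝ v w)) := by
  ext x
  simp only [LinearMap.add_apply, Module.End.mul_apply, rightOp_apply,
    Module.algebraMap_end_apply, map_mul, CliffordAlgebra.involute_involute,
    CliffordAlgebra.involute_ι, mul_assoc, ← mul_add, neg_mul]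
  rw [← neg_add, add_comm, CliffordAlgebra.ι_mul_ι_add_swap, polar_normSqForm, mul_neg,
    ← Algebra.commutes, neg_smul, Algebra.smul_def, real_inner_comm]

theorem leftOp_mul_rightOp (v w : V) :
    leftOp V v * rightOp V w = -(rightOp V w * leftOp V v) := by
  ext x
  simp [leftOp_apply, rightOp_apply, mul_assoc]

/-- Contraction of spinors with vectors. -/
def contr : V →ₗ[ℝ] Module.End ℝ (Spinor V) := (1 / 2 : ℝ) • (leftOp V - rightOp V)

theorem contr_apply (v : V) : contr v = (1 / 2 : ℝ) • (leftOp V v - rightOp V v) := rfl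

/-- `rightOp` anticommutes with `leftOp`, so only half of the Clifford relation of `leftOp`
survives: contraction is an antiderivation. -/
theorem contr_mul_leftOp (v w : V) :
    contr v * leftOp V w = algebraMap ℝ _ (inner ℝ v w) - leftOp V w * contr v :=
  half_sub_mul_of_anticomm (leftOp_mul_leftOp v w) (leftOp_mul_rightOp w v)

/-- The polarized squares of `leftOp` and `rightOp` are opposite and cancel in the difference, while
the mixed terms anticommute. -/
theorem contr_mul_contr (v w : V) : contr v * contr w = -(contr w * contr v) :=
  half_sub_mul_half_sub (leftOp_mul_leftOp v w) (rightOp_mul_rightOp v w)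
    (leftOp_mul_rightOp v w) (leftOp_mul_rightOp w v)

theorem contr_one (v : V) : contr v 1 = 0 := by
  simp [contr_apply, leftOp_apply, rightOp_apply]

variable {d : ℕ} (b : OrthonormalBasis (Fin d) ℝ V)

/-- The projection to the kernel of a contraction with a basis vector. -/
def kerProj (k : Fin d) : Module.End ℝ (Spinor V) := contr (b k) * leftOp V (b k)

theorem contr_leftOp_same (k : Fin d) :
    contr (b k) * leftOp V (b k) + leftOp V (b k) * contr (b k) = 1 := by
  rw [contr_mul_leftOp]; simp

theorem contr_leftOp_ne {j k : Fin d} (h : j ≠ k) :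
    contr (b j) * leftOp V (b k) = -(leftOp V (b k) * contr (b j)) := by
  rw [contr_mul_leftOp, b.inner_eq_zero h]; simp

theorem leftOp_leftOp_ne {j k : Fin d} (h : j ≠ k) :
    leftOp V (b j) * leftOp V (b k) = -(leftOp V (b k) * leftOp V (b j)) := by
  rw [eq_neg_iff_add_eq_zero, leftOp_mul_leftOp, b.inner_eq_zero h]; simp

theorem leftOp_sq (k : Fin d) : leftOp V (b k) * leftOp V (b k) = 1 := by
  have := leftOp_mul_leftOp (b k) (b k)
  rw [← two_smul ℝ, real_inner_self_eq_norm_sq, b.norm_eq_one, Algebra.algebraMap_eq_smul_one] at this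
  simpa using this

theorem contr_sq (k : Fin d) : contr (b k) * contr (b k) = 0 := by
  have := contr_mul_contr (b k) (b k)
  rw [eq_neg_iff_add_eq_zero, ← two_smul ℝ] at this
  exact (smul_eq_zero.mp this).resolve_left two_ne_zero

theorem kerProj_commute_contr {j k : Fin d} (h : j ≠ k) : Commute (kerProj b j) (contr (b k)) :=
  commute_mul_of_anticomm (contr_mul_contr _ _)
    (neg_eq_iff_eq_neg.mp (contr_leftOp_ne b h.symm).symm)

theorem kerProj_commute_leftOp {j k : Fin d} (h : j ≠ k) :
    Commute (kerProj b j) (leftOp V (b k)) :=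
  commute_mul_of_anticomm (contr_leftOp_ne b h) (leftOp_leftOp_ne b h)

theorem kerProj_mul_contr (k : Fin d) : kerProj b k * contr (b k) = contr (b k) :=
  mul_mul_self_of_sq_zero (contr_sq b k) (contr_leftOp_same b k)

/-- The product of the projections to the kernels of contractions. -/
def vacProj (ks : List (Fin d)) : Module.End ℝ (Spinor V) := (ks.map (kerProj b)).prod

theorem vacProj_cons (k : Fin d) (ks : List (Fin d)) :
    vacProj b (k :: ks) = kerProj b k * vacProj b ks := by simp [vacProj]

theorem vacProj_commute {x : Module.End ℝ (Spinor V)} {ks : List (Fin d)}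
    (h : ∀ k ∈ ks, Commute (kerProj b k) x) : Commute (vacProj b ks) x := by
  refine Commute.list_prod_left _ _ ?_
  simpa using h

/-- The factor of index `j` gives `contr · leftOp · leftOp = contr = kerProj · contr`, and the other
factors commute with both operators. So after projecting to the vacuum, multiplication by a vector
may be traded for a contraction. -/
theorem vacProj_mul_leftOp {ks : List (Fin d)} (hks : ks.Nodup) {j : Fin d} (hj : j ∈ ks) :
    vacProj b ks * leftOp V (b j) = vacProj b ks * contr (b j) := by
  induction ks with
  | nil => simp at hj
  | cons k ks ih =>
    rw [List.nodup_cons] at hks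
    rw [vacProj_cons, mul_assoc, mul_assoc]
    rcases List.mem_cons.mp hj with rfl | hj
    · have hne : ∀ k ∈ ks, k ≠ j := fun k hk h => hks.1 (h ▸ hk)
      rw [(vacProj_commute b fun k hk => kerProj_commute_leftOp b (hne k hk)).eq,
        (vacProj_commute b fun k hk => kerProj_commute_contr b (hne k hk)).eq,
        ← mul_assoc, ← mul_assoc]
      congr 1
      rw [kerProj_mul_contr, kerProj, mul_assoc, leftOp_sq, mul_one]
    · rw [ih hks.2 hj]

theorem vacProj_apply_one (ks : List (Fin d)) : vacProj b ks 1 = 1 := by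
  induction ks with
  | nil => simp [vacProj]
  | cons k ks ih =>
    have h1 := LinearMap.congr_fun (contr_leftOp_same b k) 1
    rw [LinearMap.add_apply, Module.End.mul_apply (leftOp V (b k)), contr_one, map_zero,
      add_zero] at h1
    rw [vacProj_cons, Module.End.mul_apply, ih, kerProj, h1, Module.End.one_apply]

/-- The filtration of spinors by degree. -/
def spinorFilt (V : Type v) [NormedAddCommGroup V] [InnerProductSpace ℝ V] :
    ℕ → Submodule ℝ (Spinor V)
  | 0 => 1
  | n + 1 => spinorFilt V n ⊔ LinearMap.range (CliffordAlgebra.ι (normSqForm V)) * spinorFilt V n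

theorem exists_mem_spinorFilt (x : Spinor V) : ∃ n, x ∈ spinorFilt V n := by
  have hm : Monotone (spinorFilt V) := monotone_nat_of_le_succ fun n => le_sup_left
  induction x using CliffordAlgebra.left_induction with
  | algebraMap r => exact ⟨0, Submodule.algebraMap_mem r⟩
  | add x y hx hy =>
    obtain ⟨n, hn⟩ := hx
    obtain ⟨m, hm'⟩ := hy
    exact ⟨max n m, add_mem (hm (le_max_left n m) hn) (hm (le_max_right n m) hm')⟩
  | ι_mul x v hx =>
    obtain ⟨n, hn⟩ := hx
    exact ⟨n + 1, Submodule.mem_sup_right (Submodule.mul_mem_mul ⟨v, rfl⟩ hn)⟩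

/-- Moving the contraction past a vector leaves a scalar multiple of an element of lower filtration.
That contractions do not raise the degree is all that `vacProj_mem_one` needs. -/
theorem contr_mem_spinorFilt (n : ℕ) (v : V) {x : Spinor V} (hx : x ∈ spinorFilt V n) :
    contr v x ∈ spinorFilt V n := by
  induction n generalizing x with
  | zero =>
    obtain ⟨r, rfl⟩ := Submodule.mem_one.mp hx
    rw [Algebra.algebraMap_eq_smul_one, map_smul, contr_one, smul_zero]
    exact zero_mem _
  | succ n ih =>
    obtain ⟨y, hy, z, hz, rfl⟩ := Submodule.mem_sup.mp hx
    rw [map_add]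
    refine add_mem (Submodule.mem_sup_left (ih hy)) ?_
    clear hx
    induction hz using Submodule.mul_induction_on' with
    | mem_mul_mem w hw z hz =>
      obtain ⟨w, rfl⟩ := hw
      rw [← leftOp_apply, ← Module.End.mul_apply, contr_mul_leftOp, LinearMap.sub_apply,
        Module.algebraMap_end_apply, Module.End.mul_apply]
      exact sub_mem (Submodule.mem_sup_left (Submodule.smul_mem _ _ hz))
        (Submodule.mem_sup_right (Submodule.mul_mem_mul ⟨w, rfl⟩ (ih hz)))
    | add z hz z' hz' h h' =>
      rw [map_add]
      exact add_mem h h'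

/-- The vacuum projection has the scalars as its range. -/
theorem vacProj_mem_one (x : Spinor V) :
    vacProj b (List.finRange d) x ∈ (1 : Submodule ℝ (Spinor V)) := by
  -- This trade lowers the filtration degree: a vector times an element of degree `n` is replaced by
  -- a contraction of the latter, still of degree `n`, and the induction applies.
  have hl : ∀ v, vacProj b (List.finRange d) * leftOp V v =
      vacProj b (List.finRange d) * contr v := by
    intro v
    have : (LinearMap.mulLeft ℝ (vacProj b (List.finRange d))) ∘ₗ leftOp V =
      (LinearMap.mulLeft ℝ (vacProj b (List.finRange d))) ∘ₗ contr :=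
      b.toBasis.ext fun k => by
        simpa using vacProj_mul_leftOp b (List.nodup_finRange d) (List.mem_finRange k)
    exact LinearMap.congr_fun this v
  obtain ⟨n, hn⟩ := exists_mem_spinorFilt x
  induction n generalizing x with
  | zero =>
    obtain ⟨r, rfl⟩ := Submodule.mem_one.mp hn
    rw [Algebra.algebraMap_eq_smul_one, map_smul, vacProj_apply_one]
    exact Submodule.smul_mem _ _ (Submodule.one_le.mp le_rfl)
  | succ n ih =>
    obtain ⟨y, hy, z, hz, rfl⟩ := Submodule.mem_sup.mp hn
    rw [map_add]
    refine add_mem (ih _ hy) ?_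
    clear hn
    induction hz using Submodule.mul_induction_on' with
    | mem_mul_mem w hw z hz =>
      obtain ⟨w, rfl⟩ := hw
      rw [← leftOp_apply, ← Module.End.mul_apply, hl]
      exact ih _ (contr_mem_spinorFilt n w hz)
    | add z _ z' _ h h' => rw [map_add]; exact add_mem h h'

/-- For each basis vector, `1 = contr · leftOp + leftOp · contr` splits the identity into `kerProj`
and a complementary term. Inserting these splittings one index at a time gives a partition of unity
passing through the vacuum. -/
theorem one_mem_span_vacProj (ks : List (Fin d)) (hks : ks.Nodup)
    (T : Subalgebra ℝ (Module.End ℝ (Spinor V))) (hT : ∀ k, contr (b k) ∈ T) :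
    (1 : Module.End ℝ (Spinor V)) ∈ Submodule.span ℝ
      {f | ∃ s : Spinor V, ∃ t ∈ T, f = Algebra.lmul ℝ (Spinor V) s * vacProj b ks * t} := by
  induction ks with
  | nil =>
    refine Submodule.subset_span ⟨1, 1, one_mem _, ?_⟩
    rw [map_one, vacProj, List.map_nil, List.prod_nil, mul_one, mul_one]
  | cons k ks ih =>
    rw [List.nodup_cons] at hks
    refine (Submodule.span_le.mpr ?_) (ih hks.2)
    rintro _ ⟨s, t, ht, rfl⟩
    have hne : ∀ j ∈ ks, j ≠ k := fun j hj h => hks.1 (h ▸ hj)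
    have hc := (vacProj_commute b fun j hj => kerProj_commute_contr b (hne j hj)).eq
    have h1 := contr_leftOp_same b k
    have key : vacProj b ks = vacProj b (k :: ks) +
        Algebra.lmul ℝ (Spinor V) (CliffordAlgebra.ι _ (b k)) * vacProj b (k :: ks) *
          contr (b k) := by
      change _ = _ + leftOp V (b k) * _ * _
      rw [vacProj_cons, mul_assoc (leftOp V (b k)), mul_assoc (kerProj b k), hc,
        ← mul_assoc (kerProj b k), kerProj_mul_contr, ← mul_assoc, ← add_mul, kerProj, h1, one_mul]
    rw [key, mul_add, add_mul]
    refine add_mem (Submodule.subset_span ⟨s, t, ht, rfl⟩) (Submodule.subset_span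
      ⟨s * CliffordAlgebra.ι _ (b k), contr (b k) * t, mul_mem (hT k) ht, ?_⟩)
    rw [map_mul]
    simp only [mul_assoc]

/-- The operators on spinors are generated by the left and right multiplications by vectors. -/
theorem mem_of_leftOp_mem_of_rightOp_mem (b : OrthonormalBasis (Fin d) ℝ V)
    (T : Subalgebra ℝ (Module.End ℝ (Spinor V)))
    (hl : ∀ v, leftOp V v ∈ T) (hr : ∀ v, rightOp V v ∈ T) (f : Module.End ℝ (Spinor V)) :
    f ∈ T := by
  have hL : ∀ s, Algebra.lmul ℝ (Spinor V) s ∈ T := by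
    intro s
    induction s using CliffordAlgebra.induction with
    | algebraMap r => rw [AlgHom.commutes]; exact T.algebraMap_mem r
    | ι v => exact hl v
    | mul x y hx hy => rw [map_mul]; exact mul_mem hx hy
    | add x y hx hy => rw [map_add]; exact add_mem hx hy
  have hc : ∀ v, contr v ∈ T := fun v => T.smul_mem (sub_mem (hl v) (hr v)) _
  have hP : vacProj b (List.finRange d) ∈ T := by
    refine Subalgebra.list_prod_mem _ ?_
    simp only [List.mem_map, forall_exists_index, and_imp]
    rintro _ k - rfl
    exact mul_mem (hc _) (hl _)
  have h1 := one_mem_span_vacProj b (List.finRange d) (List.nodup_finRange d) T fun k => hc _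
  have : ∀ y ∈ Submodule.span ℝ {f | ∃ s : Spinor V, ∃ t ∈ T,
      f = Algebra.lmul ℝ (Spinor V) s * vacProj b (List.finRange d) * t}, f * y ∈ T := by
    intro y hy
    induction hy using Submodule.span_induction with
    | zero => rw [mul_zero]; exact zero_mem _
    | add x y _ _ hx hy => rw [mul_add]; exact add_mem hx hy
    | smul r x _ hx => rw [mul_smul_comm]; exact T.smul_mem hx r
    | mem y hy =>
      obtain ⟨s, t, ht, rfl⟩ := hy
      -- The vacuum projection has scalar values `r`, and `f (s r) = r f(s)`. So behind the
      -- projection an arbitrary `f` acts like left multiplication by the spinor `f s`, which lies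
      -- in `T`.
      have : f * (Algebra.lmul ℝ (Spinor V) s * vacProj b (List.finRange d)) =
          Algebra.lmul ℝ (Spinor V) (f s) * vacProj b (List.finRange d) := by
        ext x
        obtain ⟨r, hr⟩ := Submodule.mem_one.mp (vacProj_mem_one b x)
        simp only [Module.End.mul_apply, ← hr, Algebra.algebraMap_eq_smul_one, map_smul,
          Algebra.coe_lmul_eq_mul, LinearMap.mul_apply', mul_one]
      rw [← mul_assoc, this]
      exact mul_mem (mul_mem (hL _) hP) ht
  simpa using this 1 h1

end Spinor

/-! ### The spin representation identifies `Cl^{d,d}` with the operators on spinors. -/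

section SpinRep

variable {d : ℕ} {V : Type v} [NormedAddCommGroup V] [InnerProductSpace ℝ V]
variable (b : OrthonormalBasis (Fin d) ℝ V)

/-- The algebra `Cl^{d,0} ⊗̂ Cl^{0,d}`. -/
abbrev ClDD (d : ℕ) : Type := clGrade d 0 ᵍ⊗[ℝ] clGrade 0 d

/-- Its total grading. -/
abbrev clddGrade (d : ℕ) : ZMod 2 → Submodule ℝ (ClDD d) :=
  tensorGrade (clGrade d 0) (clGrade 0 d)

/-- Coordinates of a vector, as a vector of `ℝ^{0,d}`. -/
def posCoord : V ≃ₗ[ℝ] (Fin 0 ⊕ Fin d → ℝ) :=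
  b.toBasis.equivFun ≪≫ₗ LinearEquiv.funCongrLeft ℝ ℝ (Equiv.emptySum (Fin 0) (Fin d))

/-- Coordinates of a vector, as a vector of `ℝ^{d,0}`. -/
def negCoord : V ≃ₗ[ℝ] (Fin d ⊕ Fin 0 → ℝ) :=
  b.toBasis.equivFun ≪≫ₗ LinearEquiv.funCongrLeft ℝ ℝ (Equiv.sumEmpty (Fin d) (Fin 0))

theorem posCoord_basis (i : Fin d) : posCoord b (b i) = Pi.single (Sum.inr i) 1 := by
  classical
  ext (j | j)
  · exact j.elim0
  · simp [posCoord, LinearEquiv.funCongrLeft, Pi.single_apply, LinearMap.funLeft, eq_comm]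

theorem negCoord_basis (i : Fin d) : negCoord b (b i) = Pi.single (Sum.inl i) 1 := by
  classical
  ext (j | j)
  · simp [negCoord, LinearEquiv.funCongrLeft, Pi.single_apply, LinearMap.funLeft, eq_comm]
  · exact j.elim0

theorem formPQ_posCoord (v : V) : formPQ 0 d (posCoord b v) = ‖v‖ ^ 2 := by
  rw [formPQ_apply, ← b.sum_sq_norm_inner_right v]
  simp [posCoord, LinearEquiv.funCongrLeft, LinearMap.funLeft, b.repr_apply_apply, pow_two]

theorem formPQ_negCoord (v : V) : formPQ d 0 (negCoord b v) = -‖v‖ ^ 2 := by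
  rw [formPQ_apply, ← b.sum_sq_norm_inner_right v]
  simp [negCoord, LinearEquiv.funCongrLeft, LinearMap.funLeft, b.repr_apply_apply, pow_two]

/-- The vectors of square `‖v‖²` in `Cl^{d,d}`. -/
def posC : V →ₗ[ℝ] ClDD d :=
  (GradedTensorProduct.includeRight (clGrade d 0) (clGrade 0 d)).toLinearMap ∘ₗ
    CliffordAlgebra.ι (formPQ 0 d) ∘ₗ (posCoord b).toLinearMap

/-- The vectors of square `-‖v‖²` in `Cl^{d,d}`. -/
def negC : V →ₗ[ℝ] ClDD d :=
  (GradedTensorProduct.includeLeft (clGrade d 0) (clGrade 0 d)).toLinearMap ∘ₗ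
    CliffordAlgebra.ι (formPQ d 0) ∘ₗ (negCoord b).toLinearMap

theorem posC_apply (v : V) :
    posC b v = 1 ᵍ⊗ₜ[ℝ] CliffordAlgebra.ι (formPQ 0 d) (posCoord b v) := rfl

theorem negC_apply (v : V) :
    negC b v = CliffordAlgebra.ι (formPQ d 0) (negCoord b v) ᵍ⊗ₜ[ℝ] 1 := rfl

theorem posC_basis (i : Fin d) : posC b (b i) = 1 ᵍ⊗ₜ[ℝ] Cl.pos i := by
  rw [posC_apply, posCoord_basis, Cl.pos]

theorem negC_basis (i : Fin d) : negC b (b i) = Cl.neg i ᵍ⊗ₜ[ℝ] 1 := by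
  rw [negC_apply, negCoord_basis, Cl.neg]

theorem posC_mul_self (v : V) : posC b v * posC b v = algebraMap ℝ _ (‖v‖ ^ 2) := by
  rw [posC_apply, gtmul_mul_one, CliffordAlgebra.ι_sq_scalar, formPQ_posCoord]
  exact AlgHom.commutes (GradedTensorProduct.includeRight (clGrade d 0) (clGrade 0 d)) _

theorem negC_mul_self (v : V) : negC b v * negC b v = algebraMap ℝ _ (-‖v‖ ^ 2) := by
  rw [negC_apply, gtmul_one_mul, CliffordAlgebra.ι_sq_scalar, formPQ_negCoord]
  exact AlgHom.commutes (GradedTensorProduct.includeLeft (clGrade d 0) (clGrade 0 d)) _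

theorem negC_mul_posC (v w : V) : negC b v * posC b w = -(posC b w * negC b v) := by
  rw [negC_apply, posC_apply, gtmul_one_mul,
    tmul_mul_tmul_of_mem _ _ _ _ (CliffordAlgebra.ι_mem_evenOdd_one _ _)
      (CliffordAlgebra.ι_mem_evenOdd_one _ _)]
  simp

theorem posC_mem (v : V) : posC b v ∈ clddGrade d 1 :=
  tmul_mem_tensorGrade (zero_add 1) SetLike.GradedOne.one_mem
    (CliffordAlgebra.ι_mem_evenOdd_one _ _)

theorem negC_mem (v : V) : negC b v ∈ clddGrade d 1 :=
  tmul_mem_tensorGrade (add_zero 1) (CliffordAlgebra.ι_mem_evenOdd_one _ _)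
    SetLike.GradedOne.one_mem

/-- A property of the elements of `Cl^{d,d}` holds for all elements if it holds on the generators
and is inherited by sums and products. -/
theorem cldd_induction {p : ClDD d → Prop} (hr : ∀ r : ℝ, p (algebraMap ℝ _ r))
    (hpos : ∀ v, p (posC b v)) (hneg : ∀ v, p (negC b v))
    (hadd : ∀ x y, p x → p y → p (x + y)) (hmul : ∀ x y, p x → p y → p (x * y)) (x : ClDD d) :
    p x := by
  have hL : ∀ a : Cl d 0, p (a ᵍ⊗ₜ[ℝ] 1) := by
    intro a
    induction a using CliffordAlgebra.induction with
    | algebraMap r => exact hr r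
    | ι v =>
      obtain ⟨v, rfl⟩ := (negCoord b).surjective v
      exact hneg v
    | mul x y hx hy => rw [← gtmul_one_mul]; exact hmul _ _ hx hy
    | add x y hx hy =>
      have := hadd _ _ hx hy
      rwa [← gtmk_apply, ← gtmk_apply, ← LinearMap.add_apply, ← map_add] at this
  have hR : ∀ a : Cl 0 d, p (1 ᵍ⊗ₜ[ℝ] a) := by
    intro a
    induction a using CliffordAlgebra.induction with
    | algebraMap r =>
      have := hr r
      rwa [GradedTensorProduct.algebraMap_def'] at this
    | ι v =>
      obtain ⟨v, rfl⟩ := (posCoord b).surjective v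
      exact hpos v
    | mul x y hx hy => rw [← gtmul_mul_one]; exact hmul _ _ hx hy
    | add x y hx hy =>
      have := hadd _ _ hx hy
      rwa [← gtmk_apply, ← gtmk_apply, ← map_add] at this
  induction x using gtensor_induction with
  | h0 => simpa using hr 0
  | hadd x y hx hy => exact hadd x y hx hy
  | ht a c =>
    have := hmul _ _ (hL a) (hR c)
    rwa [gtmul_one_mul, mul_one] at this

section Lift

variable {B : Type*} [Ring B] [Algebra ℝ B] (p n : V →ₗ[ℝ] B)
  (hp : ∀ v, p v * p v = algebraMap ℝ B (‖v‖ ^ 2))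
  (hn : ∀ v, n v * n v = algebraMap ℝ B (-‖v‖ ^ 2))
  (hnp : ∀ v w, n v * p w = -(p w * n v))

/-- The universal property of `Cl^{d,d}`. -/
def clddLift : ClDD d →ₐ[ℝ] B :=
  gtLift
    (CliffordAlgebra.lift (formPQ d 0) ⟨n ∘ₗ (negCoord b).symm.toLinearMap, fun m => by
      obtain ⟨v, rfl⟩ := (negCoord b).surjective m
      simp [hn, formPQ_negCoord]⟩)
    (CliffordAlgebra.lift (formPQ 0 d) ⟨p ∘ₗ (posCoord b).symm.toLinearMap, fun m => by
      obtain ⟨v, rfl⟩ := (posCoord b).surjective m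
      simp [hp, formPQ_posCoord]⟩)
    (graded_comm_of_generators _ _ CliffordAlgebra.adjoin_range_ι CliffordAlgebra.adjoin_range_ι
      (by rintro _ ⟨v, rfl⟩; exact CliffordAlgebra.ι_mem_evenOdd_one _ _)
      (by rintro _ ⟨v, rfl⟩; exact CliffordAlgebra.ι_mem_evenOdd_one _ _)
      (by
        rintro _ ⟨v, rfl⟩ _ ⟨w, rfl⟩
        rw [CliffordAlgebra.lift_ι_apply, CliffordAlgebra.lift_ι_apply]
        exact hnp _ _))

@[simp] theorem clddLift_posC (v : V) : clddLift b p n hp hn hnp (posC b v) = p v := by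
  rw [posC_apply, clddLift, gtLift_tmul]
  simp

@[simp] theorem clddLift_negC (v : V) : clddLift b p n hp hn hnp (negC b v) = n v := by
  rw [negC_apply, clddLift, gtLift_tmul]
  simp

end Lift

theorem leftOp_mul_self (v : V) : leftOp V v * leftOp V v = algebraMap ℝ _ (‖v‖ ^ 2) := by
  ext x
  simp only [Module.End.mul_apply, leftOp_apply, Module.algebraMap_end_apply, ← mul_assoc,
    CliffordAlgebra.ι_sq_scalar, normSqForm_apply]
  rw [Algebra.smul_def]

theorem rightOp_mul_self (v : V) : rightOp V v * rightOp V v = algebraMap ℝ _ (-‖v‖ ^ 2) := by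
  ext x
  simp only [Module.End.mul_apply, rightOp_apply, Module.algebraMap_end_apply, map_mul,
    CliffordAlgebra.involute_involute, CliffordAlgebra.involute_ι, mul_assoc, neg_mul, mul_neg,
    CliffordAlgebra.ι_sq_scalar, normSqForm_apply]
  rw [← Algebra.commutes, neg_smul, Algebra.smul_def]

/-- The action of `Cl^{d,d}` on spinors. -/
def spin : ClDD d →ₐ[ℝ] Module.End ℝ (Spinor V) :=
  clddLift b (leftOp V) (rightOp V) leftOp_mul_self rightOp_mul_self fun v w => by
    rw [leftOp_mul_rightOp w v, neg_neg]

theorem spin_posC (v : V) : spin b (posC b v) = leftOp V v := clddLift_posC ..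

theorem spin_negC (v : V) : spin b (negC b v) = rightOp V v := clddLift_negC ..

/-- The basis of a Clifford algebra given by a basis of the vectors. -/
def cliffordBasis {M : Type*} [AddCommGroup M] [Module ℝ M] (Q : QuadraticForm ℝ M)
    (e : Module.Basis (Fin d) ℝ M) : Module.Basis (Finset (Fin d)) ℝ (CliffordAlgebra Q) :=
  e.ExteriorAlgebra.map (CliffordAlgebra.equivExterior Q).symm

theorem finrank_clifford {M : Type*} [AddCommGroup M] [Module ℝ M] (Q : QuadraticForm ℝ M)
    (e : Module.Basis (Fin d) ℝ M) : Module.finrank ℝ (CliffordAlgebra Q) = 2 ^ d := by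
  rw [Module.finrank_eq_card_basis (cliffordBasis Q e)]; simp

theorem finite_clifford {M : Type*} [AddCommGroup M] [Module ℝ M] (Q : QuadraticForm ℝ M)
    (e : Module.Basis (Fin d) ℝ M) : Module.Finite ℝ (CliffordAlgebra Q) :=
  (cliffordBasis Q e).finiteDimensional_of_finite

/-- Surjectivity holds because left and right multiplications by vectors generate all operators;
injectivity follows since both sides have dimension `2^d · 2^d`. -/
theorem spin_bijective : Function.Bijective (spin b) := by
  have hs : Function.Surjective (spin b) := fun f =>
    mem_of_leftOp_mem_of_rightOp_mem b (spin b).range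
      (fun v => ⟨posC b v, spin_posC b v⟩) (fun v => ⟨negC b v, spin_negC b v⟩) f
  refine ⟨?_, hs⟩
  have := finite_clifford (normSqForm V) b.toBasis
  have := finite_clifford (formPQ d 0) (b.toBasis.map (negCoord b))
  have := finite_clifford (formPQ 0 d) (b.toBasis.map (posCoord b))
  have hf : Module.Finite ℝ (ClDD d) := inferInstanceAs (Module.Finite ℝ (Cl d 0 ⊗[ℝ] Cl 0 d))
  refine (LinearMap.injective_iff_surjective_of_finrank_eq_finrank (f := (spin b).toLinearMap)
    ?_).mpr hs
  rw [Module.finrank_linearMap, finrank_clifford (normSqForm V) b.toBasis]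
  refine (Module.finrank_tensorProduct (R := ℝ) (S := ℝ) (M := Cl d 0) (M' := Cl 0 d)).trans ?_
  rw [finrank_clifford (formPQ d 0) (b.toBasis.map (negCoord b)),
    finrank_clifford (formPQ 0 d) (b.toBasis.map (posCoord b))]

/-- `Cl^{d,d}` is the algebra of all operators on spinors. -/
def spinEquiv : ClDD d ≃ₐ[ℝ] Module.End ℝ (Spinor V) :=
  AlgEquiv.ofBijective (spin b) (spin_bijective b)

theorem spinEquiv_apply (c : ClDD d) : spinEquiv b c = spin b c := rfl

end SpinRep

/-! ### Lifting orthogonal transformations to even elements of `Cl^{d,d}`. -/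

section SpinLift

variable {d : ℕ} {V : Type v} [NormedAddCommGroup V] [InnerProductSpace ℝ V]
variable (b : OrthonormalBasis (Fin d) ℝ V)

/-- Left and right multiplications by vectors both anticommute with the involution, which therefore
implements the parity of `Cl^{d,d}` on spinors. Evenness of an element can then be read off from its
operator. -/
theorem spin_parityHom (c : ClDD d) (x : Spinor V) :
    spin b (parityHom (clddGrade d) c) (CliffordAlgebra.involute x) =
      CliffordAlgebra.involute (spin b c x) := by
  induction c using cldd_induction b generalizing x with
  | hr r => simp
  | hpos v =>
    rw [parityHom_of_mem _ (posC_mem b v)]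
    simp [spin_posC, leftOp_apply]
  | hneg v =>
    rw [parityHom_of_mem _ (negC_mem b v)]
    simp [spin_negC, rightOp_apply]
  | hadd y z hy hz => simp only [map_add, LinearMap.add_apply, hy, hz]
  | hmul y z hy hz => simp only [map_mul, Module.End.mul_apply, hy, hz]

theorem parityHom_eq_self_of_spin {c : ClDD d}
    (h : ∀ x, spin b c (CliffordAlgebra.involute x) = CliffordAlgebra.involute (spin b c x)) :
    parityHom (clddGrade d) c = c := by
  refine (spin_bijective b).1 (LinearMap.ext fun x => ?_)
  obtain ⟨y, rfl⟩ : ∃ y, CliffordAlgebra.involute y = x := ⟨_, CliffordAlgebra.involute_involute x⟩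
  rw [spin_parityHom, h]

variable {G : Type u} [Group G] (ρ : Representation ℝ G V) (hρ : ∀ g v, ‖ρ g v‖ = ‖v‖)

/-- The automorphism of the spinors induced by a group element. -/
def spinorMap (g : G) : Spinor V →ₐ[ℝ] Spinor V :=
  CliffordAlgebra.map
    { toLinearMap := ρ g
      map_app' := fun v => by simp [normSqForm_apply, hρ] }

theorem spinorMap_ι (g : G) (v : V) :
    spinorMap ρ hρ g (CliffordAlgebra.ι _ v) = CliffordAlgebra.ι _ (ρ g v) :=
  CliffordAlgebra.map_apply_ι _ _

theorem spinorMap_involute (g : G) (x : Spinor V) :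
    spinorMap ρ hρ g (CliffordAlgebra.involute x) =
      CliffordAlgebra.involute (spinorMap ρ hρ g x) := by
  have : (spinorMap ρ hρ g).comp CliffordAlgebra.involute =
      CliffordAlgebra.involute.comp (spinorMap ρ hρ g) := by
    ext v
    simp [spinorMap_ι]
  exact DFunLike.congr_fun this x

theorem spinorMap_one : spinorMap ρ hρ 1 = AlgHom.id ℝ (Spinor V) := by
  ext v
  simp [spinorMap_ι]

theorem spinorMap_mul (g h : G) :
    spinorMap ρ hρ (g * h) = (spinorMap ρ hρ g).comp (spinorMap ρ hρ h) := by
  ext v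
  simp [spinorMap_ι]

/-- The canonical lift of an orthogonal transformation to `Cl^{d,d}`. -/
def spinElt (g : G) : ClDD d := (spinEquiv b).symm (spinorMap ρ hρ g).toLinearMap

theorem spin_spinElt (g : G) : spin b (spinElt b ρ hρ g) = (spinorMap ρ hρ g).toLinearMap :=
  (spinEquiv b).apply_symm_apply _

theorem spinElt_one : spinElt b ρ hρ 1 = 1 := by
  refine (spin_bijective b).1 ?_
  rw [spin_spinElt, spinorMap_one, map_one]; rfl

/-- The induced automorphisms of the spinors compose without any sign or phase, and `spin` is
injective. This is why `ω` needs no correction. -/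
theorem spinElt_mul (g h : G) :
    spinElt b ρ hρ (g * h) = spinElt b ρ hρ g * spinElt b ρ hρ h := by
  refine (spin_bijective b).1 ?_
  rw [map_mul, spin_spinElt, spin_spinElt, spin_spinElt, spinorMap_mul]; rfl

theorem spinElt_mul_inv (g : G) : spinElt b ρ hρ g * spinElt b ρ hρ g⁻¹ = 1 := by
  rw [← spinElt_mul, mul_inv_cancel, spinElt_one]

theorem spinElt_inv_mul (g : G) : spinElt b ρ hρ g⁻¹ * spinElt b ρ hρ g = 1 := by
  rw [← spinElt_mul, inv_mul_cancel, spinElt_one]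

/-- The automorphism induced by an orthogonal map commutes with the involution whatever its
determinant, so reflections also lift to even elements. This is why `h` needs no correction. -/
theorem parityHom_spinElt (g : G) :
    parityHom (clddGrade d) (spinElt b ρ hρ g) = spinElt b ρ hρ g :=
  parityHom_eq_self_of_spin b fun x => by
    rw [spin_spinElt]; exact spinorMap_involute ρ hρ g x

theorem spinElt_mem (g : G) : spinElt b ρ hρ g ∈ clddGrade d 0 :=
  (mem_iff_parityHom _).mpr (by rw [parityHom_spinElt, sgn_zero, one_smul])

/-- An algebra automorphism `α` satisfies `α(v x) = α(v) α(x)`; for the negative generators the same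
argument uses right multiplication and compatibility with the involution. -/
theorem spinElt_mul_posC (g : G) (v : V) :
    spinElt b ρ hρ g * posC b v = posC b (ρ g v) * spinElt b ρ hρ g := by
  refine (spin_bijective b).1 (LinearMap.ext fun x => ?_)
  rw [map_mul, map_mul, spin_spinElt, spin_posC, spin_posC]
  simp [leftOp_apply, spinorMap_ι]

theorem spinElt_mul_negC (g : G) (v : V) :
    spinElt b ρ hρ g * negC b v = negC b (ρ g v) * spinElt b ρ hρ g := by
  refine (spin_bijective b).1 (LinearMap.ext fun x => ?_)
  rw [map_mul, map_mul, spin_spinElt, spin_negC, spin_negC]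
  simp [rightOp_apply, spinorMap_ι, spinorMap_involute]

end SpinLift

/-! ### An even rank one idempotent in `Cl^{d,d}`. -/

section Vacuum

/-- A full rank one idempotent of a graded algebra which is even. -/
structure VacuumData {C : Type*} [Ring C] [Algebra ℝ C] (𝒞 : ZMod 2 → Submodule ℝ C)
    [GradedAlgebra 𝒞] where
  /-- the index set of the partition of unity -/
  ι : Type
  [fintype : Fintype ι]
  /-- the idempotent -/
  p : C
  /-- the vacuum expectation value -/
  ev : C →ₗ[ℝ] ℝ
  /-- the left factors -/
  a : ι → C
  /-- the right factors -/
  c : ι → C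
  even : parityHom 𝒞 p = p
  ev_p : ev p = 1
  idem : p * p = p
  corner : ∀ x, p * x * p = ev x • p
  sum : ∑ i, a i * p * c i = 1

attribute [instance] VacuumData.fintype

variable {d : ℕ} {V : Type v} [NormedAddCommGroup V] [InnerProductSpace ℝ V]

/-- A functional not vanishing at `1` is averaged over the involution. Its invariance makes the rank
one projection `x ↦ l(x) 1` an even operator. -/
theorem exists_even_functional : ∃ l : Spinor V →ₗ[ℝ] ℝ, l 1 = 1 ∧
    ∀ x, l (CliffordAlgebra.involute x) = l x := by
  obtain ⟨f, hf⟩ : ∃ f : Module.Dual ℝ (Spinor V), f 1 ≠ 0 := by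
    by_contra! h
    exact one_ne_zero ((Module.forall_dual_apply_eq_zero_iff ℝ (1 : Spinor V)).mp h)
  refine ⟨(2 * f 1)⁻¹ • (f + f ∘ₗ CliffordAlgebra.involute.toLinearMap), ?_, fun x => ?_⟩
  · simp only [LinearMap.smul_apply, LinearMap.add_apply, LinearMap.comp_apply,
      AlgHom.toLinearMap_apply, map_one, ← two_mul, smul_eq_mul]
    exact inv_mul_cancel₀ (mul_ne_zero two_ne_zero hf)
  · simp only [LinearMap.smul_apply, LinearMap.add_apply, LinearMap.comp_apply,
      AlgHom.toLinearMap_apply, CliffordAlgebra.involute_involute, add_comm]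

/-- The operator of rank one given by a functional and the spinor `1`. -/
def toVacuum (m : Spinor V →ₗ[ℝ] ℝ) : Module.End ℝ (Spinor V) := m.smulRight 1

theorem toVacuum_apply (m : Spinor V →ₗ[ℝ] ℝ) (x : Spinor V) : toVacuum m x = m x • 1 := rfl

theorem mul_toVacuum_apply (f : Module.End ℝ (Spinor V)) (m : Spinor V →ₗ[ℝ] ℝ) (x : Spinor V) :
    (f * toVacuum m) x = m x • f 1 := by
  rw [Module.End.mul_apply, toVacuum_apply, map_smul]

/-- This is the expansion of `x` in a basis: the coordinate functional sends `x` to a multiple of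
`1`, the projection fixes `1`, and multiplication by the basis element restores the summand. -/
theorem sum_lmul_mul_toVacuum (b : OrthonormalBasis (Fin d) ℝ V) {l : Spinor V →ₗ[ℝ] ℝ}
    (hl : l 1 = 1) : ∑ i, Algebra.lmul ℝ (Spinor V) (cliffordBasis (normSqForm V) b.toBasis i) *
      toVacuum l * toVacuum ((cliffordBasis (normSqForm V) b.toBasis).coord i) = 1 := by
  ext x
  rw [LinearMap.sum_apply, Module.End.one_apply]
  refine Eq.trans (Finset.sum_congr rfl fun i _ => ?_)
    ((cliffordBasis (normSqForm V) b.toBasis).sum_repr x)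
  rw [mul_toVacuum_apply, Module.End.mul_apply, toVacuum_apply, hl, one_smul,
    Algebra.coe_lmul_eq_mul, LinearMap.mul_apply', mul_one]
  rfl

/-- The vacuum idempotent of `Cl^{d,d}`. -/
def cliffordVacuum (b : OrthonormalBasis (Fin d) ℝ V) : VacuumData (clddGrade d) where
  ι := Finset (Fin d)
  p := (spinEquiv b).symm (toVacuum (exists_even_functional (V := V)).choose)
  -- With `p x = l(x) 1`, the compression `p f p` sends `x` to `l(x) l(f 1) 1`, so the expectation
  -- value of `f` is `l(f 1)`.
  ev := (exists_even_functional (V := V)).choose ∘ₗ LinearMap.applyₗ (1 : Spinor V) ∘ₗ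
    (spinEquiv b).toLinearMap
  a i := (spinEquiv b).symm
    (Algebra.lmul ℝ (Spinor V) (cliffordBasis (normSqForm V) b.toBasis i))
  c i := (spinEquiv b).symm (toVacuum ((cliffordBasis (normSqForm V) b.toBasis).coord i))
  even := parityHom_eq_self_of_spin b fun x => by
    rw [← spinEquiv_apply, AlgEquiv.apply_symm_apply, toVacuum_apply, toVacuum_apply,
      (exists_even_functional (V := V)).choose_spec.2, map_smul, map_one]
  ev_p := by
    simp only [LinearMap.comp_apply, AlgEquiv.toLinearMap_apply, AlgEquiv.apply_symm_apply,
      LinearMap.applyₗ_apply_apply, toVacuum_apply, map_smul,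
      (exists_even_functional (V := V)).choose_spec.1, smul_eq_mul, mul_one]
  idem := by
    apply (spinEquiv b).injective
    rw [map_mul, AlgEquiv.apply_symm_apply]
    ext y
    rw [mul_toVacuum_apply, toVacuum_apply, toVacuum_apply,
      (exists_even_functional (V := V)).choose_spec.1, one_smul]
  corner x := by
    apply (spinEquiv b).injective
    rw [map_mul, map_mul, map_smul, AlgEquiv.apply_symm_apply]
    ext y
    rw [mul_toVacuum_apply, Module.End.mul_apply, toVacuum_apply, LinearMap.smul_apply,
      toVacuum_apply, smul_comm]
    rfl
  sum := by
    apply (spinEquiv b).injective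
    simp only [map_sum, map_mul, AlgEquiv.apply_symm_apply, map_one]
    exact sum_lmul_mul_toVacuum b (exists_even_functional (V := V)).choose_spec.1

end Vacuum

/-! ### Changing the sign of the quadratic form by multiplying vectors with `i`. -/

section Rotation

variable {G : Type u} [Group G] (D : SymmetryData G)

namespace DiracAlg

section General

variable {V : Type v} [AddCommGroup V] [Module ℝ V]
variable {Q : QuadraticForm ℝ V} {ρ : Representation ℝ G V}

theorem vec_mul_vec_add_swap (v w : V) :
    vec D Q ρ v * vec D Q ρ w + vec D Q ρ w * vec D Q ρ v =
      algebraMap ℝ _ (QuadraticMap.polar Q v w) := by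
  have h := vec_mul_self D Q ρ (v + w)
  rw [map_add, add_mul, mul_add, mul_add, vec_mul_self, vec_mul_self] at h
  rw [QuadraticMap.polar, map_sub, map_sub, ← h]
  abel

theorem induction {p : DiracAlg D Q ρ → Prop} (hincl : ∀ a, p (incl D Q ρ a))
    (hvec : ∀ v, p (vec D Q ρ v)) (hadd : ∀ x y, p x → p y → p (x + y))
    (hmul : ∀ x y, p x → p y → p (x * y)) (x : DiracAlg D Q ρ) : p x := by
  obtain ⟨x, rfl⟩ := RingQuot.mkAlgHom_surjective ℝ (DiracAlg.Rel D Q ρ) x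
  change p (mk D Q ρ x)
  induction x using FreeAlgebra.induction with
  | grade0 r =>
    rw [AlgHom.commutes, ← AlgHom.commutes (incl D Q ρ)]
    exact hincl _
  | grade1 x =>
    rcases x with a | v
    · exact hincl a
    · exact hvec v
  | mul x y hx hy => rw [map_mul]; exact hmul _ _ hx hy
  | add x y hx hy => rw [map_add]; exact hadd _ _ hx hy

end General

variable {V : Type v} [AddCommGroup V] [Module ℝ V] {W : Type w} [AddCommGroup W] [Module ℝ W]
variable (Q : QuadraticForm ℝ V) (Q₁ Q₂ : QuadraticForm ℝ W) (hQ : ∀ w, Q₁ w = -Q₂ w)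
variable (ρ : Representation ℝ G V) (σ₁ σ₂ : Representation ℝ G W)
  (hσ : ∀ g w, σ₁ g w = sgn (D.sdeg g) • σ₂ g w)
variable (c : ℂ) (hc : c * c = -1) (hc' : ∀ a, conjPow a c = sgn a • c)

/-- The linear map `(v, w) ↦ v + c w` into `A^{V ⊕ W}`. -/
def rotateVec : V × W →ₗ[ℝ] DiracAlg D (Q.prod Q₂) (ρ.prod σ₂) :=
  (vec D (Q.prod Q₂) (ρ.prod σ₂) ∘ₗ LinearMap.inl ℝ V W).coprod
    (LinearMap.mulLeft ℝ (incl D (Q.prod Q₂) (ρ.prod σ₂) (D.scalar c)) ∘ₗ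
      vec D (Q.prod Q₂) (ρ.prod σ₂) ∘ₗ LinearMap.inr ℝ V W)

theorem rotateVec_apply (v : V) (w : W) : rotateVec D Q Q₂ ρ σ₂ c (v, w) =
    vec D (Q.prod Q₂) (ρ.prod σ₂) (v, 0) + incl D (Q.prod Q₂) (ρ.prod σ₂) (D.scalar c) *
      vec D (Q.prod Q₂) (ρ.prod σ₂) (0, w) := by
  simp [rotateVec]

-- The two summands are orthogonal and `c` is central for the vectors, so the mixed terms cancel and
-- the square of `c w` is `c² Q₂(w) = -Q₂(w)`.
include hQ hc in
theorem rotateVec_mul_self (x : V × W) :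
    rotateVec D Q Q₂ ρ σ₂ c x * rotateVec D Q Q₂ ρ σ₂ c x =
      algebraMap ℝ _ ((Q.prod Q₁) x) := by
  obtain ⟨v, w⟩ := x
  have h1 := vec_mul_vec_add_swap D (Q := Q.prod Q₂) (ρ := ρ.prod σ₂) (v, 0) (0, w)
  have hp : QuadraticMap.polar (Q.prod Q₂) (v, 0) (0, w) = 0 := by
    simp [QuadraticMap.polar]
  have hs := vec_mul_self D (Q.prod Q₂) (ρ.prod σ₂) (v, 0)
  have ht := vec_mul_self D (Q.prod Q₂) (ρ.prod σ₂) (0, w)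
  have h2 := scalar_mul_vec D (Q.prod Q₂) (ρ.prod σ₂) c (v, 0)
  have h3 := scalar_mul_vec D (Q.prod Q₂) (ρ.prod σ₂) c (0, w)
  have h4 : incl D (Q.prod Q₂) (ρ.prod σ₂) (D.scalar c) *
      incl D (Q.prod Q₂) (ρ.prod σ₂) (D.scalar c) = -1 := by
    rw [← map_mul, ← map_mul, hc, map_neg, map_neg, map_one, map_one]
  rw [rotateVec_apply]
  rw [hp, map_zero] at h1
  generalize vec D (Q.prod Q₂) (ρ.prod σ₂) (v, 0) = x at *
  generalize vec D (Q.prod Q₂) (ρ.prod σ₂) (0, w) = y at *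
  generalize incl D (Q.prod Q₂) (ρ.prod σ₂) (D.scalar c) = z at *
  have e1 : (x + z * y) * (x + z * y) = x * x + z * (x * y + y * x) + (z * z) * (y * y) := by
    have a1 : x * (z * y) = z * (x * y) := by rw [← mul_assoc, ← h2, mul_assoc]
    have a2 : z * y * (z * y) = (z * z) * (y * y) := by
      rw [mul_assoc, ← mul_assoc y, ← h3, mul_assoc z, mul_assoc]
    rw [add_mul, mul_add, mul_add, a1, a2, mul_assoc z y x, mul_add]
    abel
  rw [e1, h1, hs, ht, h4, mul_zero, add_zero, neg_one_mul, ← map_neg, ← map_add]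
  simp [hQ]

/-- The homomorphism `A^{V ⊕ W₁} → A^{V ⊕ W₂}` which is `v ↦ v` on `V` and `w ↦ c w` on `W₁`. -/
def rotate : DiracAlg D (Q.prod Q₁) (ρ.prod σ₁) →ₐ[ℝ] DiracAlg D (Q.prod Q₂) (ρ.prod σ₂) :=
  lift (incl D (Q.prod Q₂) (ρ.prod σ₂)) (rotateVec D Q Q₂ ρ σ₂ c)
    (rotateVec_mul_self D Q Q₁ Q₂ hQ ρ σ₂ c hc)
    (fun z x => by
      obtain ⟨v, w⟩ := x
      rw [rotateVec_apply, mul_add, add_mul, scalar_mul_vec, mul_assoc _ (vec D _ _ (0, w)),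
        ← scalar_mul_vec D _ _ z (0, w), ← mul_assoc, ← mul_assoc, ← map_mul, ← map_mul,
        ← map_mul, ← map_mul, mul_comm])
    -- Moving `g` past `c` conjugates it, which by `hc'` is the sign `(-1)^{s(g)}`; this sign turns
    -- `σ₂` into `σ₁`.
    (fun g x => by
      obtain ⟨v, w⟩ := x
      have e : (ρ.prod σ₁) g (v, w) = (ρ g v, σ₁ g w) := rfl
      rw [e, rotateVec_apply, rotateVec_apply, mul_add, of_mul_vec, ← mul_assoc, ← map_mul,
        D.of_mul_scalar, hc', map_smul, map_mul, map_smul, mul_assoc, smul_mul_assoc, of_mul_vec,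
        add_mul, smul_add, hσ, mul_smul_comm]
      have e1 : (ρ.prod σ₂) g (v, 0) = (ρ g v, 0) := by simp
      have e2 : (ρ.prod σ₂) g (0, w) = (0, σ₂ g w) := by simp
      have e3 : ((0, sgn (D.sdeg g) • σ₂ g w) : V × W) = sgn (D.sdeg g) • (0, σ₂ g w) := by simp
      rw [e1, e2, e3, map_smul, mul_smul_comm, smul_mul_assoc, mul_assoc, smul_comm])

@[simp] theorem rotate_incl (a : D.Alg) :
    rotate D Q Q₁ Q₂ hQ ρ σ₁ σ₂ hσ c hc hc' (incl D _ _ a) = incl D _ _ a := lift_incl ..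

theorem rotate_vec (v : V) (w : W) :
    rotate D Q Q₁ Q₂ hQ ρ σ₁ σ₂ hσ c hc hc' (vec D _ _ (v, w)) =
      vec D (Q.prod Q₂) (ρ.prod σ₂) (v, 0) + incl D (Q.prod Q₂) (ρ.prod σ₂) (D.scalar c) *
      vec D (Q.prod Q₂) (ρ.prod σ₂) (0, w) := by
  rw [rotate, lift_vec, rotateVec_apply]

/-- The second rotation multiplies by the inverse scalar, with the roles of the two forms and
representations exchanged. For `c = ±i` this gives both composites needed for `sumEquivDiff`. -/
theorem rotate_rotate (hQ' : ∀ w, Q₂ w = -Q₁ w) (hσ' : ∀ g w, σ₂ g w = sgn (D.sdeg g) • σ₁ g w)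
    (c' : ℂ) (h1 : c' * c' = -1) (h2 : ∀ a, conjPow a c' = sgn a • c') (hcc : c * c' = 1) :
    (rotate D Q Q₂ Q₁ hQ' ρ σ₂ σ₁ hσ' c' h1 h2).comp
      (rotate D Q Q₁ Q₂ hQ ρ σ₁ σ₂ hσ c hc hc') = AlgHom.id ℝ _ := by
  refine hom_ext (fun a => by simp) fun x => ?_
  obtain ⟨v, w⟩ := x
  rw [AlgHom.comp_apply, rotate_vec, map_add, map_mul, rotate_vec, rotate_vec, rotate_incl]
  have e : ((0, 0) : V × W) = 0 := rfl
  rw [e, map_zero, mul_zero, add_zero, zero_add, ← mul_assoc, ← map_mul, ← map_mul, hcc, map_one,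
    map_one, one_mul, ← map_add]
  simp

theorem parity_rotate (x : DiracAlg D (Q.prod Q₁) (ρ.prod σ₁)) :
    parity D _ _ (rotate D Q Q₁ Q₂ hQ ρ σ₁ σ₂ hσ c hc hc' x) =
      rotate D Q Q₁ Q₂ hQ ρ σ₁ σ₂ hσ c hc hc' (parity D _ _ x) := by
  have : (parity D _ _).comp (rotate D Q Q₁ Q₂ hQ ρ σ₁ σ₂ hσ c hc hc') =
      (rotate D Q Q₁ Q₂ hQ ρ σ₁ σ₂ hσ c hc hc').comp (parity D _ _) := by
    refine hom_ext (fun a => by simp) fun x => ?_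
    obtain ⟨v, w⟩ := x
    rw [AlgHom.comp_apply, AlgHom.comp_apply, parity_vec, map_neg, rotate_vec, map_add, map_mul,
      parity_vec, parity_vec, parity_incl, D.parity_of_mem (D.scalar_mem_grade c), sgn_zero,
      one_smul, mul_neg, neg_add]
  exact DFunLike.congr_fun this x

end DiracAlg

theorem conjPow_I (a : ZMod 2) : conjPow a Complex.I = sgn a • Complex.I := by
  rcases zmod2_cases a with rfl | rfl <;> simp [conjPow]

variable {V : Type v} [NormedAddCommGroup V] [InnerProductSpace ℝ V] (ρ : Representation ℝ G V)

/-- The isomorphism `A^{V ⊕ V'} ≃ A^{V ⊕ V''}` multiplying the vectors of `V'` by `i`. -/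
def sumEquivDiff : DiracAlg D (sumForm V) (sumRep D ρ) ≃ₐ[ℝ] DiracAlg D (diffForm V) (ρ.prod ρ) :=
  have h1 : ∀ w, normSqForm V w = -(-normSqForm V) w := fun w => by simp
  have h2 : ∀ w, (-normSqForm V) w = -normSqForm V w := fun w => by simp
  have h3 : ∀ g w, signTwist D.s ρ g w = sgn (D.sdeg g) • ρ g w := fun g w => rfl
  have h4 : ∀ g w, ρ g w = sgn (D.sdeg g) • signTwist D.s ρ g w := fun g w => by
    rw [h3, smul_smul, sgn_mul_self, one_smul]
  have h5 : -Complex.I * -Complex.I = -1 := by simp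
  have h6 : ∀ a, conjPow a (-Complex.I) = sgn a • -Complex.I := fun a => by
    rw [map_neg, conjPow_I, smul_neg]
  AlgEquiv.ofAlgHom
    (DiracAlg.rotate D _ _ _ h1 ρ _ _ h3 Complex.I Complex.I_mul_I conjPow_I)
    (DiracAlg.rotate D _ _ _ h2 ρ _ _ h4 (-Complex.I) h5 h6)
    (DiracAlg.rotate_rotate D _ _ _ _ _ _ _ _ _ _ _ _ _ _ _ _ (by simp))
    (DiracAlg.rotate_rotate D _ _ _ _ _ _ _ _ _ _ _ _ _ _ _ _ (by simp))

theorem sumEquivDiff_incl (a : D.Alg) :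
    sumEquivDiff D ρ (DiracAlg.incl D _ _ a) = DiracAlg.incl D _ _ a :=
  DiracAlg.rotate_incl ..

theorem sumEquivDiff_vec (v w : V) : sumEquivDiff D ρ (DiracAlg.vec D _ _ (v, w)) =
    DiracAlg.vec D _ _ (v, 0) + DiracAlg.incl D _ _ (D.scalar Complex.I) *
      DiracAlg.vec D _ _ (0, w) :=
  DiracAlg.rotate_vec ..

theorem mem_grade_iff_sumEquivDiff (c : ZMod 2) (x : DiracAlg D (sumForm V) (sumRep D ρ)) :
    x ∈ DiracAlg.grade D _ _ c ↔ sumEquivDiff D ρ x ∈ DiracAlg.grade D _ _ c := by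
  have : DiracAlg.parity D _ _ (sumEquivDiff D ρ x) =
    sumEquivDiff D ρ (DiracAlg.parity D _ _ x) := DiracAlg.parity_rotate ..
  rw [DiracAlg.mem_grade, DiracAlg.mem_grade, this, ← map_smul, (sumEquivDiff D ρ).injective.eq_iff]

end Rotation

/-! ### The isomorphism `A^{V ⊕ V''} ≃ Cl^{d,d} ⊗̂ A`. -/

section TensorIso

variable {G : Type u} [Group G] (D : SymmetryData G) {d : ℕ}
variable {V : Type v} [NormedAddCommGroup V] [InnerProductSpace ℝ V]
variable (b : OrthonormalBasis (Fin d) ℝ V)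
variable (ρ : Representation ℝ G V) (hρ : ∀ g v, ‖ρ g v‖ = ‖v‖)

/-- The map `g ↦ x_g ⊗ g`. -/
def spinTensor : D.Alg →ₐ[ℝ] (clddGrade d) ᵍ⊗[ℝ] D.grade :=
  AlgHom.ofLinearMap
    (D.lsum fun g => gtmk (clddGrade d) D.grade (spinElt b ρ hρ g) ∘ₗ D.lsingle g)
    (by
      rw [SymmetryData.one_def, D.lsum_single, LinearMap.comp_apply, spinElt_one]
      rfl)
    (fun x y => by
      induction x using D.induction with
      | h0 => rw [zero_mul, map_zero, zero_mul]
      | hadd x y hx hy => rw [add_mul, map_add, map_add, add_mul, hx, hy]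
      | hs a x =>
      induction y using D.induction with
      | h0 => rw [mul_zero, map_zero, mul_zero]
      | hadd x y hx hy => rw [mul_add, map_add, map_add, mul_add, hx, hy]
      | hs c y =>
      rw [D.single_mul_single, D.lsum_single, D.lsum_single, D.lsum_single]
      simp only [LinearMap.comp_apply, SymmetryData.lsingle_apply, gtmk_apply]
      -- The lift `x_c` is even, so it passes the first group element without a sign.
      rw [gtmul_mul_of_left_even _ _ _ _ (spinElt_mem b ρ hρ c), D.single_mul_single,
        spinElt_mul])

theorem spinTensor_single (g : G) (z : ℂ) :
    spinTensor D b ρ hρ (D.single g z) = spinElt b ρ hρ g ᵍ⊗ₜ[ℝ] D.single g z :=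
  D.lsum_single _ g z

theorem spinTensor_scalar (z : ℂ) :
    spinTensor D b ρ hρ (D.scalar z) = 1 ᵍ⊗ₜ[ℝ] D.scalar z := by
  rw [D.scalar_apply, spinTensor_single, spinElt_one]

theorem spinTensor_of (g : G) :
    spinTensor D b ρ hρ (D.of g) = spinElt b ρ hρ g ᵍ⊗ₜ[ℝ] D.of g :=
  spinTensor_single D b ρ hρ g 1

/-- The vectors of `V ⊕ V''` in `Cl^{d,d}`. -/
def vecC : V × V →ₗ[ℝ] ClDD d := (posC b).coprod (negC b)

theorem vecC_apply (x : V × V) : vecC b x = posC b x.1 + negC b x.2 := rfl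

theorem vecC_mem (x : V × V) : vecC b x ∈ clddGrade d 1 := add_mem (posC_mem b _) (negC_mem b _)

theorem vecC_mul_self (x : V × V) : vecC b x * vecC b x = algebraMap ℝ _ (diffForm V x) := by
  rw [vecC_apply, add_mul, mul_add, mul_add, posC_mul_self, negC_mul_self, negC_mul_posC,
    add_assoc, add_neg_cancel_left, ← map_add]
  simp [normSqForm_apply]

theorem spinElt_mul_vecC (g : G) (x : V × V) :
    spinElt b ρ hρ g * vecC b x = vecC b ((ρ.prod ρ) g x) * spinElt b ρ hρ g := by
  rw [vecC_apply, mul_add, spinElt_mul_posC, spinElt_mul_negC, ← add_mul]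
  rfl

/-- The homomorphism `A^{V ⊕ V''} → Cl^{d,d} ⊗̂ A`. -/
def toTensor : DiracAlg D (diffForm V) (ρ.prod ρ) →ₐ[ℝ] (clddGrade d) ᵍ⊗[ℝ] D.grade :=
  DiracAlg.lift (spinTensor D b ρ hρ) ((gtmk (clddGrade d) D.grade).flip 1 ∘ₗ vecC b)
    (fun x => by
      simp only [LinearMap.comp_apply, LinearMap.flip_apply, gtmk_apply]
      rw [gtmul_one_mul, vecC_mul_self]
      rfl)
    (fun z x => by
      simp only [LinearMap.comp_apply, LinearMap.flip_apply, gtmk_apply]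
      rw [spinTensor_scalar, gtmul_one_mul,
        gtmul_mul_of_right_even _ _ _ _ (D.scalar_mem_grade z)]
      simp)
    -- The sign `(-1)^{h(g)}` of the defining relation is the tensor product sign for moving `g`
    -- past an odd vector; the rotation `ρ(g)` comes from `x_g`.
    (fun g x => by
      simp only [LinearMap.comp_apply, LinearMap.flip_apply, gtmk_apply]
      rw [spinTensor_of, gtmul_one_mul, gtmul_mul_of_left_mem _ _ _ _ (vecC_mem b x),
        twist_of_mem D.grade (D.of_mem_grade g), one_mul, mul_one, spinElt_mul_vecC]
      rw [← gtmk_apply, map_smul, gtmk_apply])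

theorem toTensor_incl (a : D.Alg) :
    toTensor D b ρ hρ (DiracAlg.incl D _ _ a) = spinTensor D b ρ hρ a := DiracAlg.lift_incl ..

theorem toTensor_vec (x : V × V) :
    toTensor D b ρ hρ (DiracAlg.vec D _ _ x) = vecC b x ᵍ⊗ₜ[ℝ] 1 := DiracAlg.lift_vec ..

/-- The homomorphism `Cl^{d,d} → A^{V ⊕ V''}`. -/
def ofClDD : ClDD d →ₐ[ℝ] DiracAlg D (diffForm V) (ρ.prod ρ) :=
  clddLift b (DiracAlg.vec D _ _ ∘ₗ LinearMap.inl ℝ V V) (DiracAlg.vec D _ _ ∘ₗ LinearMap.inr ℝ V V)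
    (fun v => by
      simp only [LinearMap.comp_apply, DiracAlg.vec_mul_self]
      simp [normSqForm_apply])
    (fun v => by
      simp only [LinearMap.comp_apply, DiracAlg.vec_mul_self]
      simp [normSqForm_apply])
    (fun v w => by
      rw [eq_neg_iff_add_eq_zero]
      refine (DiracAlg.vec_mul_vec_add_swap ..).trans ?_
      simp [QuadraticMap.polar])

theorem ofClDD_posC (v : V) : ofClDD D b ρ (posC b v) = DiracAlg.vec D _ _ (v, 0) :=
  clddLift_posC ..

theorem ofClDD_negC (v : V) : ofClDD D b ρ (negC b v) = DiracAlg.vec D _ _ (0, v) :=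
  clddLift_negC ..

theorem ofClDD_vecC (x : V × V) : ofClDD D b ρ (vecC b x) = DiracAlg.vec D _ _ x := by
  rw [vecC_apply, map_add, ofClDD_posC, ofClDD_negC, ← map_add]
  simp

theorem single_mul_vec (g : G) (z : ℂ) (x : V × V) :
    DiracAlg.incl D (diffForm V) (ρ.prod ρ) (D.single g z) * DiracAlg.vec D _ _ x =
      sgn (D.hdeg g) • (DiracAlg.vec D _ _ ((ρ.prod ρ) g x) *
        DiracAlg.incl D _ _ (D.single g z)) := by
  rw [D.single_eq, map_mul, mul_assoc, DiracAlg.of_mul_vec, mul_smul_comm, ← mul_assoc,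
    DiracAlg.scalar_mul_vec, mul_assoc]

/-- Conjugation by `g` and conjugation by `x_g` combined with `parity^{h(g)}` agree on vectors, and
both are multiplicative. This extends the defining relation from vectors to all of `Cl^{d,d}`. -/
theorem single_mul_ofClDD (g : G) (z : ℂ) (c : ClDD d) :
    DiracAlg.incl D (diffForm V) (ρ.prod ρ) (D.single g z) * ofClDD D b ρ c =
      ofClDD D b ρ (spinElt b ρ hρ g * twist (clddGrade d) (D.hdeg g) c * spinElt b ρ hρ g⁻¹) *
        DiracAlg.incl D _ _ (D.single g z) := by
  have hv : ∀ x : V × V, DiracAlg.incl D (diffForm V) (ρ.prod ρ) (D.single g z) *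
      ofClDD D b ρ (vecC b x) =
      ofClDD D b ρ (spinElt b ρ hρ g * twist (clddGrade d) (D.hdeg g) (vecC b x) *
        spinElt b ρ hρ g⁻¹) * DiracAlg.incl D _ _ (D.single g z) := by
    intro x
    rw [ofClDD_vecC, single_mul_vec, twist_of_mem _ (vecC_mem b x), mul_one, mul_smul_comm,
      smul_mul_assoc, map_smul, smul_mul_assoc, spinElt_mul_vecC, mul_assoc (vecC b _),
      spinElt_mul_inv, mul_one, ofClDD_vecC]
  induction c using cldd_induction b with
  | hr r =>
    simp only [AlgHom.commutes]
    rw [← Algebra.commutes r (spinElt b ρ hρ g), mul_assoc, spinElt_mul_inv, mul_one,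
      AlgHom.commutes, Algebra.commutes]
  | hpos v => simpa [vecC_apply] using hv (v, 0)
  | hneg v => simpa [vecC_apply] using hv (0, v)
  | hadd x y hx hy => simp only [map_add, mul_add, add_mul, hx, hy]
  | hmul x y hx hy =>
    rw [map_mul, ← mul_assoc, hx, mul_assoc, hy, ← mul_assoc, ← map_mul, map_mul (twist _ _)]
    congr 2
    simp only [mul_assoc]
    rw [← mul_assoc (spinElt b ρ hρ g⁻¹) (spinElt b ρ hρ g), spinElt_inv_mul, one_mul]

/-- A linear inverse of `toTensor`. -/
def ofTensor : (clddGrade d) ᵍ⊗[ℝ] D.grade →ₗ[ℝ] DiracAlg D (diffForm V) (ρ.prod ρ) :=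
  TensorProduct.lift (LinearMap.flip (D.lsum fun g =>
    ((LinearMap.mul ℝ (DiracAlg D (diffForm V) (ρ.prod ρ))).compl₁₂
      ((ofClDD D b ρ).toLinearMap ∘ₗ LinearMap.mulRight ℝ (spinElt b ρ hρ g⁻¹))
      ((DiracAlg.incl D (diffForm V) (ρ.prod ρ)).toLinearMap ∘ₗ D.lsingle g)).flip)) ∘ₗ
    (GradedTensorProduct.of ℝ (clddGrade d) D.grade).symm.toLinearMap

theorem ofTensor_tmul (c : ClDD d) (g : G) (z : ℂ) :
    ofTensor D b ρ hρ (c ᵍ⊗ₜ[ℝ] D.single g z) =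
      ofClDD D b ρ (c * spinElt b ρ hρ g⁻¹) * DiracAlg.incl D _ _ (D.single g z) := by
  refine (TensorProduct.lift.tmul ..).trans ?_
  rw [LinearMap.flip_apply, D.lsum_single]
  rfl

theorem twist_spinElt (i : ZMod 2) (g : G) :
    twist (clddGrade d) i (spinElt b ρ hρ g) = spinElt b ρ hρ g := by
  rw [twist_of_mem _ (spinElt_mem b ρ hρ g), mul_zero, sgn_zero, one_smul]

/-- On pure tensors the claim is that, with `c'` the `h(g)`-twist of `c`, the element `x_g c' x_h⁻¹
x_g⁻¹ · g h` equals `g · c x_h⁻¹ · h`, which is the commutation rule `single_mul_ofClDD`. -/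
theorem ofTensor_spinTensor_mul (a : D.Alg) (t : (clddGrade d) ᵍ⊗[ℝ] D.grade) :
    ofTensor D b ρ hρ (spinTensor D b ρ hρ a * t) =
      DiracAlg.incl D _ _ a * ofTensor D b ρ hρ t := by
  induction a using D.induction with
  | h0 => simp
  | hadd x y hx hy => rw [map_add, add_mul, map_add, hx, hy, map_add, add_mul]
  | hs g z =>
  induction t using gtensor_induction with
  | h0 => simp
  | hadd x y hx hy => rw [mul_add, map_add, hx, hy, map_add, mul_add]
  | ht c y =>
  induction y using D.induction with
  | h0 => rw [← gtmk_apply, map_zero, mul_zero, map_zero, mul_zero]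
  | hadd x y hx hy =>
    rw [← gtmk_apply] at hx hy ⊢
    rw [map_add, mul_add, map_add, map_add, mul_add, hx, hy]
  | hs h w =>
    rw [spinTensor_single, gtmul_mul_of_right_mem _ _ _ _ (D.single_mem_grade rfl z),
      D.single_mul_single, ofTensor_tmul, ofTensor_tmul, ← mul_assoc, single_mul_ofClDD D b ρ hρ,
      map_mul (twist _ _), twist_spinElt, mul_assoc (ofClDD D b ρ _) (DiracAlg.incl D _ _ _),
      ← map_mul (DiracAlg.incl D _ _), D.single_mul_single, mul_inv_rev, spinElt_mul]
    simp only [mul_assoc]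

/-- Compatibility with left multiplication replaces multiplicativity of `ofTensor`: taking `t = 1`
already shows that it is a left inverse of `toTensor`. It passes from generators `x` to products
because `t` is arbitrary. -/
theorem ofTensor_toTensor_mul (x : DiracAlg D (diffForm V) (ρ.prod ρ))
    (t : (clddGrade d) ᵍ⊗[ℝ] D.grade) :
    ofTensor D b ρ hρ (toTensor D b ρ hρ x * t) = x * ofTensor D b ρ hρ t := by
  induction x using DiracAlg.induction generalizing t with
  | hincl a => rw [toTensor_incl, ofTensor_spinTensor_mul]
  | hvec v =>
    rw [toTensor_vec]
    induction t using gtensor_induction with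
    | h0 => simp
    | hadd x y hx hy => rw [mul_add, map_add, hx, hy, map_add, mul_add]
    | ht c y =>
    induction y using D.induction with
    | h0 => rw [← gtmk_apply, ← gtmk_apply, map_zero, mul_zero, map_zero, mul_zero]
    | hadd x y hx hy =>
      rw [gtmul_one_mul, ← gtmk_apply, map_add, map_add, gtmk_apply, gtmk_apply, ← gtmul_one_mul,
        ← gtmul_one_mul, hx, hy, ← mul_add, ← map_add, ← gtmk_apply, ← gtmk_apply, ← map_add]
      rfl
    | hs h w =>
      rw [gtmul_one_mul, ofTensor_tmul, ofTensor_tmul, mul_assoc (vecC b v), map_mul,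
        ofClDD_vecC, mul_assoc]
  | hadd x y hx hy => rw [map_add, add_mul, map_add, hx, hy, add_mul]
  | hmul x y hx hy => rw [map_mul (toTensor D b ρ hρ), mul_assoc, hx, hy, mul_assoc]

theorem toTensor_injective : Function.Injective (toTensor D b ρ hρ) := by
  refine Function.LeftInverse.injective (g := ofTensor D b ρ hρ) fun x => ?_
  have h := ofTensor_toTensor_mul D b ρ hρ x 1
  have h1 : ofTensor D b ρ hρ 1 = 1 := by
    change ofTensor D b ρ hρ (1 ᵍ⊗ₜ[ℝ] D.single 1 _) = 1
    rw [ofTensor_tmul, inv_one, spinElt_one, mul_one, ← D.one_def, map_one, map_one, mul_one]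
  rwa [mul_one, h1, mul_one] at h

/-- The range contains `Cl^{d,d} ⊗ 1`, generated by the images of vectors, and therefore also
`(x_g⁻¹ ⊗ 1)(x_g ⊗ g) = 1 ⊗ g`. -/
theorem toTensor_surjective : Function.Surjective (toTensor D b ρ hρ) := by
  have hC : ∀ c : ClDD d, c ᵍ⊗ₜ[ℝ] (1 : D.Alg) ∈ (toTensor D b ρ hρ).range := by
    have hv : ∀ x : V × V, vecC b x ᵍ⊗ₜ[ℝ] (1 : D.Alg) ∈ (toTensor D b ρ hρ).range :=
      fun x => ⟨_, toTensor_vec D b ρ hρ x⟩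
    intro c
    induction c using cldd_induction b with
    | hr r => exact (toTensor D b ρ hρ).range.algebraMap_mem r
    | hpos v => simpa [vecC_apply] using hv (v, 0)
    | hneg v => simpa [vecC_apply] using hv (0, v)
    | hadd x y hx hy =>
      rw [← gtmk_apply, map_add, LinearMap.add_apply]
      exact add_mem hx hy
    | hmul x y hx hy => rw [← gtmul_one_mul]; exact mul_mem hx hy
  have hA : ∀ a : D.Alg, (1 : ClDD d) ᵍ⊗ₜ[ℝ] a ∈ (toTensor D b ρ hρ).range := by
    intro a
    induction a using D.induction with
    | h0 => rw [← gtmk_apply, map_zero]; exact zero_mem _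
    | hadd x y hx hy => rw [← gtmk_apply, map_add]; exact add_mem hx hy
    | hs g z =>
      rw [← spinElt_inv_mul b ρ hρ g, ← gtmul_one_mul]
      refine mul_mem (hC _) ⟨DiracAlg.incl D _ _ (D.single g z), ?_⟩
      exact (toTensor_incl D b ρ hρ _).trans (spinTensor_single D b ρ hρ g z)
  intro t
  change t ∈ (toTensor D b ρ hρ).range
  induction t using gtensor_induction with
  | h0 => exact zero_mem _
  | hadd x y hx hy => exact add_mem hx hy
  | ht c a =>
    have := mul_mem (hC c) (hA a)
    rwa [gtmul_one_mul, mul_one] at this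

/-- The isomorphism `A^{V ⊕ V''} ≃ Cl^{d,d} ⊗̂ A`. -/
def tensorEquiv : DiracAlg D (diffForm V) (ρ.prod ρ) ≃ₐ[ℝ] (clddGrade d) ᵍ⊗[ℝ] D.grade :=
  AlgEquiv.ofBijective (toTensor D b ρ hρ)
    ⟨toTensor_injective D b ρ hρ, toTensor_surjective D b ρ hρ⟩

theorem tensorEquiv_apply (x : DiracAlg D (diffForm V) (ρ.prod ρ)) :
    tensorEquiv D b ρ hρ x = toTensor D b ρ hρ x := rfl

theorem parityHom_toTensor (x : DiracAlg D (diffForm V) (ρ.prod ρ)) :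
    parityHom (tensorGrade (clddGrade d) D.grade) (toTensor D b ρ hρ x) =
      toTensor D b ρ hρ (DiracAlg.parity D _ _ x) := by
  have : (parityHom (tensorGrade (clddGrade d) D.grade)).comp (toTensor D b ρ hρ) =
      (toTensor D b ρ hρ).comp (DiracAlg.parity D _ _) := by
    refine DiracAlg.hom_ext (fun a => ?_) fun x => ?_
    · rw [AlgHom.comp_apply, AlgHom.comp_apply, DiracAlg.parity_incl, toTensor_incl, toTensor_incl]
      induction a using D.induction with
      | h0 => simp
      | hadd x y hx hy => simp only [map_add, hx, hy]
      | hs g z =>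
        rw [spinTensor_single, parityHom_gtmul, parityHom_spinElt,
          parityHom_of_mem _ (D.single_mem_grade rfl z), D.parity_single, map_smul,
          spinTensor_single, ← gtmk_apply, map_smul, gtmk_apply]
    · rw [AlgHom.comp_apply, AlgHom.comp_apply, DiracAlg.parity_vec, map_neg, toTensor_vec,
        parityHom_gtmul, map_one, parityHom_of_mem _ (vecC_mem b x), sgn_one, neg_one_smul,
        ← gtmk_apply, map_neg, LinearMap.neg_apply, gtmk_apply]
  exact DFunLike.congr_fun this x

theorem mem_grade_iff_tensorEquiv (c : ZMod 2) (x : DiracAlg D (diffForm V) (ρ.prod ρ)) :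
    x ∈ DiracAlg.grade D _ _ c ↔
      tensorEquiv D b ρ hρ x ∈ tensorGrade (clddGrade d) D.grade c := by
  rw [DiracAlg.mem_grade, mem_iff_parityHom, tensorEquiv_apply, parityHom_toTensor, ← map_smul,
    (toTensor_injective D b ρ hρ).eq_iff]

end TensorIso

/-! ### Full corners and universes -/

section Glue

variable {R : Type u} [Ring R] [Algebra ℝ R] {U : Type v} [AddCommGroup U]
  [Module ℝ U] [Module R U] [IsScalarTower ℝ R U] (𝒮 : UniverseDecomposition R U)

namespace UniverseDecomposition

theorem induction {p : U → Prop} (u : U) (h0 : p 0) (hadd : ∀ x y, p x → p y → p (x + y))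
    (hs : ∀ k, ∀ u ∈ 𝒮.summand k, p u) : p u := by
  have hu : u ∈ ⨆ k, 𝒮.summand k := 𝒮.internal.submodule_iSup_eq_top ▸ Submodule.mem_top
  exact Submodule.iSup_induction _ (motive := p) hu hs h0 hadd

variable {M : Type*} [AddCommGroup M] [Module ℝ M]

theorem hom_ext {f g : U →ₗ[ℝ] M} (h : ∀ k, ∀ u ∈ 𝒮.summand k, f u = g u) : f = g := by
  ext u
  induction u using 𝒮.induction with
  | h0 => simp
  | hadd x y hx hy => rw [map_add, map_add, hx, hy]
  | hs k u hu => exact h k u hu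

theorem exists_glue (f : ∀ k, 𝒮.summand k →ₗ[ℝ] M) :
    ∃ F : U →ₗ[ℝ] M, ∀ k u (hu : u ∈ 𝒮.summand k), F u = f k ⟨u, hu⟩ := by
  let T : ℕ → Submodule ℝ U := fun k => (𝒮.summand k).restrictScalars ℝ
  have hT : DirectSum.IsInternal T := 𝒮.internal
  let e := LinearEquiv.ofBijective (DirectSum.coeLinearMap T) hT
  let f' : ∀ k, T k →ₗ[ℝ] M := f
  refine ⟨DirectSum.toModule ℝ ℕ M f' ∘ₗ e.symm.toLinearMap, fun k u hu => ?_⟩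
  have : e.symm u = DirectSum.lof ℝ ℕ (fun k => T k) k ⟨u, hu⟩ := by
    rw [LinearEquiv.symm_apply_eq]
    exact (DirectSum.coeLinearMap_lof T k ⟨u, hu⟩).symm
  rw [LinearMap.comp_apply, LinearEquiv.coe_coe, this, DirectSum.toModule_lof]
  rfl

end UniverseDecomposition

end Glue

/-- Two sequences with the same values, all of them taken infinitely often, are equal up to a
permutation of the indices. -/
theorem exists_perm_of_infinite_fibers {T : Type*} (f g : ℕ → T)
    (hf : ∀ n, {m | f m = f n}.Infinite) (hg : ∀ n, {m | g m = g n}.Infinite)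
    (hfg : ∀ n, ∃ m, g m = f n) (hgf : ∀ n, ∃ m, f m = g n) :
    ∃ σ : ℕ ≃ ℕ, ∀ n, g (σ n) = f n := by
  -- Over a common value both fibres are infinite subsets of `ℕ`, hence equinumerous; over any other
  -- value both are empty.
  have : ∀ t, Nonempty ({n // f n = t} ≃ {n // g n = t}) := by
    intro t
    by_cases h : ∃ n, f n = t
    · obtain ⟨n, rfl⟩ := h
      obtain ⟨m, hm⟩ := hfg n
      have h1 : Infinite {k // f k = f n} := (hf n).to_subtype
      have h2 : Infinite {k // g k = f n} := by
        rw [← hm]; exact (hg m).to_subtype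
      obtain ⟨_⟩ := nonempty_denumerable {k // f k = f n}
      obtain ⟨_⟩ := nonempty_denumerable {k // g k = f n}
      exact ⟨Denumerable.equiv₂ _ _⟩
    · have h' : ¬∃ n, g n = t := by
        rintro ⟨n, rfl⟩
        exact h (hgf n)
      have : IsEmpty {n // f n = t} := ⟨fun x => h ⟨x.1, x.2⟩⟩
      have : IsEmpty {n // g n = t} := ⟨fun x => h' ⟨x.1, x.2⟩⟩
      exact ⟨Equiv.equivOfIsEmpty _ _⟩
  exact ⟨Equiv.ofFiberEquiv fun t => (this t).some, fun n => Equiv.ofFiberEquiv_map _ n⟩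

/-- A full idempotent `p` of `R₁` with a homomorphism `R₀ → R₁` inducing `R₀ ≃ p R₁ p`. -/
structure FullCorner (R₀ : Type u) (R₁ : Type v) [Ring R₀] [Ring R₁] [Algebra ℝ R₀]
    [Algebra ℝ R₁] where
  /-- the homomorphism -/
  θ : R₀ →ₐ[ℝ] R₁
  /-- the idempotent -/
  p : R₁
  /-- the index set of the partition of unity -/
  ι : Type
  [fintype : Fintype ι]
  /-- the left factors -/
  a : ι → R₁
  /-- the right factors -/
  c : ι → R₁
  sum : ∑ i, a i * p * c i = 1
  idem : p * p = p
  comm : ∀ r, p * θ r = θ r * p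
  corner : ∀ r, ∃ s, p * r * p = θ s * p
  inj : ∀ s, θ s * p = 0 → s = 0

attribute [instance] FullCorner.fintype

namespace FullCorner

variable {R₀ : Type u} {R₁ : Type v} [Ring R₀] [Ring R₁] [Algebra ℝ R₀] [Algebra ℝ R₁]
  (K : FullCorner R₀ R₁)

section Fix

variable (Y : Type w) [AddCommGroup Y] [Module R₁ Y]

/-- The part of a module fixed by the idempotent. -/
def Fix : AddSubgroup Y where
  carrier := {y | K.p • y = y}
  add_mem' {x y} hx hy := by
    rw [Set.mem_ofPred_eq] at *
    rw [smul_add, hx, hy]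
  zero_mem' := smul_zero _
  neg_mem' {x} hx := by
    rw [Set.mem_ofPred_eq] at *
    rw [smul_neg, hx]

variable {Y} in
theorem mem_fix {y : Y} : y ∈ K.Fix Y ↔ K.p • y = y := Iff.rfl

variable {Y} in
theorem p_smul_mem (y : Y) : K.p • y ∈ K.Fix Y := by
  rw [mem_fix, ← mul_smul, K.idem]

variable {Y} in
theorem θ_smul_mem (r : R₀) {y : Y} (hy : y ∈ K.Fix Y) : K.θ r • y ∈ K.Fix Y := by
  rw [mem_fix] at *
  rw [← mul_smul, K.comm, mul_smul, hy]

instance : Module R₀ (K.Fix Y) where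
  smul r y := ⟨K.θ r • (y : Y), K.θ_smul_mem r y.2⟩
  one_smul y := Subtype.ext (by change K.θ 1 • (y : Y) = y; rw [map_one, one_smul])
  mul_smul r s y := Subtype.ext (by
    change K.θ (r * s) • (y : Y) = K.θ r • K.θ s • (y : Y); rw [map_mul, mul_smul])
  smul_zero r := Subtype.ext (smul_zero (K.θ r))
  smul_add r x y := Subtype.ext (smul_add (K.θ r) (x : Y) (y : Y))
  add_smul r s y := Subtype.ext (by
    change K.θ (r + s) • (y : Y) = K.θ r • (y : Y) + K.θ s • (y : Y); rw [map_add, add_smul])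
  zero_smul y := Subtype.ext (by change K.θ 0 • (y : Y) = 0; rw [map_zero, zero_smul])

variable {Y} in
theorem coe_smul (r : R₀) (y : K.Fix Y) : ((r • y : K.Fix Y) : Y) = K.θ r • (y : Y) := rfl

variable {Y} in
-- Fullness of `p` enters here: `y = ∑ aᵢ p cᵢ y`.
theorem eq_zero_of_p_smul {y : Y} (h : ∀ r : R₁, K.p • r • y = 0) : y = 0 := by
  rw [← one_smul R₁ y, ← K.sum, Finset.sum_smul]
  exact Finset.sum_eq_zero fun i _ => by rw [mul_smul, mul_smul, h, smul_zero]

/-- Fullness makes the fixed part nonzero. If `r x = y` with `x`, `y` fixed by `p`, then `p r p`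
also carries `x` to `y`, and `p r p` acts as an element of `R₀`. -/
theorem isSimpleModule_fix [IsSimpleModule R₁ Y] : IsSimpleModule R₀ (K.Fix Y) := by
  rw [isSimpleModule_iff_toSpanSingleton_surjective]
  constructor
  · have := IsSimpleModule.nontrivial R₁ Y
    obtain ⟨y, hy⟩ := exists_ne (0 : Y)
    by_contra hn
    rw [not_nontrivial_iff_subsingleton] at hn
    refine hy (K.eq_zero_of_p_smul fun r => ?_)
    exact congrArg Subtype.val (Subsingleton.elim (⟨_, K.p_smul_mem (r • y)⟩ : K.Fix Y) 0)
  · intro x hx y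
    have hx' : (x : Y) ≠ 0 := fun h => hx (Subtype.ext h)
    obtain ⟨r, hr⟩ := IsSimpleModule.toSpanSingleton_surjective R₁ hx' (y : Y)
    obtain ⟨s, hs⟩ := K.corner r
    refine ⟨s, Subtype.ext ?_⟩
    rw [LinearMap.toSpanSingleton_apply] at hr ⊢
    rw [coe_smul]
    have hx2 := K.mem_fix.mp x.2
    rw [← hx2, ← mul_smul, ← hs, mul_smul, hx2, mul_smul, hr]
    exact y.2

variable {Y} in
/-- Isomorphic modules have isomorphic parts fixed by the idempotent. -/
def fixCongr {Z : Type*} [AddCommGroup Z] [Module R₁ Z] (e : Y ≃ₗ[R₁] Z) :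
    K.Fix Y ≃ₗ[R₀] K.Fix Z where
  toFun y := ⟨e y, by rw [mem_fix, ← map_smul, K.mem_fix.mp y.2]⟩
  invFun z := ⟨e.symm z, by rw [mem_fix, ← map_smul, K.mem_fix.mp z.2]⟩
  left_inv y := by simp
  right_inv z := by simp
  map_add' x y := by ext; simp
  map_smul' r x := by ext; simp [coe_smul]

end Fix

/-- The left ideal of `R₁` induced by a left ideal of `R₀`. -/
def induced (I : Submodule R₀ R₀) : Submodule R₁ R₁ where
  carrier := {r | ∀ t, ∃ s ∈ I, K.p * t * r * K.p = K.θ s * K.p}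
  add_mem' {x y} hx hy t := by
    obtain ⟨s, hs, h⟩ := hx t
    obtain ⟨s', hs', h'⟩ := hy t
    exact ⟨s + s', add_mem hs hs', by rw [mul_add, add_mul, h, h', map_add, add_mul]⟩
  zero_mem' t := ⟨0, zero_mem _, by simp⟩
  smul_mem' r x hx t := by
    obtain ⟨s, hs, h⟩ := hx (t * r)
    exact ⟨s, hs, by rw [smul_eq_mul, ← h]; simp only [mul_assoc]⟩

theorem mem_induced {I : Submodule R₀ R₀} {r : R₁} :
    r ∈ K.induced I ↔ ∀ t, ∃ s ∈ I, K.p * t * r * K.p = K.θ s * K.p := Iff.rfl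

theorem one_sub_p_mem_induced (I : Submodule R₀ R₀) (r : R₁) :
    r * (1 - K.p) ∈ K.induced I := by
  refine Submodule.smul_mem _ r fun t => ⟨0, zero_mem _, ?_⟩
  rw [map_zero, zero_mul, mul_assoc, sub_mul, K.idem, one_mul, sub_self, mul_zero]

/-- Inducing and then compressing to the corner returns `I`: the test element `t = 1` together with
injectivity of `s ↦ θ(s) p` recovers `s`, and conversely each `p t p` acts through `R₀`, which
preserves `I`. -/
theorem θ_mul_p_mem_induced {I : Submodule R₀ R₀} {s : R₀} :
    K.θ s * K.p ∈ K.induced I ↔ s ∈ I := by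
  rw [mem_induced]
  constructor
  · intro h
    obtain ⟨s', hs', h⟩ := h 1
    rw [mul_one, ← mul_assoc, K.comm, mul_assoc, mul_assoc, K.idem, K.idem] at h
    have : s - s' = 0 := K.inj _ (by rw [map_sub, sub_mul, h, sub_self])
    rwa [sub_eq_zero.mp this]
  · intro hs t
    obtain ⟨t', ht⟩ := K.corner t
    refine ⟨t' * s, I.smul_mem t' hs, ?_⟩
    have e : K.p * t * (K.θ s * K.p) * K.p = K.p * t * K.p * K.θ s := by
      rw [mul_assoc (K.p * t), mul_assoc (K.θ s), K.idem, ← K.comm]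
      simp only [mul_assoc]
    rw [e, ht, mul_assoc, K.comm, map_mul, mul_assoc]

/-- A strictly larger left ideal `L` contains an `r` having a compression `θ(s) p` with `s ∉ I`.
Maximality of `I` gives `1 = x + s' s` with `x ∈ I`, so `p ∈ L`; since `1 - p` lies in the induced
ideal, `1 ∈ L`. -/
theorem isSimpleModule_induced (I : Submodule R₀ R₀) [hI : IsSimpleModule R₀ (R₀ ⧸ I)] :
    IsSimpleModule R₁ (R₁ ⧸ K.induced I) := by
  rw [isSimpleModule_iff_isCoatom] at hI ⊢
  constructor
  · intro h
    apply hI.1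
    rw [Submodule.eq_top_iff'] at h ⊢
    exact fun s => K.θ_mul_p_mem_induced.mp (h _)
  · intro L hL
    obtain ⟨r, hr, hr'⟩ := SetLike.exists_of_lt hL
    rw [mem_induced] at hr'
    push Not at hr'
    obtain ⟨t, ht⟩ := hr'
    obtain ⟨s, hs⟩ := K.corner (t * r)
    have hsI : s ∉ I := fun h => ht s h (by rw [← hs]; simp only [mul_assoc])
    have htop : I ⊔ Submodule.span R₀ {s} = ⊤ := by
      refine hI.2 _ (lt_of_le_of_ne le_sup_left fun h => hsI ?_)
      rw [h]
      exact Submodule.mem_sup_right (Submodule.mem_span_singleton_self s)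
    have h1 : (1 : R₀) ∈ I ⊔ Submodule.span R₀ {s} := htop ▸ Submodule.mem_top
    obtain ⟨x, hx, y, hy, hxy⟩ := Submodule.mem_sup.mp h1
    obtain ⟨s', rfl⟩ := Submodule.mem_span_singleton.mp hy
    have hp1 : K.θ x * K.p ∈ L := hL.le (K.θ_mul_p_mem_induced.mpr hx)
    have hp2 : K.θ s' * (K.p * (t * r) * K.p) ∈ L := by
      have e : K.θ s' * (K.p * (t * r) * K.p) =
          (K.θ s' * K.p * t) * r - (K.θ s' * K.p * (t * r)) * (1 - K.p) := by
        rw [mul_sub, mul_one]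
        simp only [mul_assoc, sub_sub_cancel]
      rw [e]
      exact sub_mem (L.smul_mem _ hr) (hL.le (K.one_sub_p_mem_induced I _))
    have hp : K.p ∈ L := by
      have := add_mem hp1 hp2
      rwa [hs, ← mul_assoc, ← map_mul, ← add_mul, ← map_add, ← smul_eq_mul s' s, hxy, map_one,
        one_mul] at this
    have := add_mem hp (hL.le (K.one_sub_p_mem_induced I 1))
    rw [one_mul, add_sub_cancel] at this
    exact (Ideal.eq_top_iff_one L).mpr this

/-- The map sending `s` to the class of `θ(s) p` has kernel `I` and reaches every class fixed by
`p`. So each irreducible `R₀`-module is the fixed part of an irreducible `R₁`-module, and occurs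
infinitely often among fixed parts of summands. -/
theorem nonempty_fix_induced_equiv (I : Submodule R₀ R₀) :
    Nonempty (K.Fix (R₁ ⧸ K.induced I) ≃ₗ[R₀] R₀ ⧸ I) := by
  have hp : ∀ x : R₁ ⧸ K.induced I, ∀ r, Submodule.Quotient.mk r = x →
      x = Submodule.Quotient.mk (r * K.p) := by
    rintro _ r rfl
    rw [Submodule.Quotient.eq]
    simpa [mul_sub] using K.one_sub_p_mem_induced I r
  let f : R₀ →ₗ[R₀] K.Fix (R₁ ⧸ K.induced I) :=
    LinearMap.toSpanSingleton R₀ _ ⟨_, K.p_smul_mem (Submodule.Quotient.mk 1)⟩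
  have hf : ∀ s, (f s : R₁ ⧸ K.induced I) = Submodule.Quotient.mk (K.θ s * K.p) := fun s => by
    rw [LinearMap.toSpanSingleton_apply, coe_smul, ← mul_smul, ← Submodule.Quotient.mk_smul,
      smul_eq_mul, mul_one]
  have hker : LinearMap.ker f = I := by
    ext s
    rw [LinearMap.mem_ker, ← K.θ_mul_p_mem_induced, ← Submodule.Quotient.mk_eq_zero, ← hf]
    exact Subtype.ext_iff
  have hsurj : Function.Surjective f := by
    intro x
    obtain ⟨r, hr⟩ := Submodule.Quotient.mk_surjective _ (x : R₁ ⧸ K.induced I)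
    obtain ⟨s, hs⟩ := K.corner r
    refine ⟨s, Subtype.ext ?_⟩
    rw [hf, ← hs, mul_assoc, ← smul_eq_mul, Submodule.Quotient.mk_smul, ← hp _ r hr]
    exact x.2
  exact ⟨((Submodule.quotEquivOfEq _ _ hker.symm).trans (f.quotKerEquivOfSurjective hsurj)).symm⟩

section Linear

variable {Y : Type*} [AddCommGroup Y] [Module ℝ Y] [Module R₁ Y] [IsScalarTower ℝ R₁ Y]
  {Z : Type*} [AddCommGroup Z] [Module ℝ Z] [Module R₀ Z] [IsScalarTower ℝ R₀ Z]

/-- A linear map on the part fixed by the idempotent, extended to the whole module. -/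
def toLin (f : K.Fix Y →ₗ[R₀] Z) : Y →ₗ[ℝ] Z where
  toFun y := f ⟨_, K.p_smul_mem y⟩
  map_add' x y := by
    rw [← map_add]; congr 1; exact Subtype.ext (smul_add _ _ _)
  map_smul' r x := by
    rw [RingHom.id_apply, ← algebraMap_smul R₀ r (f _), ← map_smul]
    congr 1
    refine Subtype.ext ?_
    rw [coe_smul, AlgHom.commutes]
    change K.p • r • x = algebraMap ℝ R₁ r • K.p • x
    rw [← algebraMap_smul R₁ r x, ← mul_smul, ← mul_smul, Algebra.commutes]

/-- A linear map into the part fixed by the idempotent, as a real linear map. -/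
def ofLin (f : Z →ₗ[R₀] K.Fix Y) : Z →ₗ[ℝ] Y where
  toFun z := f z
  map_add' x y := by rw [map_add]; rfl
  map_smul' r x := by
    rw [RingHom.id_apply, ← algebraMap_smul R₀ r x, map_smul, coe_smul, AlgHom.commutes,
      algebraMap_smul]

end Linear

section Match

variable {U₁ : Type*} [AddCommGroup U₁] [Module ℝ U₁] [Module R₁ U₁] [IsScalarTower ℝ R₁ U₁]
  (𝒮₁ : UniverseDecomposition R₁ U₁)
  {U₀ : Type*} [AddCommGroup U₀] [Module ℝ U₀] [Module R₀ U₀] [IsScalarTower ℝ R₀ U₀]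
  (𝒮₀ : UniverseDecomposition R₀ U₀)

/-- The fixed parts of the summands of `𝒮₁` are irreducible over `R₀`, and every irreducible
`R₀`-module occurs infinitely often both among them and in `𝒮₀`; two such sequences differ by a
permutation. -/
theorem exists_perm : ∃ σ : ℕ ≃ ℕ,
    ∀ k, Nonempty (K.Fix (𝒮₁.summand k) ≃ₗ[R₀] 𝒮₀.summand (σ k)) := by
  have hq : ∀ k, ∃ I : Submodule R₀ R₀, IsSimpleModule R₀ (R₀ ⧸ I) ∧
      Nonempty (K.Fix (𝒮₁.summand k) ≃ₗ[R₀] R₀ ⧸ I) := by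
    intro k
    have := 𝒮₁.simple k
    have hs := K.isSimpleModule_fix (𝒮₁.summand k)
    obtain ⟨I, hI, ⟨e⟩⟩ := isSimpleModule_iff_quot_maximal.mp hs
    exact ⟨I, IsSimpleModule.congr e.symm, ⟨e⟩⟩
  have hq0 : ∀ l, ∃ I : Submodule R₀ R₀, IsSimpleModule R₀ (R₀ ⧸ I) ∧
      Nonempty (𝒮₀.summand l ≃ₗ[R₀] R₀ ⧸ I) := by
    intro l
    have hs := 𝒮₀.simple l
    obtain ⟨I, hI, ⟨e⟩⟩ := isSimpleModule_iff_quot_maximal.mp hs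
    exact ⟨I, IsSimpleModule.congr e.symm, ⟨e⟩⟩
  -- An isomorphism class is encoded by the set of indices at which it occurs in `𝒮₀`, so that
  -- isomorphism becomes equality of values of `f` and `g`.
  let g : ℕ → Set ℕ := fun l => {l' | Nonempty (𝒮₀.summand l ≃ₗ[R₀] 𝒮₀.summand l')}
  let f : ℕ → Set ℕ := fun k => {l' | Nonempty (K.Fix (𝒮₁.summand k) ≃ₗ[R₀] 𝒮₀.summand l')}
  have hfg : ∀ k l, f k = g l ↔ Nonempty (K.Fix (𝒮₁.summand k) ≃ₗ[R₀] 𝒮₀.summand l) := by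
    intro k l
    constructor
    · intro h
      have : l ∈ g l := ⟨LinearEquiv.refl _ _⟩
      rw [← h] at this
      exact this
    · rintro ⟨e⟩
      ext l'
      exact ⟨fun ⟨e'⟩ => ⟨e.symm.trans e'⟩, fun ⟨e'⟩ => ⟨e.trans e'⟩⟩
  have hgg : ∀ l l', Nonempty (𝒮₀.summand l ≃ₗ[R₀] 𝒮₀.summand l') → g l = g l' := by
    rintro l l' ⟨e⟩
    ext m
    exact ⟨fun ⟨e'⟩ => ⟨e.symm.trans e'⟩, fun ⟨e'⟩ => ⟨e.trans e'⟩⟩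
  have h1 : ∀ k, ∃ l, g l = f k := by
    intro k
    obtain ⟨I, hI, ⟨e⟩⟩ := hq k
    obtain ⟨l, ⟨e'⟩⟩ := (𝒮₀.infinite I hI).nonempty
    exact ⟨l, ((hfg k l).mpr ⟨e.trans e'.symm⟩).symm⟩
  have h2 : ∀ l, {k | f k = g l}.Infinite := by
    intro l
    obtain ⟨I, hI, ⟨e⟩⟩ := hq0 l
    obtain ⟨e'⟩ := K.nonempty_fix_induced_equiv I
    refine (𝒮₁.infinite _ (K.isSimpleModule_induced I)).mono ?_
    rintro k ⟨e''⟩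
    exact (hfg k l).mpr ⟨(K.fixCongr e'').trans (e'.trans e.symm)⟩
  have h3 : ∀ l, {l' | g l' = g l}.Infinite := by
    intro l
    obtain ⟨I, hI, ⟨e⟩⟩ := hq0 l
    refine (𝒮₀.infinite I hI).mono ?_
    rintro l' ⟨e'⟩
    exact hgg l' l ⟨e'.trans e.symm⟩
  obtain ⟨σ, hσ⟩ := exists_perm_of_infinite_fibers f g
    (fun k => by
      obtain ⟨l, hl⟩ := h1 k
      rw [← hl]; exact h2 l)
    h3 h1 (fun l => (h2 l).nonempty)
  exact ⟨σ, fun k => (hfg k _).mp (hσ k).symm⟩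

/-- The universe of `R₀` is, up to a permutation of the summands, the part of the universe of `R₁`
fixed by the idempotent. -/
theorem exists_transfer : ∃ (σ : ℕ ≃ ℕ) (q : U₁ →ₗ[ℝ] U₀) (i : U₀ →ₗ[ℝ] U₁),
    (∀ u, q (i u) = u) ∧ (∀ u, i (q u) = K.p • u) ∧
    (∀ r u, q (K.θ r • u) = r • q u) ∧ (∀ r u, i (r • u) = K.θ r • i u) ∧
    (∀ k, ∀ u ∈ 𝒮₁.summand k, q u ∈ 𝒮₀.summand (σ k)) ∧
    (∀ k, ∀ u ∈ 𝒮₀.summand (σ k), i u ∈ 𝒮₁.summand k) := by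
  obtain ⟨σ, hσ⟩ := K.exists_perm 𝒮₁ 𝒮₀
  let f := fun k => (hσ k).some
  obtain ⟨q, hq⟩ := 𝒮₁.exists_glue fun k =>
    ((𝒮₀.summand (σ k)).subtype.restrictScalars ℝ) ∘ₗ K.toLin (f k).toLinearMap
  have hq' : ∀ k u (hu : u ∈ 𝒮₁.summand k), q u =
      f k ⟨_, K.p_smul_mem (⟨u, hu⟩ : 𝒮₁.summand k)⟩ := hq
  -- On the fixed vectors of a summand `q` is injective. Identities for `i` are obtained below by
  -- applying `q` to the difference of their sides.
  have hqp : ∀ k, ∀ u ∈ 𝒮₁.summand k, K.p • u = u → q u = 0 → u = 0 := by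
    intro k u hu hp h0
    rw [hq' k u hu, ZeroMemClass.coe_eq_zero, LinearEquiv.map_eq_zero_iff] at h0
    rw [← hp]
    exact congrArg (fun x : K.Fix (𝒮₁.summand k) => ((x : 𝒮₁.summand k) : U₁)) h0
  have hqθ : ∀ r u, q (K.θ r • u) = r • q u := by
    intro r u
    induction u using 𝒮₁.induction with
    | h0 => simp
    | hadd x y hx hy => rw [smul_add, map_add, map_add, smul_add, hx, hy]
    | hs k u hu =>
      rw [hq' k u hu, hq' k _ (Submodule.smul_mem _ _ hu), ← Submodule.coe_smul, ← map_smul]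
      congr 2
      refine Subtype.ext (Subtype.ext ?_)
      change K.p • K.θ r • u = K.θ r • K.p • u
      rw [← mul_smul, K.comm, mul_smul]
  have hq1 : ∀ u, q (K.p • u) = q u := by
    intro u
    induction u using 𝒮₁.induction with
    | h0 => simp
    | hadd x y hx hy => rw [smul_add, map_add, map_add, hx, hy]
    | hs k u hu =>
      rw [hq' k u hu, hq' k _ (Submodule.smul_mem _ _ hu)]
      congr 2
      refine Subtype.ext (Subtype.ext ?_)
      change K.p • K.p • u = K.p • u
      rw [← mul_smul, K.idem]
  have hi : ∀ l, ∃ il : 𝒮₀.summand l →ₗ[ℝ] U₁, ∀ u, q (il u) = u ∧ K.p • il u = il u ∧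
      ∀ k, σ k = l → il u ∈ 𝒮₁.summand k := by
    intro l
    obtain ⟨k, rfl⟩ := σ.surjective l
    refine ⟨((𝒮₁.summand k).subtype.restrictScalars ℝ) ∘ₗ K.ofLin (f k).symm.toLinearMap,
      fun u => ⟨?_, ?_, fun k' hk' => ?_⟩⟩
    · refine (hq' k _ (K.ofLin (f k).symm.toLinearMap u).2).trans ?_
      have : (⟨_, K.p_smul_mem ⟨_, (K.ofLin (f k).symm.toLinearMap u).2⟩⟩ :
          K.Fix (𝒮₁.summand k)) = (f k).symm u :=
        Subtype.ext ((f k).symm u).2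
      rw [this, LinearEquiv.apply_symm_apply]
    · exact congrArg Subtype.val ((f k).symm u).2
    · rw [σ.injective hk']
      exact ((f k).symm u : 𝒮₁.summand k).2
  choose il hil using hi
  obtain ⟨i, hi⟩ := 𝒮₀.exists_glue il
  have hqi : ∀ u, q (i u) = u := by
    intro u
    induction u using 𝒮₀.induction with
    | h0 => simp
    | hadd x y hx hy => rw [map_add, map_add, hx, hy]
    | hs k u hu => rw [hi k u hu]; exact (hil k _).1
  have hqs : ∀ k, ∀ u ∈ 𝒮₁.summand k, q u ∈ 𝒮₀.summand (σ k) := fun k u hu => by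
    rw [hq' k u hu]; exact Subtype.mem _
  have his : ∀ k, ∀ u ∈ 𝒮₀.summand (σ k), i u ∈ 𝒮₁.summand k := fun k u hu => by
    rw [hi _ u hu]; exact (hil _ _).2.2 k rfl
  have hip : ∀ u, K.p • i u = i u := by
    intro u
    induction u using 𝒮₀.induction with
    | h0 => simp
    | hadd x y hx hy => rw [map_add, smul_add, hx, hy]
    | hs k u hu => rw [hi k u hu]; exact (hil k _).2.1
  refine ⟨σ, q, i, hqi, fun u => ?_, hqθ, fun r u => ?_, hqs, his⟩
  · induction u using 𝒮₁.induction with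
    | h0 => simp
    | hadd x y hx hy => rw [map_add, map_add, smul_add, hx, hy]
    | hs k u hu =>
      rw [← sub_eq_zero]
      refine hqp k _ (sub_mem (his k _ (hqs k u hu)) (Submodule.smul_mem _ _ hu)) ?_ ?_
      · rw [smul_sub, hip, ← mul_smul, K.idem]
      · rw [map_sub, hqi, hq1, sub_self]
  · induction u using 𝒮₀.induction with
    | h0 => simp
    | hadd x y hx hy => rw [smul_add, map_add, map_add, smul_add, hx, hy]
    | hs l u hu =>
      obtain ⟨k, rfl⟩ := σ.surjective l
      rw [← sub_eq_zero]
      refine hqp k _ (sub_mem (his k _ (Submodule.smul_mem _ _ hu))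
        (Submodule.smul_mem _ _ (his k u hu))) ?_ ?_
      · rw [smul_sub, hip, ← mul_smul, K.comm, mul_smul, hip]
      · rw [map_sub, hqi, hqθ, hqi, sub_self]

end Match

end FullCorner

/-! ### Continuous maps of classifying spaces -/

section Initial

variable {R : Type u} [Ring R] [Algebra ℝ R] {U : Type v} [AddCommGroup U]
  [Module ℝ U] [Module R U] [IsScalarTower ℝ R U] (𝒮 : UniverseDecomposition R U)

namespace UniverseDecomposition

theorem summand_le_initial {k n : ℕ} (h : k < n) : 𝒮.summand k ≤ 𝒮.initial n :=
  le_iSup₂_of_le k h le_rfl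

theorem initial_induction {p : U → Prop} {n : ℕ} {u : U} (hu : u ∈ 𝒮.initial n) (h0 : p 0)
    (hadd : ∀ x y, p x → p y → p (x + y)) (hs : ∀ k < n, ∀ u ∈ 𝒮.summand k, p u) : p u := by
  refine Submodule.iSup_induction _ (motive := p) hu (fun k x hx => ?_) h0 hadd
  exact Submodule.iSup_induction _ (motive := p) hx (fun hk x hx => hs k hk x hx) h0 hadd

/-- The projection along the remaining summands; it allows an operator of the `n`-th stage to be
rebuilt from its restriction. -/
theorem exists_proj (n : ℕ) : ∃ e : U →ₗ[ℝ] (𝒮.initial n).restrictScalars ℝ,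
    (∀ u ∈ 𝒮.initial n, (e u : U) = u) ∧ ∀ k, n ≤ k → ∀ u ∈ 𝒮.summand k, e u = 0 := by
  obtain ⟨e, he⟩ := 𝒮.exists_glue fun k =>
    if k < n then (𝒮.summand k).subtype.restrictScalars ℝ else 0
  have he1 : ∀ k < n, ∀ u ∈ 𝒮.summand k, e u = u := fun k hk u hu => by
    rw [he k u hu, if_pos hk]; rfl
  have he2 : ∀ k, n ≤ k → ∀ u ∈ 𝒮.summand k, e u = 0 := fun k hk u hu => by
    rw [he k u hu, if_neg hk.not_gt]; rfl
  have hmem : ∀ u, e u ∈ (𝒮.initial n).restrictScalars ℝ := by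
    intro u
    induction u using 𝒮.induction with
    | h0 => rw [map_zero]; exact zero_mem _
    | hadd x y hx hy => rw [map_add]; exact add_mem hx hy
    | hs k u hu =>
      rcases lt_or_ge k n with hk | hk
      · rw [he1 k hk u hu]; exact 𝒮.summand_le_initial hk hu
      · rw [he2 k hk u hu]; exact zero_mem _
  refine ⟨e.codRestrict _ hmem, fun u hu => ?_, fun k hk u hu => Subtype.ext (he2 k hk u hu)⟩
  change e u = u
  exact 𝒮.initial_induction (p := fun u => e u = u) hu (map_zero e)
    (fun x y hx hy => by rw [map_add, hx, hy]) he1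

end UniverseDecomposition

theorem exists_bound (τ : ℕ ≃ ℕ) (n : ℕ) : ∃ m, ∀ k < n, τ k < m :=
  ⟨(Finset.range n).sup τ + 1, fun _ hk =>
    Nat.lt_succ_of_le (Finset.le_sup (f := τ) (Finset.mem_range.mpr hk))⟩

end Initial

section Sandwich

variable {U U' : Type*} [AddCommGroup U] [Module ℝ U] [AddCommGroup U'] [Module ℝ U']
variable {ι : Type*} [Fintype ι] (a : ι → U →ₗ[ℝ] U') (c : ι → U' →ₗ[ℝ] U)

/-- The linear map `M ↦ ∑ i, a i ∘ M ∘ c i` of operators. -/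
def sandwich : Module.End ℝ U →ₗ[ℝ] Module.End ℝ U' where
  toFun M := ∑ i, a i ∘ₗ M ∘ₗ c i
  map_add' M N := by
    simp only [LinearMap.add_comp, LinearMap.comp_add, Finset.sum_add_distrib]
  map_smul' r M := by
    simp only [LinearMap.smul_comp, LinearMap.comp_smul, Finset.smul_sum, RingHom.id_apply]

theorem sandwich_apply (M : Module.End ℝ U) (u : U') :
    sandwich a c M u = ∑ i, a i (M (c i u)) := by
  simp [sandwich]

end Sandwich

namespace ClSpace

variable {G : Type u} [Group G] (D : SymmetryData G)
variable {B : Type*} [Ring B] [Algebra ℝ B] {ℬ : ZMod 2 → Submodule ℝ B} [GradedAlgebra ℬ]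
variable (j : D.Alg →ₐ[ℝ] B) (E : Set B)
variable {U : Type*} [AddCommGroup U] [Module ℝ U] [Module (Ham ℬ) U] [IsScalarTower ℝ (Ham ℬ) U]
variable (𝒮 : UniverseDecomposition (Ham ℬ) U)
variable {B' : Type*} [Ring B'] [Algebra ℝ B'] {ℬ' : ZMod 2 → Submodule ℝ B'} [GradedAlgebra ℬ']
variable (j' : D.Alg →ₐ[ℝ] B') (E' : Set B')
variable {U' : Type*} [AddCommGroup U'] [Module ℝ U'] [Module (Ham ℬ') U']
  [IsScalarTower ℝ (Ham ℬ') U']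
variable (𝒮' : UniverseDecomposition (Ham ℬ') U')

theorem continuous_stage_val (n : ℕ) :
    @Continuous _ _ (TopologicalSpace.induced (restrict D j E 𝒮 n) (moduleTopology ℝ _)) _
      (Subtype.val : stage D j E 𝒮 n → ClSpace D j E 𝒮) :=
  @continuous_iff_coinduced_le _ _ _ (TopologicalSpace.induced _ (moduleTopology ℝ _)) _ |>.mpr
    (le_iSup (fun n => TopologicalSpace.coinduced
      (Subtype.val : stage D j E 𝒮 n → ClSpace D j E 𝒮)
        (TopologicalSpace.induced (restrict D j E 𝒮 n) (moduleTopology ℝ _))) n)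

variable {D j E 𝒮 j' E' 𝒮'}

/-- A map of classifying spaces which maps stages to stages, and does so by affine maps, is
continuous. -/
theorem continuous_of_affine {F : ClSpace D j E 𝒮 → ClSpace D j' E' 𝒮'}
    (h : ∀ n, ∃ m, ∃ hm : ∀ M ∈ stage D j E 𝒮 n, F M ∈ stage D j' E' 𝒮' m,
      ∃ (Λ : Module.End ℝ ((𝒮.initial n).restrictScalars ℝ) →ₗ[ℝ]
        Module.End ℝ ((𝒮'.initial m).restrictScalars ℝ)) (N : _),
      ∀ M : stage D j E 𝒮 n, restrict D j' E' 𝒮' m ⟨F M, hm M.1 M.2⟩ =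
        Λ (restrict D j E 𝒮 n M) + N) : Continuous F := by
  refine continuous_iSup_dom.mpr fun n => continuous_coinduced_dom.mpr ?_
  obtain ⟨m, hm, Λ, N, hΛ⟩ := h n
  let t1 := moduleTopology ℝ (Module.End ℝ ((𝒮.initial n).restrictScalars ℝ))
  let t2 := moduleTopology ℝ (Module.End ℝ ((𝒮'.initial m).restrictScalars ℝ))
  let t3 := TopologicalSpace.induced (restrict D j E 𝒮 n) t1
  let t4 := TopologicalSpace.induced (restrict D j' E' 𝒮' m) t2
  have : IsModuleTopology ℝ (Module.End ℝ ((𝒮.initial n).restrictScalars ℝ)) := ⟨rfl⟩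
  have : IsModuleTopology ℝ (Module.End ℝ ((𝒮'.initial m).restrictScalars ℝ)) := ⟨rfl⟩
  have := IsModuleTopology.toContinuousAdd ℝ (Module.End ℝ ((𝒮'.initial m).restrictScalars ℝ))
  have := IsModuleTopology.toContinuousSMul ℝ (Module.End ℝ ((𝒮'.initial m).restrictScalars ℝ))
  let g : stage D j E 𝒮 n → stage D j' E' 𝒮' m := fun M => ⟨F M, hm M.1 M.2⟩
  have hg : Continuous g := by
    refine continuous_induced_rng.mpr ?_
    have e : restrict D j' E' 𝒮' m ∘ g = fun M => Λ (restrict D j E 𝒮 n M) + N :=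
      funext fun M => hΛ M
    rw [e]
    exact ((IsModuleTopology.continuous_of_linearMap Λ).comp continuous_induced_dom).add
      continuous_const
  exact (continuous_stage_val D j' E' 𝒮' m).comp hg

section Map

variable {ι : Type*} [Fintype ι] {a : ι → U →ₗ[ℝ] U'} {c : ι → U' →ₗ[ℝ] U} {τ : ℕ ≃ ℕ}

/-- The coefficients respect the matching `τ` of summands, so beyond stage `n` the operator may be
replaced by the trivial Hamiltonian, whose image is trivial by `h0`. The bound `m` only has to
exceed `τ k` for `k < n`; other summands below `m` are preserved by the trivial Hamiltonian. -/
theorem isTrivialOutside_sandwich (ha : ∀ i k, ∀ u ∈ 𝒮.summand k, a i u ∈ 𝒮'.summand (τ k))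
    (hc : ∀ i k, ∀ u ∈ 𝒮'.summand (τ k), c i u ∈ 𝒮.summand k)
    (h0 : sandwich a c (trivialHam ℬ U) = trivialHam ℬ' U') {n m : ℕ} (hm : ∀ k < n, τ k < m)
    {M : Module.End ℝ U} (hM : IsTrivialOutside 𝒮 n M) :
    IsTrivialOutside 𝒮' m (sandwich a c M) := by
  have key : ∀ k, n ≤ k → ∀ u ∈ 𝒮'.summand (τ k), sandwich a c M u = trivialHam ℬ' U' u := by
    intro k hk u hu
    rw [← h0, sandwich_apply, sandwich_apply]
    exact Finset.sum_congr rfl fun i _ => by rw [hM.eq k hk _ (hc i k u hu)]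
  constructor
  · intro u hu
    refine 𝒮'.initial_induction (p := fun u => sandwich a c M u ∈ 𝒮'.initial m) hu
      (by rw [map_zero]; exact zero_mem _)
      (fun x y hx hy => by rw [map_add]; exact add_mem hx hy) fun l hl u hu => ?_
    obtain ⟨k, rfl⟩ := τ.surjective l
    rcases lt_or_ge k n with hk | hk
    · rw [sandwich_apply]
      refine sum_mem fun i _ => ?_
      exact 𝒮.initial_induction (p := fun x => a i x ∈ 𝒮'.initial m)
        (hM.maps _ (𝒮.summand_le_initial hk (hc i k u hu)))
        (by rw [map_zero]; exact zero_mem _)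
        (fun x y hx hy => by rw [map_add]; exact add_mem hx hy)
        fun k' hk' x hx => 𝒮'.summand_le_initial (hm k' hk') (ha i k' x hx)
    · rw [key k hk u hu]
      exact 𝒮'.summand_le_initial hl (Submodule.smul_mem _ _ hu)
  · intro l hl u hu
    obtain ⟨k, rfl⟩ := τ.surjective l
    exact key k (not_lt.mp fun hk => hl.not_gt (hm k hk)) u hu

/-- The map of classifying spaces given by `M ↦ ∑ i, a i ∘ M ∘ c i`. -/
def sandwichMap (ha : ∀ i k, ∀ u ∈ 𝒮.summand k, a i u ∈ 𝒮'.summand (τ k))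
    (hc : ∀ i k, ∀ u ∈ 𝒮'.summand (τ k), c i u ∈ 𝒮.summand k)
    (h0 : sandwich a c (trivialHam ℬ U) = trivialHam ℬ' U')
    (hH : ∀ M, IsHamiltonian D ℬ j E M → IsHamiltonian D ℬ' j' E' (sandwich a c M))
    (M : ClSpace D j E 𝒮) : ClSpace D j' E' 𝒮' :=
  ⟨sandwich a c M.1, hH _ M.2.1, by
    obtain ⟨n, hn⟩ := M.2.2
    obtain ⟨m, hm⟩ := exists_bound τ n
    exact ⟨m, isTrivialOutside_sandwich ha hc h0 hm hn⟩⟩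

/-- In stage `n` an operator is its restriction extended by zero plus the trivial Hamiltonian on the
complement. The second term is constant, so on restrictions the map is affine between finite
dimensional spaces. -/
theorem continuous_sandwichMap (ha : ∀ i k, ∀ u ∈ 𝒮.summand k, a i u ∈ 𝒮'.summand (τ k))
    (hc : ∀ i k, ∀ u ∈ 𝒮'.summand (τ k), c i u ∈ 𝒮.summand k)
    (h0 : sandwich a c (trivialHam ℬ U) = trivialHam ℬ' U')
    (hH : ∀ M, IsHamiltonian D ℬ j E M → IsHamiltonian D ℬ' j' E' (sandwich a c M)) :
    Continuous (sandwichMap (𝒮 := 𝒮) (𝒮' := 𝒮') ha hc h0 hH) := by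
  refine continuous_of_affine fun n => ?_
  obtain ⟨m, hm⟩ := exists_bound τ n
  obtain ⟨e, he1, he2⟩ := 𝒮.exists_proj n
  obtain ⟨e', he1', -⟩ := 𝒮'.exists_proj m
  let s : (𝒮.initial n).restrictScalars ℝ →ₗ[ℝ] U := Submodule.subtype _
  let s' : (𝒮'.initial m).restrictScalars ℝ →ₗ[ℝ] U' := Submodule.subtype _
  refine ⟨m, fun M hM => isTrivialOutside_sandwich ha hc h0 hm hM,
    sandwich (fun _ : Unit => e') (fun _ => s') ∘ₗ sandwich a c ∘ₗ
      sandwich (fun _ : Unit => s) (fun _ => e),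
    e' ∘ₗ sandwich a c (trivialHam ℬ U ∘ₗ (LinearMap.id - s ∘ₗ e)) ∘ₗ s', fun M => ?_⟩
  have hM : M.1.1 = sandwich (fun _ : Unit => s) (fun _ => e) (restrict D j E 𝒮 n M) +
      trivialHam ℬ U ∘ₗ (LinearMap.id - s ∘ₗ e) := by
    refine 𝒮.hom_ext fun k u hu => ?_
    rw [LinearMap.add_apply, sandwich_apply, LinearMap.comp_apply, LinearMap.sub_apply,
      LinearMap.comp_apply, LinearMap.id_apply, Fintype.sum_unique]
    change _ = M.1.1 (e u : U) + trivialHam ℬ U (u - (e u : U))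
    rcases lt_or_ge k n with hk | hk
    · rw [he1 u (𝒮.summand_le_initial hk hu), sub_self, map_zero, add_zero]
    · rw [he2 k hk u hu, Submodule.coe_zero, map_zero, zero_add, sub_zero]
      exact M.2.eq k hk u hu
  ext u
  have h1 : ∀ x, (e' (sandwich a c M.1.1 (s' x)) : U') = sandwich a c M.1.1 (s' x) := fun x =>
    he1' _ ((isTrivialOutside_sandwich ha hc h0 hm M.2).maps _ x.2)
  refine (h1 u).symm.trans ?_
  rw [hM, map_add, LinearMap.add_apply, map_add, LinearMap.add_apply, LinearMap.comp_apply,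
    LinearMap.comp_apply, LinearMap.comp_apply, LinearMap.comp_apply,
    sandwich_apply (fun _ : Unit => e') (fun _ => s'), Fintype.sum_unique]

end Map

end ClSpace

/-! ### Removing a factor `Cl^{d,d}` -/

namespace VacuumData

variable {C : Type*} [Ring C] [Algebra ℝ C] {𝒞 : ZMod 2 → Submodule ℝ C} [GradedAlgebra 𝒞]
  (P : VacuumData 𝒞)

theorem p_mem : P.p ∈ 𝒞 0 := (mem_iff_parityHom 𝒞).mpr (by rw [P.even, sgn_zero, one_smul])

end VacuumData

section Factor

variable {G : Type u} [Group G] (D : SymmetryData G)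
variable {C : Type*} [Ring C] [Algebra ℝ C] {𝒞 : ZMod 2 → Submodule ℝ C} [GradedAlgebra 𝒞]
variable {B : Type v} [Ring B] [Algebra ℝ B] {ℬ : ZMod 2 → Submodule ℝ B}
variable (e : B ≃ₐ[ℝ] 𝒞 ᵍ⊗[ℝ] D.grade) (he : ∀ c x, x ∈ ℬ c ↔ e x ∈ tensorGrade 𝒞 D.grade c)

/-- The first factor of `B ≃ C ⊗̂ A`. -/
def leftFactor : C →ₐ[ℝ] B :=
  e.symm.toAlgHom.comp (GradedTensorProduct.includeLeft 𝒞 D.grade)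

/-- The second factor of `B ≃ C ⊗̂ A`. -/
def rightFactor : D.Alg →ₐ[ℝ] B :=
  e.symm.toAlgHom.comp (GradedTensorProduct.includeRight 𝒞 D.grade)

theorem leftFactor_apply (c : C) : leftFactor D e c = e.symm (c ᵍ⊗ₜ[ℝ] 1) := rfl

theorem rightFactor_apply (a : D.Alg) : rightFactor D e a = e.symm (1 ᵍ⊗ₜ[ℝ] a) := rfl

theorem leftFactor_mul_rightFactor (c : C) (a : D.Alg) :
    leftFactor D e c * rightFactor D e a = e.symm (c ᵍ⊗ₜ[ℝ] a) := by
  rw [leftFactor_apply, rightFactor_apply, ← map_mul, gtmul_one_mul, mul_one]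

theorem rightFactor_mul_leftFactor {c : C} (hc : c ∈ 𝒞 0) (a : D.Alg) :
    rightFactor D e a * leftFactor D e c = leftFactor D e c * rightFactor D e a := by
  rw [leftFactor_mul_rightFactor, leftFactor_apply, rightFactor_apply, ← map_mul,
    gtmul_mul_of_left_even _ _ _ _ hc, one_mul, mul_one]

theorem rightFactor_mul_leftFactor' (c : C) {a : D.Alg} (ha : a ∈ D.grade 0) :
    rightFactor D e a * leftFactor D e c = leftFactor D e c * rightFactor D e a := by
  rw [leftFactor_mul_rightFactor, leftFactor_apply, rightFactor_apply, ← map_mul,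
    gtmul_mul_of_right_even _ _ _ _ ha, one_mul, mul_one]

include he in
theorem leftFactor_mem {i : ZMod 2} {c : C} (hc : c ∈ 𝒞 i) : leftFactor D e c ∈ ℬ i := by
  rw [he, leftFactor_apply, AlgEquiv.apply_symm_apply]
  exact tmul_mem_tensorGrade (add_zero i) hc SetLike.GradedOne.one_mem

include he in
theorem rightFactor_mem {i : ZMod 2} {a : D.Alg} (ha : a ∈ D.grade i) :
    rightFactor D e a ∈ ℬ i := by
  rw [he, rightFactor_apply, AlgEquiv.apply_symm_apply]
  exact tmul_mem_tensorGrade (zero_add i) SetLike.GradedOne.one_mem ha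

variable [GradedAlgebra ℬ]

/-- The homomorphism `Cl^{0,1} ⊗̂ A → Cl^{0,1} ⊗̂ B`. -/
def hamMap : Ham D.grade →ₐ[ℝ] Ham ℬ :=
  gtLift (GradedTensorProduct.includeLeft (clGrade 0 1) ℬ)
    ((GradedTensorProduct.includeRight (clGrade 0 1) ℬ).comp (rightFactor D e))
    (fun i k m hm a ha => by
      change (m ᵍ⊗ₜ[ℝ] (1 : B) : Ham ℬ) * ((1 : Cl 0 1) ᵍ⊗ₜ[ℝ] rightFactor D e a : Ham ℬ) =
        sgn (k * i) • (((1 : Cl 0 1) ᵍ⊗ₜ[ℝ] rightFactor D e a : Ham ℬ) *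
          (m ᵍ⊗ₜ[ℝ] (1 : B) : Ham ℬ))
      rw [gtmul_one_mul, tmul_mul_tmul_of_mem _ _ _ _ (rightFactor_mem D e he ha) hm, smul_smul,
        sgn_mul_self, one_smul, mul_one, mul_one, one_mul])

theorem hamMap_tmul (m : Cl 0 1) (a : D.Alg) :
    hamMap D e he (m ᵍ⊗ₜ[ℝ] a) = m ᵍ⊗ₜ[ℝ] rightFactor D e a := by
  refine (gtLift_tmul ..).trans ?_
  change (m ᵍ⊗ₜ[ℝ] (1 : B) : Ham ℬ) * ((1 : Cl 0 1) ᵍ⊗ₜ[ℝ] rightFactor D e a : Ham ℬ) = _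
  rw [gtmul_one_mul, mul_one]

/-- A linear map `Cl^{0,1} ⊗̂ B → Cl^{0,1} ⊗̂ A` given by a functional on `C`. -/
def hamEval (l : C →ₗ[ℝ] ℝ) : Ham ℬ →ₗ[ℝ] Ham D.grade :=
  (GradedTensorProduct.of ℝ (clGrade 0 1) D.grade).toLinearMap ∘ₗ
    TensorProduct.map LinearMap.id
      (TensorProduct.lift (LinearMap.lsmul ℝ D.Alg ∘ₗ l) ∘ₗ
        (GradedTensorProduct.of ℝ 𝒞 D.grade).symm.toLinearMap ∘ₗ e.toLinearMap) ∘ₗ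
    (GradedTensorProduct.of ℝ (clGrade 0 1) ℬ).symm.toLinearMap

theorem hamEval_tmul (l : C →ₗ[ℝ] ℝ) (m : Cl 0 1) (c : C) (a : D.Alg) :
    hamEval (ℬ := ℬ) D e l (m ᵍ⊗ₜ[ℝ] e.symm (c ᵍ⊗ₜ[ℝ] a)) = m ᵍ⊗ₜ[ℝ] (l c • a) := by
  change m ᵍ⊗ₜ[ℝ] (TensorProduct.lift (LinearMap.lsmul ℝ D.Alg ∘ₗ l)
    ((GradedTensorProduct.of ℝ 𝒞 D.grade).symm (e (e.symm (c ᵍ⊗ₜ[ℝ] a))))) = _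
  rw [AlgEquiv.apply_symm_apply]
  rfl

variable (P : VacuumData 𝒞)

theorem hamMap_mul_vacuum (m : Cl 0 1) (a : D.Alg) :
    (hamMap D e he (m ᵍ⊗ₜ[ℝ] a) * ((1 : Cl 0 1) ᵍ⊗ₜ[ℝ] leftFactor D e P.p : Ham ℬ) : Ham ℬ) =
      m ᵍ⊗ₜ[ℝ] (leftFactor D e P.p * rightFactor D e a) := by
  rw [hamMap_tmul, gtmul_mul_one, rightFactor_mul_leftFactor D e P.p_mem]

include he in
theorem vacuum_mul (m : Cl 0 1) (x : B) :
    (((1 : Cl 0 1) ᵍ⊗ₜ[ℝ] leftFactor D e P.p : Ham ℬ) * (m ᵍ⊗ₜ[ℝ] x : Ham ℬ) : Ham ℬ) =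
      m ᵍ⊗ₜ[ℝ] (leftFactor D e P.p * x) := by
  rw [gtmul_mul_of_right_even _ _ _ _ (leftFactor_mem D e he P.p_mem), one_mul]

/-- The full corner of `Cl^{0,1} ⊗̂ B` given by the vacuum of the first factor of
`B ≃ C ⊗̂ A`. -/
def vacuumCorner : FullCorner (Ham D.grade) (Ham ℬ) where
  θ := hamMap D e he
  p := (1 : Cl 0 1) ᵍ⊗ₜ[ℝ] leftFactor D e P.p
  ι := P.ι
  a i := (1 : Cl 0 1) ᵍ⊗ₜ[ℝ] leftFactor D e (P.a i)
  c i := (1 : Cl 0 1) ᵍ⊗ₜ[ℝ] leftFactor D e (P.c i)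
  sum := by
    simp only [gtmul_mul_one, ← map_mul]
    have h := congrArg (fun x => gtmk (clGrade 0 1) ℬ 1 (leftFactor D e x)) P.sum
    simp only [map_sum, map_one] at h
    exact h
  idem := by rw [gtmul_mul_one, ← map_mul, P.idem]
  comm r := by
    induction r using gtensor_induction with
    | h0 => simp
    | hadd x y hx hy => rw [map_add, mul_add, add_mul, hx, hy]
    | ht m a => rw [hamMap_mul_vacuum, hamMap_tmul, vacuum_mul D e he]
  corner r := by
    induction r using gtensor_induction with
    | h0 => exact ⟨0, by simp⟩
    | hadd x y hx hy =>
      obtain ⟨s, hs⟩ := hx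
      obtain ⟨t, ht⟩ := hy
      exact ⟨s + t, by rw [mul_add, add_mul, hs, ht, map_add, add_mul]⟩
    | ht m x =>
      obtain ⟨t, rfl⟩ := e.symm.surjective x
      induction t using gtensor_induction with
      | h0 =>
        have h : (m ᵍ⊗ₜ[ℝ] (0 : B) : Ham ℬ) = 0 := map_zero (gtmk _ ℬ m)
        exact ⟨0, by rw [map_zero, h]; simp⟩
      | hadd x y hx hy =>
        obtain ⟨s, hs⟩ := hx
        obtain ⟨t, ht⟩ := hy
        refine ⟨s + t, ?_⟩
        have h : (m ᵍ⊗ₜ[ℝ] (e.symm x + e.symm y) : Ham ℬ) =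
          m ᵍ⊗ₜ[ℝ] e.symm x + m ᵍ⊗ₜ[ℝ] e.symm y := map_add (gtmk _ ℬ m) _ _
        rw [map_add, map_add, add_mul, ← hs, ← ht, ← add_mul, ← mul_add, h]
      | ht c a =>
        -- The even idempotent passes `m` and `a` without signs, and `p c p = ev(c) p`.
        refine ⟨P.ev c • (m ᵍ⊗ₜ[ℝ] a), ?_⟩
        rw [map_smul, smul_mul_assoc, hamMap_mul_vacuum, vacuum_mul D e he, gtmul_mul_one,
          ← leftFactor_mul_rightFactor, mul_assoc, mul_assoc,
          rightFactor_mul_leftFactor D e P.p_mem, ← mul_assoc, ← mul_assoc, ← map_mul, ← map_mul,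
          P.corner, map_smul, smul_mul_assoc, ← gtmk_apply, map_smul]
        rfl
  inj s hs := by
    -- Since `ev p = 1`, evaluating the factor in `C` by `ev` inverts `s ↦ θ(s) p` from the left.
    have h : ∀ s, hamEval (ℬ := ℬ) D e P.ev (hamMap D e he s *
        ((1 : Cl 0 1) ᵍ⊗ₜ[ℝ] leftFactor D e P.p : Ham ℬ)) = s := by
      intro s
      induction s using gtensor_induction with
      | h0 => simp
      | hadd x y hx hy => rw [map_add, add_mul, map_add, hx, hy]
      | ht m a =>
        rw [hamMap_mul_vacuum, leftFactor_mul_rightFactor, hamEval_tmul, P.ev_p, one_smul]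
    rw [← h s, hs, map_zero]

end Factor

/-! ### Operators on a module and on its vacuum part -/

section VacuumPart

variable {C : Type*} [Ring C] [Algebra ℝ C] {𝒞 : ZMod 2 → Submodule ℝ C} [GradedAlgebra 𝒞]
variable {U₁ U₀ : Type*} [AddCommGroup U₁] [Module ℝ U₁] [AddCommGroup U₀] [Module ℝ U₀]

/-- A representation of a graded algebra with a vacuum, together with an identification of its
vacuum part. -/
structure VacuumPart (P : VacuumData 𝒞) (L : C →ₐ[ℝ] Module.End ℝ U₁) (q : U₁ →ₗ[ℝ] U₀)
    (i : U₀ →ₗ[ℝ] U₁) : Prop where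
  q_i : ∀ v, q (i v) = v
  i_q : ∀ u, i (q u) = L P.p u

namespace VacuumPart

variable {P : VacuumData 𝒞} {L : C →ₐ[ℝ] Module.End ℝ U₁} {q : U₁ →ₗ[ℝ] U₀} {i : U₀ →ₗ[ℝ] U₁}
  (H : VacuumPart P L q i)

include H

theorem q_p (u : U₁) : q (L P.p u) = q u := by rw [← H.i_q, H.q_i]

theorem p_i (v : U₀) : L P.p (i v) = i v := by rw [← H.i_q, H.q_i]

/-- The image of `i` is fixed by `p`, and `p x p = ev(x) p`. -/
theorem q_act_i (x : C) (v : U₀) : q (L x (i v)) = P.ev x • v := by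
  rw [← H.p_i v, ← H.q_p, ← Module.End.mul_apply, ← Module.End.mul_apply, ← map_mul, ← map_mul,
    P.corner, map_smul, LinearMap.smul_apply, map_smul, H.q_p, H.q_i]

theorem resolve (u : U₁) : ∑ k, L (P.a k) (i (q (L (P.c k) u))) = u := by
  have h := congrArg (fun x => L x u) P.sum
  simp only [map_sum, map_mul, map_one, LinearMap.sum_apply, Module.End.mul_apply,
    Module.End.one_apply] at h
  simpa only [H.i_q] using h

theorem q_act (x : C) (u : U₁) :
    q (L x u) = ∑ k, P.ev (x * P.a k) • q (L (P.c k) u) := by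
  conv_lhs => rw [← H.resolve u]
  simp only [map_sum, ← H.q_act_i, map_mul, Module.End.mul_apply]

/-- The partition of unity gives `x p = ∑ ev(c_k x) a_k p`. The parity automorphism is applied to
this identity, and evenness of `p` keeps the vacuum part in place. -/
theorem parity_act_i (x : C) (v : U₀) : L (parityHom 𝒞 x) (i v) =
    ∑ k, P.ev (P.c k * x) • L (parityHom 𝒞 (P.a k)) (i v) := by
  have h : x * P.p = ∑ k, P.ev (P.c k * x) • (P.a k * P.p) := by
    calc x * P.p = (∑ k, P.a k * P.p * P.c k) * (x * P.p) := by rw [P.sum, one_mul]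
      _ = _ := by
        rw [Finset.sum_mul]
        refine Finset.sum_congr rfl fun k _ => ?_
        rw [← mul_smul_comm, ← P.corner]
        simp only [mul_assoc]
  have h' := congrArg (fun y => L (parityHom 𝒞 y) (i v)) h
  simpa only [map_sum, map_mul, map_smul, P.even, LinearMap.sum_apply, LinearMap.smul_apply,
    Module.End.mul_apply, H.p_i] using h'

omit H in
variable (P L q i) in
/-- The extension of an operator on the vacuum part to an operator which commutes with the
algebra in the graded sense. -/
def extend : Module.End ℝ U₀ →ₗ[ℝ] Module.End ℝ U₁ :=
  sandwich (fun k => L (parityHom 𝒞 (P.a k)) ∘ₗ i) (fun k => q ∘ₗ L (P.c k))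

omit H in
theorem extend_apply (N : Module.End ℝ U₀) (u : U₁) :
    extend P L q i N u = ∑ k, L (parityHom 𝒞 (P.a k)) (i (N (q (L (P.c k) u)))) :=
  sandwich_apply ..

/-- The scalars `ev(c_k x a_l)` are the matrix entries of `x`. They arise from `x` on the right by
expanding after `c_k`, and from its parity on the left by expanding before `a_l`; they pass through
`N`, and the double sums agree. -/
theorem extend_act (N : Module.End ℝ U₀) (x : C) :
    extend P L q i N * L x = L (parityHom 𝒞 x) * extend P L q i N := by
  ext u
  rw [Module.End.mul_apply, Module.End.mul_apply, extend_apply, extend_apply, map_sum]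
  have h1 : ∀ k, L (parityHom 𝒞 (P.a k)) (i (N (q (L (P.c k) (L x u))))) =
      ∑ l, P.ev (P.c k * x * P.a l) • L (parityHom 𝒞 (P.a k)) (i (N (q (L (P.c l) u)))) := by
    intro k
    rw [← Module.End.mul_apply (L (P.c k)), ← map_mul, H.q_act]
    simp only [map_sum, map_smul]
  have h2 : ∀ l, L (parityHom 𝒞 x) (L (parityHom 𝒞 (P.a l)) (i (N (q (L (P.c l) u))))) =
      ∑ k, P.ev (P.c k * x * P.a l) • L (parityHom 𝒞 (P.a k)) (i (N (q (L (P.c l) u)))) := by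
    intro l
    rw [← Module.End.mul_apply, ← map_mul, ← map_mul, H.parity_act_i]
    simp only [mul_assoc]
  rw [Finset.sum_congr rfl fun k _ => h1 k, Finset.sum_congr rfl fun k _ => h2 k]
  exact Finset.sum_comm

theorem extend_i (N : Module.End ℝ U₀) (v : U₀) : extend P L q i N (i v) = i (N v) := by
  have h := H.parity_act_i 1 (N v)
  rw [map_one, map_one, Module.End.one_apply] at h
  rw [extend_apply, h]
  simp only [H.q_act_i, map_smul, mul_one]

/-- Moving the outer factor past the parity of `a_k` restores `a_k`; it then acts on the vacuum part
by `N`, so that `N² = 1` leaves the resolution of `u`. -/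
theorem extend_mul_self {N : Module.End ℝ U₀} (hN : N * N = 1) :
    extend P L q i N * extend P L q i N = 1 := by
  ext u
  rw [Module.End.mul_apply, extend_apply N u, map_sum, Module.End.one_apply]
  conv_rhs => rw [← H.resolve u]
  refine Finset.sum_congr rfl fun k _ => ?_
  rw [← Module.End.mul_apply, H.extend_act, parityHom_parityHom, Module.End.mul_apply, H.extend_i,
    ← Module.End.mul_apply N, hN, Module.End.one_apply]

omit H in
variable (q i) in
/-- The compression of an operator to the vacuum part. -/
def compress : Module.End ℝ U₁ →ₗ[ℝ] Module.End ℝ U₀ :=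
  sandwich (fun _ : Unit => q) (fun _ => i)

omit H in
theorem compress_apply (M : Module.End ℝ U₁) (v : U₀) : compress q i M v = q (M (i v)) := by
  rw [compress, sandwich_apply, Fintype.sum_unique]

theorem compress_extend (N : Module.End ℝ U₀) : compress q i (extend P L q i N) = N := by
  ext v
  rw [compress_apply, H.extend_i, H.q_i]

/-- Applying `M` to the resolution `u = ∑ a_k p c_k u` and moving it past `a_k` shows that `M` is
determined by its action on the vacuum part, which it preserves because `p` is even. -/
theorem extend_compress {M : Module.End ℝ U₁} (hM : ∀ x, M * L x = L (parityHom 𝒞 x) * M) :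
    extend P L q i (compress q i M) = M := by
  have h : ∀ x u, L (parityHom 𝒞 x) (M u) = M (L x u) := fun x u =>
    (LinearMap.congr_fun (hM x) u).symm
  have hp : ∀ u, L P.p (M u) = M (L P.p u) := fun u => by rw [← h, P.even]
  ext u
  conv_rhs => rw [← H.resolve u, map_sum]
  rw [extend_apply]
  refine Finset.sum_congr rfl fun k _ => ?_
  rw [compress_apply, H.i_q (M _), hp, H.p_i, h]

theorem compress_mul_self {M : Module.End ℝ U₁} (hM : M * L P.p = L P.p * M) (hM2 : M * M = 1) :
    compress q i M * compress q i M = 1 := by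
  ext v
  rw [Module.End.mul_apply, compress_apply, compress_apply, H.i_q, ← Module.End.mul_apply,
    ← Module.End.mul_apply, mul_assoc, ← hM, ← mul_assoc, hM2, one_mul, H.p_i, H.q_i,
    Module.End.one_apply]

end VacuumPart

end VacuumPart

/-! ### Comparison of classifying spaces -/

/-- For mutually inverse maps constant homotopies suffice, and equivariance and base point of the
inverse are automatic. -/
theorem BasedGHomotopyEquivalent.of_inverse (G : Type u) [Group G] {X : Type v} {Y : Type w}
    [TopologicalSpace X] [TopologicalSpace Y] [MulAction G X] [MulAction G Y] {x₀ : X} {y₀ : Y}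
    {f : X → Y} {f' : Y → X} (hf : Continuous f) (hf' : Continuous f')
    (h : ∀ x, f' (f x) = x) (h' : ∀ y, f (f' y) = y)
    (hG : ∀ (g : G) x, f (g • x) = g • f x) (h0 : f x₀ = y₀) :
    BasedGHomotopyEquivalent G x₀ y₀ := by
  have h1 : (⟨f', hf'⟩ : C(Y, X)).comp ⟨f, hf⟩ = ContinuousMap.id X := ContinuousMap.ext h
  have h2 : (⟨f, hf⟩ : C(X, Y)).comp ⟨f', hf'⟩ = ContinuousMap.id Y := ContinuousMap.ext h'
  have h3 : f' y₀ = x₀ := by rw [← h0, h]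
  refine ⟨⟨f, hf⟩, ⟨f', hf'⟩, hG, h0, fun g y => ?_, h3, ?_, ?_⟩
  · change f' (g • y) = g • f' y
    rw [← h (g • f' y), hG, h']
  · rw [h1]
    exact ⟨.refl _, fun _ _ _ => rfl, fun _ => rfl⟩
  · rw [h2]
    exact ⟨.refl _, fun _ _ _ => rfl, fun _ => rfl⟩

section Comparison

variable {G : Type u} [Group G] (D : SymmetryData G)
variable {C : Type*} [Ring C] [Algebra ℝ C] {𝒞 : ZMod 2 → Submodule ℝ C} [GradedAlgebra 𝒞]
variable {B : Type*} [Ring B] [Algebra ℝ B] {ℬ : ZMod 2 → Submodule ℝ B} [GradedAlgebra ℬ]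
variable (e : B ≃ₐ[ℝ] 𝒞 ᵍ⊗[ℝ] D.grade) (he : ∀ c x, x ∈ ℬ c ↔ e x ∈ tensorGrade 𝒞 D.grade c)
variable (P : VacuumData 𝒞) (j : D.Alg →ₐ[ℝ] B) (E : Set B) [IsSymmetryExtension D ℬ j E]
variable {U₁ : Type*} [AddCommGroup U₁] [Module ℝ U₁] [Module (Ham ℬ) U₁]
  [IsScalarTower ℝ (Ham ℬ) U₁] (𝒮₁ : UniverseDecomposition (Ham ℬ) U₁)
variable {U₀ : Type*} [AddCommGroup U₀] [Module ℝ U₀] [Module (Ham D.grade) U₀]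
  [IsScalarTower ℝ (Ham D.grade) U₀] (𝒮₀ : UniverseDecomposition (Ham D.grade) U₀)

variable (ℬ U₁) in
/-- The representation of the first factor of `B ≃ C ⊗̂ A`. -/
def leftRep : C →ₐ[ℝ] Module.End ℝ U₁ := (rep ℬ U₁).comp (leftFactor D e)

theorem leftRep_apply (x : C) : leftRep D ℬ e U₁ x = rep ℬ U₁ (leftFactor D e x) := rfl

variable (ℬ U₁) in
/-- The representation of the second factor of `B ≃ C ⊗̂ A`. -/
def rightRep : D.Alg →ₐ[ℝ] Module.End ℝ U₁ := (rep ℬ U₁).comp (rightFactor D e)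

theorem rightRep_apply (x : D.Alg) : rightRep D ℬ e U₁ x = rep ℬ U₁ (rightFactor D e x) := rfl

theorem rightRep_mul_leftRep (x : C) {a : D.Alg} (ha : a ∈ D.grade 0) :
    rightRep D ℬ e U₁ a * leftRep D ℬ e U₁ x = leftRep D ℬ e U₁ x * rightRep D ℬ e U₁ a := by
  rw [leftRep_apply, rightRep_apply, ← map_mul, ← map_mul, rightFactor_mul_leftFactor' D e x ha]

include he in
theorem trivialHam_mul_leftRep (x : C) :
    trivialHam ℬ U₁ * leftRep D ℬ e U₁ x = leftRep D ℬ e U₁ (parityHom 𝒞 x) * trivialHam ℬ U₁ := by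
  have h : (LinearMap.mulLeft ℝ (trivialHam ℬ U₁)) ∘ₗ (leftRep D ℬ e U₁).toLinearMap =
      (LinearMap.mulRight ℝ (trivialHam ℬ U₁)) ∘ₗ (leftRep D ℬ e U₁).toLinearMap ∘ₗ
        (parityHom 𝒞).toLinearMap := by
    refine linearMap_ext_of_mem 𝒞 fun c x hx => ?_
    change trivialHam ℬ U₁ * leftRep D ℬ e U₁ x = leftRep D ℬ e U₁ (parityHom 𝒞 x) * trivialHam ℬ U₁
    rw [leftRep_apply, trivialHam_mul_rep ℬ (leftFactor_mem D e he hx), parityHom_of_mem 𝒞 hx,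
      map_smul, smul_mul_assoc, leftRep_apply]
  exact LinearMap.congr_fun h x

include he P in
/-- If `B ≃ C ⊗̂ A` as graded algebras, where `C` has a vacuum, if the operators in the classifying
space of `B` are those which commute with `C` in the graded sense, and if the elements of `G` in `B`
and in `A` differ only by even invertible elements of `C`, then the classifying spaces of `B` and of
`A` are equivalent. -/
theorem basedGHomotopyEquivalent_of_vacuum
    (hE : ∀ M : Module.End ℝ U₁,
      (∀ z, M * rep ℬ U₁ (j (D.scalar z)) = rep ℬ U₁ (j (D.scalar z)) * M) →
      ((∀ x ∈ E, M * rep ℬ U₁ x = -(rep ℬ U₁ x * M)) ↔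
        ∀ c, M * leftRep D ℬ e U₁ c = leftRep D ℬ e U₁ (parityHom 𝒞 c) * M))
    (hz : ∀ z, j (D.scalar z) = rightFactor D e (D.scalar z))
    (hg : ∀ g, ∃ x y, parityHom 𝒞 x = x ∧ y * x = 1 ∧
      j (D.of g) = leftFactor D e x * rightFactor D e (D.of g)) :
    BasedGHomotopyEquivalent G (ClSpace.base D j E 𝒮₁)
      (ClSpace.base D (AlgHom.id ℝ D.Alg) ∅ 𝒮₀) := by
  obtain ⟨σ, q, i, hqi, hiq, hq, hi, hqS, hiS⟩ :=
    (vacuumCorner D e he P).exists_transfer 𝒮₁ 𝒮₀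
  have H : VacuumPart P (leftRep D ℬ e U₁) q i := ⟨hqi, hiq⟩
  have hqR : ∀ a u, q (rightRep D ℬ e U₁ a u) = rep D.grade U₀ a (q u) := fun a u => by
    rw [rep_apply, ← hq]
    change _ = q (hamMap D e he _ • u)
    rw [hamMap_tmul]
    rfl
  have hiR : ∀ a v, i (rep D.grade U₀ a v) = rightRep D ℬ e U₁ a (i v) := fun a v => by
    rw [rep_apply, hi]
    change hamMap D e he _ • i v = _
    rw [hamMap_tmul]
    rfl
  have hi0 : ∀ v, i (trivialHam D.grade U₀ v) = trivialHam ℬ U₁ (i v) := fun v => by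
    rw [trivialHam_apply, hi]
    change hamMap D e he _ • i v = _
    rw [hamMap_tmul, map_one]
    rfl
  have hzR : ∀ z, rep ℬ U₁ (j (D.scalar z)) = rightRep D ℬ e U₁ (D.scalar z) := fun z => by
    rw [hz, rightRep_apply]
  have hH1 : ∀ M : Module.End ℝ U₁, IsHamiltonian D ℬ j E M →
      ∀ c, M * leftRep D ℬ e U₁ c = leftRep D ℬ e U₁ (parityHom 𝒞 c) * M := fun M hM =>
    (hE M hM.comm).mp hM.anticomm
  have hc0 : VacuumPart.compress q i (trivialHam ℬ U₁) = trivialHam D.grade U₀ := by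
    ext v
    rw [VacuumPart.compress_apply, ← hi0, hqi]
  have he0 : VacuumPart.extend P (leftRep D ℬ e U₁) q i (trivialHam D.grade U₀) =
      trivialHam ℬ U₁ := by
    rw [← hc0, H.extend_compress (trivialHam_mul_leftRep D e he)]
  have hcH : ∀ M, IsHamiltonian D ℬ j E M →
      IsHamiltonian D D.grade (AlgHom.id ℝ D.Alg) ∅ (VacuumPart.compress q i M) := fun M hM =>
    { sq := H.compress_mul_self (by rw [hH1 M hM, P.even]) hM.sq
      comm := fun z => by
        ext v
        have h := LinearMap.congr_fun (hM.comm z) (i v)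
        rw [hzR, Module.End.mul_apply, Module.End.mul_apply] at h
        rw [AlgHom.id_apply, Module.End.mul_apply, Module.End.mul_apply,
          VacuumPart.compress_apply, VacuumPart.compress_apply, hiR, h, hqR]
      anticomm := by simp }
  have heH : ∀ N, IsHamiltonian D D.grade (AlgHom.id ℝ D.Alg) ∅ N →
      IsHamiltonian D ℬ j E (VacuumPart.extend P (leftRep D ℬ e U₁) q i N) := fun N hN => by
    -- Complex scalars are even, so they commute with the first factor and pass through every term
    -- of the extension; in the middle they commute with `N`.
    have hcomm : ∀ z, VacuumPart.extend P (leftRep D ℬ e U₁) q i N * rep ℬ U₁ (j (D.scalar z)) =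
        rep ℬ U₁ (j (D.scalar z)) * VacuumPart.extend P (leftRep D ℬ e U₁) q i N := by
      intro z
      ext u
      have hcl : ∀ x u, leftRep D ℬ e U₁ x (rightRep D ℬ e U₁ (D.scalar z) u) =
          rightRep D ℬ e U₁ (D.scalar z) (leftRep D ℬ e U₁ x u) := fun x u =>
        (LinearMap.congr_fun (rightRep_mul_leftRep D e x (D.scalar_mem_grade z)) u).symm
      rw [hzR, Module.End.mul_apply, Module.End.mul_apply, VacuumPart.extend_apply,
        VacuumPart.extend_apply, map_sum]
      refine Finset.sum_congr rfl fun k _ => ?_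
      have h := LinearMap.congr_fun (hN.comm z) (q (leftRep D ℬ e U₁ (P.c k) u))
      rw [AlgHom.id_apply, Module.End.mul_apply, Module.End.mul_apply] at h
      rw [hcl, hqR, h, hiR, hcl]
    exact ⟨H.extend_mul_self hN.sq, hcomm, (hE _ hcomm).mpr (H.extend_act N)⟩
  have hlS : ∀ x k, ∀ u ∈ 𝒮₁.summand k, leftRep D ℬ e U₁ x u ∈ 𝒮₁.summand k := fun x k u hu =>
    Submodule.smul_mem _ _ hu
  have hcS : ∀ (_ : Unit) k, ∀ u ∈ 𝒮₁.summand k, q u ∈ 𝒮₀.summand (σ k) := fun _ => hqS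
  have hcS' : ∀ (_ : Unit) k, ∀ u ∈ 𝒮₀.summand (σ k), i u ∈ 𝒮₁.summand k := fun _ => hiS
  have heS : ∀ l k, ∀ u ∈ 𝒮₀.summand k,
      (leftRep D ℬ e U₁ (parityHom 𝒞 (P.a l)) ∘ₗ i) u ∈ 𝒮₁.summand (σ.symm k) := fun l k u hu =>
    hlS _ _ _ (hiS _ _ (by rwa [Equiv.apply_symm_apply]))
  have heS' : ∀ l k, ∀ u ∈ 𝒮₁.summand (σ.symm k),
      (q ∘ₗ leftRep D ℬ e U₁ (P.c l)) u ∈ 𝒮₀.summand k := fun l k u hu => by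
    have := hqS _ _ (hlS (P.c l) _ _ hu)
    rwa [Equiv.apply_symm_apply] at this
  refine BasedGHomotopyEquivalent.of_inverse G
    (ClSpace.continuous_sandwichMap (𝒮 := 𝒮₁) (𝒮' := 𝒮₀) hcS hcS' hc0 hcH)
    (ClSpace.continuous_sandwichMap (𝒮 := 𝒮₀) (𝒮' := 𝒮₁) heS heS' he0 heH)
    (fun M => Subtype.ext (H.extend_compress (hH1 _ M.2.1)))
    (fun N => Subtype.ext (H.compress_extend N.1)) (fun g M => Subtype.ext ?_) (Subtype.ext hc0)
  symm
  refine (ClSpace.conj_eq_iff D (AlgHom.id ℝ D.Alg) g _ _).mpr ?_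
  change sgn (D.hdeg g) • (rep D.grade U₀ (D.of g) * VacuumPart.compress q i M.1) =
    VacuumPart.compress q i (g • M).1 * rep D.grade U₀ (D.of g)
  obtain ⟨x, y, hx, hyx, hxg⟩ := hg g
  have h1 : (g • M).1 * rep ℬ U₁ (j (D.of g)) = sgn (D.hdeg g) • (rep ℬ U₁ (j (D.of g)) * M.1) :=
    ClSpace.conj_mul_rep D j g M.1
  rw [hxg, map_mul, ← leftRep_apply, ← rightRep_apply, ← mul_assoc, hH1 _ (g • M).2.1, hx] at h1
  -- The operator `g • M` commutes with the even element `x`, which can then be cancelled by its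
  -- left inverse `y`. So the action defined through `j(g)` is the one defined through the second
  -- factor.
  have h2 : (g • M).1 * rightRep D ℬ e U₁ (D.of g) =
      sgn (D.hdeg g) • (rightRep D ℬ e U₁ (D.of g) * M.1) := by
    have h := congrArg (fun T => leftRep D ℬ e U₁ y * T) h1
    simpa only [mul_smul_comm, ← mul_assoc, ← map_mul, hyx, map_one, one_mul] using h
  ext v
  have h3 := LinearMap.congr_fun h2 (i v)
  rw [LinearMap.smul_apply, Module.End.mul_apply, Module.End.mul_apply] at h3
  rw [LinearMap.smul_apply, Module.End.mul_apply, Module.End.mul_apply,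
    VacuumPart.compress_apply, VacuumPart.compress_apply, hiR, h3, map_smul, hqR]

end Comparison

/-! ### Operators anticommuting with the vectors -/

section Vectors

variable {G : Type u} [Group G] (D : SymmetryData G) {d : ℕ}
variable {V : Type v} [NormedAddCommGroup V] [InnerProductSpace ℝ V]
variable (b : OrthonormalBasis (Fin d) ℝ V)
variable (ρ : Representation ℝ G V) (hρ : ∀ g v, ‖ρ g v‖ = ‖v‖)

/-- The isomorphism `A^{V ⊕ V'} ≃ Cl^{d,d} ⊗̂ A`. -/
def sumEquivTensor : DiracAlg D (sumForm V) (sumRep D ρ) ≃ₐ[ℝ] (clddGrade d) ᵍ⊗[ℝ] D.grade :=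
  (sumEquivDiff D ρ).trans (tensorEquiv D b ρ hρ)

theorem mem_grade_iff_sumEquivTensor (c : ZMod 2) (x : DiracAlg D (sumForm V) (sumRep D ρ)) :
    x ∈ DiracAlg.grade D _ _ c ↔
      sumEquivTensor D b ρ hρ x ∈ tensorGrade (clddGrade d) D.grade c :=
  (mem_grade_iff_sumEquivDiff D ρ c x).trans (mem_grade_iff_tensorEquiv D b ρ hρ c _)

theorem sumEquivTensor_incl (a : D.Alg) :
    sumEquivTensor D b ρ hρ (DiracAlg.incl D _ _ a) = spinTensor D b ρ hρ a := by
  rw [sumEquivTensor, AlgEquiv.trans_apply, sumEquivDiff_incl, tensorEquiv_apply, toTensor_incl]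

theorem sumEquivTensor_vec (v w : V) :
    sumEquivTensor D b ρ hρ (DiracAlg.vec D _ _ (v, w)) =
      posC b v ᵍ⊗ₜ[ℝ] 1 + (1 ᵍ⊗ₜ[ℝ] D.scalar Complex.I) * (negC b w ᵍ⊗ₜ[ℝ] 1) := by
  rw [sumEquivTensor, AlgEquiv.trans_apply, sumEquivDiff_vec, tensorEquiv_apply, map_add, map_mul,
    toTensor_vec, toTensor_vec, toTensor_incl, spinTensor_scalar, vecC_apply, vecC_apply]
  simp

theorem incl_scalar_eq (z : ℂ) : DiracAlg.incl D (sumForm V) (sumRep D ρ) (D.scalar z) =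
    rightFactor D (sumEquivTensor D b ρ hρ) (D.scalar z) := by
  rw [rightFactor_apply, AlgEquiv.eq_symm_apply, sumEquivTensor_incl, spinTensor_scalar]

theorem incl_of_eq (g : G) : DiracAlg.incl D (sumForm V) (sumRep D ρ) (D.of g) =
    leftFactor D (sumEquivTensor D b ρ hρ) (spinElt b ρ hρ g) *
      rightFactor D (sumEquivTensor D b ρ hρ) (D.of g) := by
  rw [leftFactor_mul_rightFactor, AlgEquiv.eq_symm_apply, sumEquivTensor_incl, spinTensor_of]

theorem vec_eq (v w : V) : DiracAlg.vec D (sumForm V) (sumRep D ρ) (v, w) =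
    leftFactor D (sumEquivTensor D b ρ hρ) (posC b v) +
      DiracAlg.incl D _ _ (D.scalar Complex.I) *
        leftFactor D (sumEquivTensor D b ρ hρ) (negC b w) := by
  apply (sumEquivTensor D b ρ hρ).injective
  rw [sumEquivTensor_vec, map_add, map_mul, sumEquivTensor_incl, spinTensor_scalar,
    leftFactor_apply, leftFactor_apply, AlgEquiv.apply_symm_apply, AlgEquiv.apply_symm_apply]

variable {U : Type*} [AddCommGroup U] [Module ℝ U]
  [Module (Ham (DiracAlg.grade D (sumForm V) (sumRep D ρ))) U]
  [IsScalarTower ℝ (Ham (DiracAlg.grade D (sumForm V) (sumRep D ρ))) U]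

/-- The vectors act as positive generators and as `i` times negative generators. Since `M` commutes
with `i`, anticommuting with the vectors is the same as anticommuting with all generators of
`Cl^{d,d}`, and this extends multiplicatively to the graded rule. -/
theorem anticomm_vec_iff (M : Module.End ℝ U)
    (hM : ∀ z, M * rep (DiracAlg.grade D (sumForm V) (sumRep D ρ)) U
        (DiracAlg.incl D _ _ (D.scalar z)) =
      rep (DiracAlg.grade D (sumForm V) (sumRep D ρ)) U (DiracAlg.incl D _ _ (D.scalar z)) * M) :
    (∀ x ∈ Set.range (DiracAlg.vec D (sumForm V) (sumRep D ρ)),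
      M * rep (DiracAlg.grade D (sumForm V) (sumRep D ρ)) U x =
        -(rep (DiracAlg.grade D (sumForm V) (sumRep D ρ)) U x * M)) ↔
    ∀ c, M * leftRep D (DiracAlg.grade D (sumForm V) (sumRep D ρ)) (sumEquivTensor D b ρ hρ) U c =
      leftRep D (DiracAlg.grade D (sumForm V) (sumRep D ρ)) (sumEquivTensor D b ρ hρ) U
        (parityHom (clddGrade d) c) * M := by
  set L := leftRep D (DiracAlg.grade D (sumForm V) (sumRep D ρ)) (sumEquivTensor D b ρ hρ) U with hL
  set I := rep (DiracAlg.grade D (sumForm V) (sumRep D ρ)) U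
    (DiracAlg.incl D (sumForm V) (sumRep D ρ) (D.scalar Complex.I)) with hI
  have hII : I * I = -1 := by
    rw [hI, ← map_mul, ← map_mul, ← map_mul, Complex.I_mul_I, map_neg, map_neg, map_neg, map_one,
      map_one, map_one]
  have hv : ∀ v w, rep (DiracAlg.grade D (sumForm V) (sumRep D ρ)) U
      (DiracAlg.vec D (sumForm V) (sumRep D ρ) (v, w)) =
      L (posC b v) + I * L (negC b w) := fun v w => by
    rw [vec_eq D b ρ hρ, map_add, map_mul]
    rfl
  have hpos : ∀ v, parityHom (clddGrade d) (posC b v) = -posC b v := fun v => by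
    rw [parityHom_of_mem _ (posC_mem b v), sgn_one, neg_one_smul]
  have hneg : ∀ v, parityHom (clddGrade d) (negC b v) = -negC b v := fun v => by
    rw [parityHom_of_mem _ (negC_mem b v), sgn_one, neg_one_smul]
  have hMI : M * I = I * M := hM Complex.I
  constructor
  · intro h c
    have h' : ∀ v w, M * (L (posC b v) + I * L (negC b w)) =
        -((L (posC b v) + I * L (negC b w)) * M) := fun v w => by
      rw [← hv]; exact h _ ⟨_, rfl⟩
    induction c using cldd_induction b with
    | hr r =>
      rw [AlgHom.commutes, AlgHom.commutes, AlgHom.commutes]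
      exact (Algebra.commutes r M).symm
    | hpos v =>
      have := h' v 0
      rw [map_zero, map_zero, mul_zero, add_zero] at this
      rw [this, hpos, map_neg, neg_mul]
    | hneg v =>
      have := h' 0 v
      rw [map_zero, map_zero, zero_add, ← mul_assoc, hMI, mul_assoc] at this
      -- A second factor `i` cancels the one attached to the negative generator, up to the sign `i²
      -- = -1`.
      have h2 := congrArg (fun T => I * T) this
      simp only [mul_neg, ← mul_assoc, hII, neg_mul, one_mul] at h2
      rw [hneg, map_neg, neg_mul, ← neg_inj, h2, neg_neg]
    | hadd x y hx hy => rw [map_add, map_add, map_add, mul_add, add_mul, hx, hy]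
    | hmul x y hx hy =>
      rw [map_mul, map_mul, map_mul, ← mul_assoc, hx, mul_assoc, hy, mul_assoc]
  · rintro h _ ⟨⟨v, w⟩, rfl⟩
    rw [hv, mul_add, ← mul_assoc, hMI, mul_assoc, h, h, hpos, hneg, map_neg, map_neg, add_mul]
    simp only [neg_mul, mul_neg, mul_assoc, neg_add]

end Vectors

end FreeFermion

end

/-! ### Assembly of both statements. -/

open FreeFermion in
theorem mainTheorem3 {G : Type*} [Group G] (D : SymmetryData G) {d : ℕ}
    {V : Type*} [NormedAddCommGroup V] [InnerProductSpace ℝ V] (b : OrthonormalBasis (Fin d) ℝ V)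
    (ρ : Representation ℝ G V) (hρ : ∀ g v, ‖ρ g v‖ = ‖v‖) :
    (∃ (Φ₁ : DiracAlg D (sumForm V) (sumRep D ρ) ≃ₐ[ℝ]
          DiracAlg D (diffForm V) (ρ.prod ρ))
        (Φ₂ : DiracAlg D (diffForm V) (ρ.prod ρ) ≃ₐ[ℝ]
          (tensorGrade (clGrade d 0) (clGrade 0 d)) ᵍ⊗[ℝ] D.grade),
        (∀ c x, x ∈ DiracAlg.grade D _ _ c ↔ Φ₁ x ∈ DiracAlg.grade D _ _ c) ∧
        (∀ a : D.Alg, Φ₁ (DiracAlg.incl D _ _ a) = DiracAlg.incl D _ _ a) ∧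
        (∀ v : V, Φ₁ (DiracAlg.vec D _ _ (v, 0)) = DiracAlg.vec D _ _ (v, 0)) ∧
        (∀ v : V, Φ₁ (DiracAlg.vec D _ _ (0, v)) =
          DiracAlg.incl D _ _ (D.scalar Complex.I) * DiracAlg.vec D _ _ (0, v)) ∧
        (∀ c x, x ∈ DiracAlg.grade D _ _ c ↔ Φ₂ x ∈ tensorGrade _ _ c) ∧
        (∀ i, Φ₂ (DiracAlg.vec D _ _ (b i, 0)) = (1 ᵍ⊗ₜ[ℝ] Cl.pos i) ᵍ⊗ₜ[ℝ] 1) ∧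
        (∀ i, Φ₂ (DiracAlg.vec D _ _ (0, b i)) = (Cl.neg i ᵍ⊗ₜ[ℝ] 1) ᵍ⊗ₜ[ℝ] 1) ∧
        (∀ z : ℂ, Φ₂ (DiracAlg.incl D _ _ (D.scalar z)) = 1 ᵍ⊗ₜ[ℝ] D.scalar z) ∧
        (∀ g : G, ∃ x ∈ tensorGrade (clGrade d 0) (clGrade 0 d) 0,
          Φ₂ (DiracAlg.incl D _ _ (D.of g)) = x ᵍ⊗ₜ[ℝ] D.of g)) ∧
    ∀ {U₁ : Type*} [AddCommGroup U₁] [Module ℝ U₁]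
      [Module (Ham (DiracAlg.grade D (sumForm V) (sumRep D ρ))) U₁]
      [IsScalarTower ℝ (Ham (DiracAlg.grade D (sumForm V) (sumRep D ρ))) U₁]
      (𝒮₁ : UniverseDecomposition (Ham (DiracAlg.grade D (sumForm V) (sumRep D ρ))) U₁)
      {U₀ : Type*} [AddCommGroup U₀] [Module ℝ U₀] [Module (Ham D.grade) U₀]
      [IsScalarTower ℝ (Ham D.grade) U₀] (𝒮₀ : UniverseDecomposition (Ham D.grade) U₀),
      BasedGHomotopyEquivalent G
        (ClSpace.base D (DiracAlg.incl D _ _) (Set.range (DiracAlg.vec D _ _)) 𝒮₁)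
        (ClSpace.base D (AlgHom.id ℝ D.Alg) ∅ 𝒮₀) := by
  refine ⟨⟨sumEquivDiff D ρ, tensorEquiv D b ρ hρ, mem_grade_iff_sumEquivDiff D ρ,
    sumEquivDiff_incl D ρ, fun v => ?_, fun v => ?_, mem_grade_iff_tensorEquiv D b ρ hρ,
    fun i => ?_, fun i => ?_, fun z => ?_, fun g => ⟨_, spinElt_mem b ρ hρ g, ?_⟩⟩, ?_⟩
  · rw [sumEquivDiff_vec, Prod.mk_zero_zero, map_zero, mul_zero, add_zero]
  · rw [sumEquivDiff_vec, Prod.mk_zero_zero, map_zero, zero_add]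
  · rw [tensorEquiv_apply, toTensor_vec, vecC_apply, posC_basis, map_zero, add_zero]
  · rw [tensorEquiv_apply, toTensor_vec, vecC_apply, negC_basis, map_zero, zero_add]
  · rw [tensorEquiv_apply, toTensor_incl, spinTensor_scalar]
  · rw [tensorEquiv_apply, toTensor_incl, spinTensor_of]
  · intro U₁ _ _ _ _ 𝒮₁ U₀ _ _ _ _ 𝒮₀
    exact basedGHomotopyEquivalent_of_vacuum D (sumEquivTensor D b ρ hρ)
      (mem_grade_iff_sumEquivTensor D b ρ hρ) (cliffordVacuum b) _ _ 𝒮₁ 𝒮₀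
      (anticomm_vec_iff D b ρ hρ) (incl_scalar_eq D b ρ hρ)
      fun g => ⟨_, _, parityHom_spinElt b ρ hρ g, spinElt_inv_mul b ρ hρ g,
        incl_of_eq D b ρ hρ g⟩
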